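/- Let $S^2\subset\mathbb R^3$ be the unit sphere with surface measure $\sigma$, let $Y_{\ell,m}$ ($\ell\ge 0$, $-\ell\le m\le \ell$) be Laplace's spherical harmonics, and for $f\in L^2(S^2)$ (complex valued) put $f_{\ell,m}=\int_{S^2} f\,\overline{Y_{\ell,m}}\,d\sigma$ and $A_\ell(f)=\sum_{m=-\ell}^{\ell}|f_{\ell,m}|^2$. For $s\ge 0$ let $$H^s(S^2)=\Big\{f\in L^2(S^2):\ [f]_{H^s}^2:=\sum_{\ell\ge 0}A_\ell(f)\,\ell^{2s}<\infty\Big\},\qquad \|f\|_{H^s}=\|f\|_{L^2}+[f]_{H^s}.$$ For $\mu\in\mathbb R$ let $\mathcal G_\mu=\Delta_{S^2}+X_\mu$, where $\Delta_{S^2}$ is the (weak) Laplace–Beltrami operator and $X_\mu=\mu\,\partial/\partial\varphi$ ($\varphi$ the longitude). Let $\alpha\in(0,1)$, $\Phi(\lambda)=\lambda^\alpha$, let $\nu_\Phi$ be its Lévy measure, that is, the measure on $(0,\infty)$ with $\int_0^\infty (1\wedge t)\,\nu_\Phi(dt)<\infty$, $\nu_\Phi(0,\infty)=\infty$ and $\Phi(\lambda)=\int_0^\infty(1-e^{-\lambda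 t})\,\nu_\Phi(dt)$ for all $\lambda\ge 0$, and let $\overline\nu_\Phi(t)=\nu_\Phi(t,\infty)$. For a function $u$ on $[0,\infty)$ with values in a Banach space put $$\frac{d^\Phi u}{dt^\Phi}(t)=\frac{d}{dt}\int_0^t\overline\nu_\Phi(t-\tau)\,\big(u(\tau)-u(0^+)\big)\,d\tau,\qquad t>0,$$ with a Bochner integral and a derivative in norm. For $f\in H^s(S^2)$, a strong solution in $H^s(S^2)$ of $$\frac{d^\Phi u}{dt^\Phi}(t)=\mathcal G_\mu u(t)\quad(t>0),\qquad u(0)=f, \tag{1}$$ is a function $u\in C([0,\infty);H^s(S^2))\cap C((0,\infty);H^{s+2}(S^2))$ for which $d^\Phi u/dt^\Phi$ exists in $H^s(S^2)$ at every $t>0$, belongs to $C((0,\infty);H^s(S^2))$, and (1) holds. **Proposition.** Let $\alpha\in(0,1)$, $\mu\in\mathbb R$ and $s>1$. The series $$f=\sum_{\ell=2}^{\infty}\frac{1}{\ell^{\,s+1/2}\log \ell}\,Y_{\ell,0}$$ converges in $L^2(S^2)$ and defines a function $f\in H^s(S^2)$. For this $f$, problem (1) has a unique strong solution $u$ in $H^s(S^2)$,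 and for all $t>0$ and all $\varepsilon>0$ $$u(t)\notin H^{s+2+\varepsilon}(S^2).$$ -/

import Mathlib

open MeasureTheory Set Filter Topology
open scoped ComplexConjugate

namespace SphereKolmogorov

noncomputable section

/-! ### The sphere, its surface measure and the spherical harmonics -/

/-- Euclidean three-space. -/
abbrev E3 : Type := EuclideanSpace ℝ (Fin 3)

/-- The unit sphere of Euclidean three-space. -/
abbrev S2 : Type := Metric.sphere (0 : E3) 1

/-- The surface measure of the unit sphere (total mass `4 π`). -/
def surf : Measure S2 := (volume : Measure E3).toSphere

instance surf_isFiniteMeasure : IsFiniteMeasure surf := by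
  unfold surf; infer_instance

/-- `L²(S²)`, complex valued. -/
abbrev L2S : Type := Lp ℂ 2 surf

/-- Laplace's spherical harmonic `Y_{l,k}` for a non-negative order `k`. With
`x = (sin θ cos φ, sin θ sin φ, cos θ)` one has `(sin θ) ^ k * e ^ (i k φ) = (x₀ + i x₁) ^ k`, so
that `P_l^k (cos θ) * e ^ (i k φ)`, where
`P_l^k (z) = (-1) ^ k / (2 ^ l l!) * (1 - z ^ 2) ^ (k / 2) * (d / dz) ^ (l + k) (z ^ 2 - 1) ^ l`,
is the polynomial in the Cartesian coordinates written here. -/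
def sphHarmNonneg (l k : ℕ) : C(S2, ℂ) where
  toFun x :=
    ((Real.sqrt ((2 * l + 1) * (l - k).factorial / (4 * Real.pi * (l + k).factorial))
      * ((-1) ^ k / (2 ^ l * l.factorial))
      * ((Polynomial.derivative^[l + k]
          ((Polynomial.X ^ 2 - 1 : Polynomial ℝ) ^ l)).eval (x.1 2)) : ℝ) : ℂ)
      * ((x.1 0 : ℂ) + Complex.I * (x.1 1 : ℂ)) ^ k
  continuous_toFun := by
    have h (i : Fin 3) : Continuous fun x : S2 => x.1 i := by fun_prop
    refine Continuous.mul (Complex.continuous_ofReal.comp (continuous_const.mul ?_)) ?_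
    · exact (Polynomial.continuous _).comp (h 2)
    · exact ((Complex.continuous_ofReal.comp (h 0)).add
        (continuous_const.mul (Complex.continuous_ofReal.comp (h 1)))).pow k

/-- Laplace's spherical harmonics `Y_{l,m}`, with `Y_{l,-k} = (-1) ^ k * conj Y_{l,k}`.
They are used for `-l ≤ m ≤ l`. -/
def sphHarm (l : ℕ) (m : ℤ) : C(S2, ℂ) :=
  if 0 ≤ m then sphHarmNonneg l m.natAbs
  else ((-1 : ℂ) ^ m.natAbs) • star (sphHarmNonneg l m.natAbs)

/-- The spherical harmonic `Y_{l,m}` as an element of `L²(S²)`. -/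
def sphHarmL2 (l : ℕ) (m : ℤ) : L2S := ContinuousMap.toLp 2 surf ℂ (sphHarm l m)

/-- The Fourier-Laplace coefficient `f_{l,m}`. -/
def coeff (l : ℕ) (m : ℤ) (f : L2S) : ℂ := ∫ x, f x * conj (sphHarm l m x) ∂surf

lemma coeff_eq_inner (l : ℕ) (m : ℤ) (f : L2S) : coeff l m f = inner ℂ (sphHarmL2 l m) f := by
  rw [coeff, L2.inner_def]
  refine integral_congr_ae ?_
  filter_upwards [ContinuousMap.coeFn_toLp (p := 2) (𝕜 := ℂ) surf (sphHarm l m)] with x hx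
  rw [sphHarmL2, hx]
  simp

/-- The power spectrum `A_l(f)`. -/
def powerSpectrum (l : ℕ) (f : L2S) : ℝ := ∑ m ∈ Finset.Icc (-(l : ℤ)) l, ‖coeff l m f‖ ^ 2

/-! ### The Sobolev spaces `H^s(S²)` -/

/-- The coefficients of degree `l`, weighted by `l ^ s`, as a vector. -/
def wvec (s : ℝ) (l : ℕ) : L2S →ₗ[ℂ] EuclideanSpace ℂ (Finset.Icc (-(l : ℤ)) l) where
  toFun f := WithLp.toLp 2 fun m => (((l : ℝ) ^ s : ℝ) : ℂ) * coeff l m f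
  map_add' f g := by ext m; simp [coeff_eq_inner, inner_add_right, mul_add]
  map_smul' c f := by ext m; simp [coeff_eq_inner, inner_smul_right]; ring

lemma norm_wvec_sq (s : ℝ) (l : ℕ) (f : L2S) :
    ‖wvec s l f‖ ^ 2 = powerSpectrum l f * (l : ℝ) ^ (2 * s) := by
  rw [EuclideanSpace.norm_sq_eq, powerSpectrum, Finset.sum_mul,
    ← Finset.sum_coe_sort (Finset.Icc (-(l : ℤ)) l)]
  refine Finset.sum_congr rfl fun m _ => ?_
  have : (l : ℝ) ^ (2 * s) = ((l : ℝ) ^ s) ^ 2 := by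
    rw [mul_comm, Real.rpow_mul (Nat.cast_nonneg l)]; norm_cast
  rw [this]
  simp only [wvec, LinearMap.coe_mk, AddHom.coe_mk, norm_mul, Complex.norm_real, Real.norm_eq_abs,
    mul_pow, sq_abs]
  ring

lemma memlp_wvec_iff (s : ℝ) (f : L2S) :
    Memℓp (fun l => wvec s l f) 2 ↔ Summable fun l : ℕ => powerSpectrum l f * (l : ℝ) ^ (2 * s) := by
  rw [memℓp_gen_iff (by norm_num)]
  simp only [ENNReal.toReal_ofNat, Real.rpow_ofNat, norm_wvec_sq]

/-- `H^s(S²)` as a linear subspace of `L²(S²)`: the functions with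
`∑ l, A_l(f) * l ^ (2 s) < ∞`. -/
def sobolev (s : ℝ) : Submodule ℂ L2S where
  carrier := {f | Summable fun l : ℕ => powerSpectrum l f * (l : ℝ) ^ (2 * s)}
  zero_mem' := by
    simp only [mem_ofPred_eq, ← memlp_wvec_iff, map_zero]
    exact zero_memℓp
  add_mem' {f g} hf hg := by
    simp only [mem_ofPred_eq, ← memlp_wvec_iff, map_add] at *
    exact hf.add hg
  smul_mem' c f hf := by
    simp only [mem_ofPred_eq, ← memlp_wvec_iff, map_smul] at *
    exact hf.const_smul c

/-- The seminorm `[f]_{H^s} = (∑ l, A_l(f) * l ^ (2 s)) ^ (1 / 2)`. -/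
def sobSeminorm (s : ℝ) (f : L2S) : ℝ :=
  Real.sqrt (∑' l : ℕ, powerSpectrum l f * (l : ℝ) ^ (2 * s))

/-- `H^s(S²)` as a type of its own; it carries the norm `‖f‖_{L²} + [f]_{H^s}`, not the norm of
`L²(S²)`. -/
def Sob (s : ℝ) : Type := ↥(sobolev s)

instance (s : ℝ) : AddCommGroup (Sob s) := inferInstanceAs (AddCommGroup ↥(sobolev s))
instance (s : ℝ) : Module ℂ (Sob s) := inferInstanceAs (Module ℂ ↥(sobolev s))

/-- The inclusion of `H^s(S²)` in `L²(S²)`. -/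
def Sob.toL2 {s : ℝ} : Sob s →ₗ[ℂ] L2S := (sobolev s).subtype

lemma Sob.toL2_injective {s : ℝ} : Function.Injective (Sob.toL2 (s := s)) :=
  (sobolev s).injective_subtype

/-- The weighted coefficients as a linear map to a Hilbert sum. -/
def Sob.wlp {s : ℝ} :
    Sob s →ₗ[ℂ] lp (fun l : ℕ => EuclideanSpace ℂ (Finset.Icc (-(l : ℤ)) l)) 2 where
  toFun f := ⟨fun l => wvec s l f.toL2, (memlp_wvec_iff s f.toL2).2 f.2⟩
  map_add' f g := by ext1; funext l; exact (wvec s l).map_add f.toL2 g.toL2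
  map_smul' c f := by ext1; funext l; exact (wvec s l).map_smul c f.toL2

lemma Sob.norm_wlp {s : ℝ} (f : Sob s) : ‖f.wlp‖ = sobSeminorm s f.toL2 := by
  have h := lp.norm_eq_tsum_rpow (p := 2) (by norm_num) f.wlp
  rw [h, sobSeminorm, Real.sqrt_eq_rpow]
  simp only [wlp, LinearMap.coe_mk, AddHom.coe_mk, ENNReal.toReal_ofNat, Real.rpow_ofNat,
    norm_wvec_sq]

instance (s : ℝ) : NormedAddCommGroup (Sob s) :=
  AddGroupNorm.toNormedAddCommGroup
    { toFun := fun f => ‖f.toL2‖ + sobSeminorm s f.toL2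
      map_zero' := by rw [← Sob.norm_wlp]; simp
      add_le' := fun f g => by
        rw [← Sob.norm_wlp, ← Sob.norm_wlp, ← Sob.norm_wlp, map_add, map_add]
        have h1 := norm_add_le f.toL2 g.toL2
        have h2 := norm_add_le f.wlp g.wlp
        linarith
      neg' := fun f => by rw [← Sob.norm_wlp, ← Sob.norm_wlp, map_neg, map_neg, norm_neg, norm_neg]
      eq_zero_of_map_eq_zero' := fun f hf => by
        have h1 : 0 ≤ ‖f.toL2‖ := norm_nonneg _
        have h2 : 0 ≤ sobSeminorm s f.toL2 := Real.sqrt_nonneg _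
        refine Sob.toL2_injective ?_
        rw [map_zero, ← norm_eq_zero]
        exact le_antisymm (by linarith) h1 }

lemma Sob.norm_def {s : ℝ} (f : Sob s) : ‖f‖ = ‖f.toL2‖ + sobSeminorm s f.toL2 := rfl

instance (s : ℝ) : NormedSpace ℂ (Sob s) where
  norm_smul_le c f := by
    rw [Sob.norm_def, Sob.norm_def, ← Sob.norm_wlp, ← Sob.norm_wlp, map_smul, map_smul, norm_smul,
      norm_smul, mul_add]

/-- `H^s(S²)` is a Banach space, so that Bochner integrals in it are meaningful. -/
instance (s : ℝ) : CompleteSpace (Sob s) := by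
  refine Metric.complete_of_cauchySeq_tendsto fun u hu => ?_
  have hle1 (f : Sob s) : ‖f.toL2‖ ≤ ‖f‖ := by
    rw [Sob.norm_def]; exact le_add_of_nonneg_right (Real.sqrt_nonneg _)
  have hle2 (f : Sob s) : ‖f.wlp‖ ≤ ‖f‖ := by
    rw [Sob.norm_def, ← Sob.norm_wlp]; exact le_add_of_nonneg_left (norm_nonneg _)
  have hc1 : CauchySeq fun n => (u n).toL2 := by
    rw [Metric.cauchySeq_iff] at hu ⊢
    intro ε hε
    obtain ⟨N, hN⟩ := hu ε hε
    refine ⟨N, fun m hm n hn => lt_of_le_of_lt ?_ (hN m hm n hn)⟩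
    rw [dist_eq_norm, dist_eq_norm, ← map_sub]
    exact hle1 _
  have hc2 : CauchySeq fun n => (u n).wlp := by
    rw [Metric.cauchySeq_iff] at hu ⊢
    intro ε hε
    obtain ⟨N, hN⟩ := hu ε hε
    refine ⟨N, fun m hm n hn => lt_of_le_of_lt ?_ (hN m hm n hn)⟩
    rw [dist_eq_norm, dist_eq_norm, ← map_sub]
    exact hle2 _
  obtain ⟨f, hf⟩ := cauchySeq_tendsto_of_complete hc1
  obtain ⟨g, hg⟩ := cauchySeq_tendsto_of_complete hc2
  have hgf : ∀ l, g l = wvec s l f := by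
    intro l
    have ha : Tendsto (fun n => (u n).wlp l) atTop (𝓝 (g l)) := by
      rw [tendsto_iff_norm_sub_tendsto_zero] at hg ⊢
      refine squeeze_zero (fun _ => norm_nonneg _) (fun n => ?_) hg
      have := lp.norm_apply_le_norm (p := 2) (by norm_num) ((u n).wlp - g) l
      simpa using this
    ext m
    have hb : Tendsto (fun n => (u n).wlp l m) atTop (𝓝 (g l m)) :=
      ((EuclideanSpace.proj (𝕜 := ℂ) m).continuous.tendsto _).comp ha
    have hd : Tendsto (fun n => (u n).wlp l m) atTop (𝓝 (wvec s l f m)) := by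
      have : Continuous fun v : L2S => wvec s l v m := by
        simp only [wvec, LinearMap.coe_mk, AddHom.coe_mk, coeff_eq_inner]
        fun_prop
      exact (this.tendsto f).comp hf
    exact tendsto_nhds_unique hb hd
  have hmem : f ∈ sobolev s := by
    refine (memlp_wvec_iff s f).1 ?_
    have h := g.2
    have e : (fun l => wvec s l f) = (g : ∀ l, _) := funext fun l => (hgf l).symm
    rw [e]; exact h
  let F : Sob s := ⟨f, hmem⟩
  have hF : F.wlp = g := by
    ext1; funext l; exact (hgf l).symm
  refine ⟨F, ?_⟩
  rw [tendsto_iff_norm_sub_tendsto_zero] at hf hg ⊢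
  have := hf.add hg
  rw [add_zero] at this
  refine this.congr fun n => ?_
  rw [Sob.norm_def, ← Sob.norm_wlp, map_sub, map_sub, hF]
  rfl

/-! ### The operator `Δ + X_μ` -/

/-- The `0`-homogeneous extension `x ↦ h (x / |x|)` of a function on the sphere. -/
def homExt (h : S2 → ℂ) (x : E3) : ℂ :=
  if hx : x = 0 then 0
  else h ⟨‖x‖⁻¹ • x, by simp [norm_smul, norm_ne_zero_iff.2 hx]⟩

/-- `h ∈ C²(S²)`. -/
def IsC2 (h : S2 → ℂ) : Prop := ContDiffOn ℝ 2 (homExt h) {0}ᶜ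

/-- The Laplace-Beltrami operator on `C²(S²)`. -/
def lapC2 (h : S2 → ℂ) (x : S2) : ℂ := Laplacian.laplacian (homExt h) x.1

/-- The longitudinal drift `X_μ = μ ∂/∂φ` on `C¹` functions: at `x` it is the derivative in the
direction `μ (-x₁, x₀, 0)`. -/
def driftC1 (μ : ℝ) (h : S2 → ℂ) (x : S2) : ℂ :=
  fderiv ℝ (homExt h) x.1 (μ • !₂[-(x.1 1), x.1 0, 0])

/-- `w` is the weak Laplacian of `v`. -/
def IsWeakLaplacian (v w : L2S) : Prop :=
  ∀ h : S2 → ℂ, IsC2 h →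
    ∫ x, w x * conj (h x) ∂surf = ∫ x, v x * conj (lapC2 h x) ∂surf

/-- `w = X_μ v` weakly (the vector field `X_μ` is real and divergence free). -/
def IsWeakDrift (μ : ℝ) (v w : L2S) : Prop :=
  ∀ h : S2 → ℂ, IsC2 h →
    ∫ x, w x * conj (h x) ∂surf = -∫ x, v x * conj (driftC1 μ h x) ∂surf

/-- `w = (Δ + X_μ) v`. -/
def IsGenerator (μ : ℝ) (v w : L2S) : Prop :=
  ∃ a b : L2S, IsWeakLaplacian v a ∧ IsWeakDrift μ v b ∧ w = a + b

/-! ### The nonlocal time derivative -/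

/-- `Φ` is the Bernstein function, without drift and killing and with infinite activity, of the
Lévy measure `ν` on `(0, ∞)`. Only the restriction of `ν` to `(0, ∞)` matters. -/
structure IsLevyMeasure (Φ : ℝ → ℝ) (ν : Measure ℝ) : Prop where
  lintegral_lt_top : ∫⁻ t in Ioi (0 : ℝ), ENNReal.ofReal (min 1 t) ∂ν < ⊤
  infinite : ν (Ioi 0) = ⊤
  laplace : ∀ z : ℝ, 0 ≤ z → Φ z = ∫ t in Ioi (0 : ℝ), (1 - Real.exp (-(z * t))) ∂ν

/-- The tail `t ↦ ν (t, ∞)` of a Lévy measure. -/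
def tail (ν : Measure ℝ) (t : ℝ) : ℝ := ν.real (Ioi t)

/-- `d` is the value at time `t > 0` of the Caputo-type derivative of `u : [0, ∞) → B`, that is, of
`d/dt ∫_0^t ν(t - τ, ∞) (u(τ) - u(0+)) dτ` with a Bochner integral in `B` and a derivative in the
norm of `B`. -/
def HasNonlocalDerivAt {B : Type*} [NormedAddCommGroup B] [NormedSpace ℝ B]
    (ν : Measure ℝ) (u : ℝ → B) (d : B) (t : ℝ) : Prop :=
  ∃ u₀ : B, Tendsto u (𝓝[>] 0) (𝓝 u₀) ∧
    (∀ᶠ r in 𝓝 t,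
      IntervalIntegrable (fun τ => tail ν (r - τ) • (u τ - u₀)) volume 0 r) ∧
    HasDerivAt (fun r => ∫ τ in (0 : ℝ)..r, tail ν (r - τ) • (u τ - u₀)) d t

/-- `u` is a strong solution in `H^s(S²)` of the time-nonlocal Kolmogorov equation
`∂^Φ u / ∂t^Φ = (Δ + X_μ) u` for `t > 0`, `u(0) = f`; here `ν` is the Lévy measure of `Φ`, and only
the values `u t` with `0 ≤ t` matter. -/
structure IsStrongSolution (μ : ℝ) (ν : Measure ℝ) {s : ℝ} (f : Sob s) (u : ℝ → Sob s) : Prop where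
  /-- `u ∈ C([0, ∞); H^s)` -/
  continuousOn : ContinuousOn u (Ici 0)
  /-- `u ∈ C((0, ∞); H^{s+2})` -/
  smoothing : ∃ v : ℝ → Sob (s + 2), ContinuousOn v (Ioi 0) ∧
    ∀ t, 0 < t → (v t).toL2 = (u t).toL2
  /-- The nonlocal derivative exists in `H^s`, lies in `C((0, ∞); H^s)`, and satisfies the
  equation. -/
  equation : ∃ d : ℝ → Sob s, ContinuousOn d (Ioi 0) ∧
    ∀ t, 0 < t → HasNonlocalDerivAt ν u (d t) t ∧ IsGenerator μ (u t).toL2 (d t).toL2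
  initial : u 0 = f

end

end SphereKolmogorov

open MeasureTheory Set Filter Topology
open scoped ComplexConjugate

namespace SphereKolmogorov

noncomputable section

/-! ### Laplace transforms and the tail of the Lévy measure -/

/-! Write a_l = 1 / (l^{s+1/2} log l). Zonal functions do not feel the drift and Δ Y_{l,0} = -l(l+1)
Y_{l,0}, so the equation decouples into scalar relaxation equations and u(t) = ∑ a_l E_α(-l(l+1)
t^α) Y_{l,0}. Everything rests on the two-sided algebraic bound c/(1+x) ≤ E_α(-x) ≤ C/x. The upper
half (`mul_relaxRate_le`) yields the gain of two orders, with majorants that also give continuity in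
time. The lower half (`exists_le_relaxRate`) forbids any further gain: A_l(f) l^{2s} = 1/(l log² l),
so the terms of the squared seminorm of u(t) in H^{s+2+ε} are at least a constant times l^{2ε}/(l
log² l), and their sum diverges.

These bounds are obtained without complete monotonicity. Put E(t) = E_α(-t^α), r = -E' and k(t) =
t^{-α}/Γ(1-α). Termwise Beta integrals give E = k * r and k * (1 - E) = ∫ E. A minimum principle
shows r ≥ 0 (`mlKernel_self_nonneg`). Since E and k decrease, the second identity gives t E(t) ≤ ∫ k
and the first gives k(t)(1 - E(t)) ≤ E(t).

The Lévy measure is known only through its exponent. The Laplace transform of its tail is Φ(z)/z,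
and injectivity of the Laplace transform identifies the tail with k almost everywhere
(`IsLevyMeasure.tail_rpow`).

For uniqueness a competitor need not be zonal. Testing the weak generator with Y_{l,m} makes every
coefficient c of the difference of two solutions satisfy (k * c)' = z c. The primitive of c then
solves a fractional Volterra equation that has only the zero solution
(`eq_zero_of_eq_integral_rlKernel`), and completeness of the harmonics concludes.

The facts about the sphere come from rotations. The Laplace–Beltrami operator is the sum of the
squares of the three rotation fields (`lapC2_eq_lieLap`), and invariance of the surface measure
provides integration by parts. The harmonics are restrictions of polynomials, so their eigenvalues
follow from a recurrence for the derivatives of (X² - 1)^l, and their completeness from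
Stone–Weierstrass. -/

lemma integrableOn_comp_exp_mul {ψ g : ℝ → ℝ} (hψ : IntegrableOn ψ (Ioi 0))
    (hg : ContinuousOn g (Icc 0 1)) :
    IntegrableOn (fun t => g (Real.exp (-t)) * ψ t) (Ioi 0) := by
  obtain ⟨C, hC⟩ := isCompact_Icc.exists_bound_of_continuousOn hg
  have hmaps : MapsTo (fun t : ℝ => Real.exp (-t)) (Ioi 0) (Icc 0 1) := fun t ht =>
    ⟨(Real.exp_pos _).le, Real.exp_le_one_iff.2 (by simpa using (mem_Ioi.1 ht).le)⟩
  refine Integrable.bdd_mul (c := C) hψ ?_ ?_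
  · exact (hg.comp (by fun_prop) hmaps).aestronglyMeasurable measurableSet_Ioi
  · filter_upwards [ae_restrict_mem measurableSet_Ioi] with t ht
    exact hC _ (hmaps ht)

/-- The hypothesis says that ψ annihilates all polynomials in x = e^{-t}; Weierstrass approximation
on [0, 1] extends this to continuous functions of x. -/
lemma integral_comp_exp_mul_eq_zero {ψ : ℝ → ℝ} (hψ : IntegrableOn ψ (Ioi 0))
    (h : ∀ n : ℕ, ∫ t in Ioi 0, Real.exp (-t) ^ n * ψ t = 0)
    {g : ℝ → ℝ} (hg : ContinuousOn g (Icc 0 1)) :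
    ∫ t in Ioi 0, g (Real.exp (-t)) * ψ t = 0 := by
  have hmaps : MapsTo (fun t : ℝ => Real.exp (-t)) (Ioi 0) (Icc 0 1) := fun t ht =>
    ⟨(Real.exp_pos _).le, Real.exp_le_one_iff.2 (by simpa using (mem_Ioi.1 ht).le)⟩
  have hpoly (p : Polynomial ℝ) : ∫ t in Ioi 0, p.eval (Real.exp (-t)) * ψ t = 0 := by
    induction p using Polynomial.induction_on' with
    | add p q hp hq =>
      simp only [Polynomial.eval_add, add_mul]
      rw [integral_add, hp, hq, add_zero]
      · exact integrableOn_comp_exp_mul hψ p.continuous.continuousOn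
      · exact integrableOn_comp_exp_mul hψ q.continuous.continuousOn
    | monomial n a =>
      simp only [Polynomial.eval_monomial, mul_assoc]
      rw [integral_const_mul, h, mul_zero]
  have key (ε : ℝ) (hε : 0 < ε) :
      ‖∫ t in Ioi 0, g (Real.exp (-t)) * ψ t‖ ≤ ε * ∫ t in Ioi 0, ‖ψ t‖ := by
    obtain ⟨p, hp⟩ := exists_polynomial_near_of_continuousOn 0 1 g hg ε hε
    have hsub : ∫ t in Ioi 0, g (Real.exp (-t)) * ψ t
        = ∫ t in Ioi 0, (g (Real.exp (-t)) - p.eval (Real.exp (-t))) * ψ t := by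
      simp only [sub_mul]
      rw [integral_sub (integrableOn_comp_exp_mul hψ hg)
        (integrableOn_comp_exp_mul hψ p.continuous.continuousOn), hpoly, sub_zero]
    rw [hsub, ← integral_const_mul]
    refine norm_integral_le_of_norm_le (hψ.norm.const_mul ε) ?_
    filter_upwards [ae_restrict_mem measurableSet_Ioi] with t ht
    rw [norm_mul]
    gcongr
    rw [Real.norm_eq_abs, abs_sub_comm]
    exact (hp _ (hmaps ht)).le
  have hlim : Tendsto (fun ε : ℝ => ε * ∫ t in Ioi 0, ‖ψ t‖) (𝓝[>] 0) (𝓝 0) := by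
    have : Tendsto (fun ε : ℝ => ε * ∫ t in Ioi 0, ‖ψ t‖) (𝓝 0)
        (𝓝 (0 * ∫ t in Ioi 0, ‖ψ t‖)) :=
      tendsto_id.mul_const _
    rw [zero_mul] at this
    exact this.mono_left nhdsWithin_le_nhds
  have := ge_of_tendsto hlim (a := (0 : ℝ)) (b := ‖∫ t in Ioi 0, g (Real.exp (-t)) * ψ t‖)
    (by filter_upwards [self_mem_nhdsWithin] with ε hε using key ε hε)
  simpa using this

/-- A function on the half-line is determined by its Laplace transform at the positive integers. -/
lemma ae_eq_zero_of_laplace_eq_zero {φ : ℝ → ℝ}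
    (hφ : IntegrableOn (fun t => Real.exp (-t) * φ t) (Ioi 0))
    (h : ∀ n : ℕ, ∫ t in Ioi 0, Real.exp (-((n + 1) * t)) * φ t = 0) :
    ∀ᵐ t, t ∈ Ioi (0 : ℝ) → φ t = 0 := by
  have h' (n : ℕ) : ∫ t in Ioi 0, Real.exp (-t) ^ n * (Real.exp (-t) * φ t) = 0 := by
    refine Eq.trans ?_ (h n)
    refine integral_congr_ae (Eventually.of_forall fun t => ?_)
    simp only
    rw [← mul_assoc, ← pow_succ, ← Real.exp_nat_mul]
    congr 2
    push_cast
    ring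
  suffices H : ∀ g : ℝ → ℝ, ContDiff ℝ (⊤ : ℕ∞) g → HasCompactSupport g → tsupport g ⊆ Ioi 0 →
      ∫ t, g t • (Real.exp (-t) * φ t) = 0 by
    have := IsOpen.ae_eq_zero_of_integral_contDiff_smul_eq_zero (isOpen_Ioi (a := (0 : ℝ)))
      hφ.locallyIntegrableOn H
    filter_upwards [this] with t ht ht0
    exact (mul_eq_zero.1 (ht ht0)).resolve_left (Real.exp_pos _).ne'
  intro g hg hgc hgs
  -- A test function supported in (0, ∞) is a continuous function of x = e^{-t}: it vanishes for
  -- large t, that is, for x near 0.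
  let G : ℝ → ℝ := fun x => g (-Real.log x)
  have hsupp : ∃ R : ℝ, ∀ t, R ≤ t → g t = 0 := by
    obtain ⟨R, hR⟩ := hgc.isCompact.bddAbove
    refine ⟨R + 1, fun t ht => image_eq_zero_of_notMem_tsupport fun hmem => ?_⟩
    have := hR hmem
    linarith
  obtain ⟨R, hR⟩ := hsupp
  -- Since `Real.log 0 = 0`, the value G 0 is g 0, and continuity of G at 0 requires it to vanish.
  have hg0 : g 0 = 0 := image_eq_zero_of_notMem_tsupport fun hmem =>
    lt_irrefl (0 : ℝ) (hgs hmem)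
  have hG : Continuous G := by
    rw [continuous_iff_continuousAt]
    intro x
    by_cases hx : x = 0
    · subst hx
      have : G =ᶠ[𝓝 0] fun _ => 0 := by
        filter_upwards [Metric.ball_mem_nhds (0 : ℝ) (Real.exp_pos (-R))] with y hy
        by_cases hy0 : y = 0
        · simp [G, hy0, hg0]
        · refine hR _ ?_
          have : |y| < Real.exp (-R) := by simpa using hy
          have := (Real.log_lt_iff_lt_exp (abs_pos.2 hy0)).2 this
          rw [Real.log_abs] at this
          linarith
      exact (continuousAt_const (y := (0 : ℝ))).congr this.symm
    · exact (hg.continuous.continuousAt).comp (Real.continuousAt_log hx).neg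
  have := integral_comp_exp_mul_eq_zero hφ h' hG.continuousOn
  simp only [G, Real.log_exp, neg_neg] at this
  have hzero : ∫ t, g t • (Real.exp (-t) * φ t)
      = ∫ t in Ioi 0, g t • (Real.exp (-t) * φ t) := by
    refine (setIntegral_eq_integral_of_forall_compl_eq_zero fun t ht => ?_).symm
    rw [image_eq_zero_of_notMem_tsupport fun hmem => ht (hgs hmem), zero_smul]
  rw [hzero]
  simpa using this

/-! ### The tail of a Lévy measure and its Laplace transform -/

section tail

variable {Φ : ℝ → ℝ} {ν : Measure ℝ}

/-- Markov's inequality for the ν-integrable function min(1, ·), which is at least min(1, t) on (t,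
∞). -/
lemma IsLevyMeasure.measure_Ioi_lt_top (hν : IsLevyMeasure Φ ν) {t : ℝ} (ht : 0 < t) :
    ν (Ioi t) < ⊤ := by
  have hmin : 0 < min 1 t := lt_min one_pos ht
  have h1 : ENNReal.ofReal (min 1 t) * (ν.restrict (Ioi 0))
      {x | ENNReal.ofReal (min 1 t) ≤ ENNReal.ofReal (min 1 x)} < ⊤ :=
    lt_of_le_of_lt (mul_meas_ge_le_lintegral₀ (by fun_prop) _) hν.lintegral_lt_top
  have h2 : ν (Ioi t) ≤ (ν.restrict (Ioi 0))
      {x | ENNReal.ofReal (min 1 t) ≤ ENNReal.ofReal (min 1 x)} := by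
    have : Ioi t = Ioi t ∩ Ioi 0 := (inter_eq_left.2 (Ioi_subset_Ioi ht.le)).symm
    rw [this, ← Measure.restrict_apply measurableSet_Ioi]
    refine measure_mono fun x hx => ?_
    exact ENNReal.ofReal_le_ofReal (min_le_min_left _ (mem_Ioi.1 hx).le)
  refine lt_of_le_of_lt h2 ?_
  by_contra hcon
  rw [not_lt, top_le_iff] at hcon
  rw [hcon, ENNReal.mul_top (by simpa using hmin)] at h1
  exact lt_irrefl _ h1

lemma IsLevyMeasure.aemeasurable_tail (hν : IsLevyMeasure Φ ν) :
    AEMeasurable (tail ν) (volume.restrict (Ioi 0)) := by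
  refine aemeasurable_restrict_of_antitoneOn measurableSet_Ioi fun a ha b _ hab => ?_
  exact ENNReal.toReal_mono (hν.measure_Ioi_lt_top ha).ne (measure_mono (Ioi_subset_Ioi hab))

/-- Layer-cake formula: 1 - e^{-zt} is the integral of z e^{-zs} over (0, t), so integrating against
ν and exchanging the order replaces ν by its tail. -/
lemma IsLevyMeasure.lintegral_tail (hν : IsLevyMeasure Φ ν) {z : ℝ} (hz : 0 < z) :
    ∫⁻ t in Ioi 0, ENNReal.ofReal (tail ν t * (z * Real.exp (-(z * t))))
      = ENNReal.ofReal (Φ z) := by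
  have hprim (t : ℝ) : ∫ s in (0 : ℝ)..t, z * Real.exp (-(z * s)) = 1 - Real.exp (-(z * t)) := by
    have hd (s : ℝ) : HasDerivAt (fun s => - Real.exp (-(z * s))) (z * Real.exp (-(z * s))) s := by
      have h1 : HasDerivAt (fun s : ℝ => -(z * s)) (-(z * 1)) s :=
        ((hasDerivAt_id s).const_mul z).neg
      exact h1.exp.neg.congr_deriv (by ring)
    rw [intervalIntegral.integral_eq_sub_of_hasDerivAt (fun s _ => hd s)
      (Continuous.intervalIntegrable (by fun_prop) _ _)]
    simp only [mul_zero, neg_zero, Real.exp_zero]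
    ring
  have hcake := lintegral_comp_eq_lintegral_meas_lt_mul (ν.restrict (Ioi 0)) (f := fun x => x)
    (g := fun s => z * Real.exp (-(z * s))) ?_ aemeasurable_id
    (fun t _ => Continuous.intervalIntegrable (by fun_prop) _ _)
    (Eventually.of_forall fun t => by positivity)
  · have hint : Integrable (fun t => 1 - Real.exp (-(z * t))) (ν.restrict (Ioi 0)) := by
      have hmin : Integrable (fun t : ℝ => max 1 z * min 1 t) (ν.restrict (Ioi 0)) := by
        refine Integrable.const_mul ⟨by fun_prop, ?_⟩ _
        rw [hasFiniteIntegral_iff_ofReal]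
        · exact hν.lintegral_lt_top
        · filter_upwards [ae_restrict_mem measurableSet_Ioi] with t ht
          exact le_min zero_le_one (mem_Ioi.1 ht).le
      refine hmin.mono (by fun_prop) ?_
      filter_upwards [ae_restrict_mem measurableSet_Ioi] with t ht
      have ht : 0 < t := ht
      have h1 : Real.exp (-(z * t)) ≤ 1 := Real.exp_le_one_iff.2 (by nlinarith)
      have h2 := Real.add_one_le_exp (-(z * t))
      have h3 := Real.exp_pos (-(z * t))
      rw [Real.norm_of_nonneg (by linarith), Real.norm_of_nonneg (by positivity)]
      rcases le_total 1 t with h | h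
      · rw [min_eq_left h]
        have := le_max_left 1 z
        linarith
      · rw [min_eq_right h]
        have := le_max_right 1 z
        nlinarith
    have hcake2 : ENNReal.ofReal (Φ z)
        = ∫⁻ t in Ioi 0, ENNReal.ofReal (∫ s in (0 : ℝ)..t, z * Real.exp (-(z * s))) ∂ν := by
      rw [hν.laplace z hz.le, ofReal_integral_eq_lintegral_ofReal hint]
      · simp only [hprim]
      · filter_upwards [ae_restrict_mem measurableSet_Ioi] with t ht
        have ht : 0 < t := ht
        have h1 : Real.exp (-(z * t)) ≤ 1 := Real.exp_le_one_iff.2 (by nlinarith)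
        simpa using h1
    rw [hcake2, hcake]
    refine setLIntegral_congr_fun measurableSet_Ioi fun t ht => ?_
    have ht : 0 < t := ht
    rw [tail, ENNReal.ofReal_mul measureReal_nonneg, Measure.real,
      ENNReal.ofReal_toReal (hν.measure_Ioi_lt_top ht).ne]
    congr 1
    change ν (Ioi t) = (ν.restrict (Ioi 0)) (Ioi t)
    rw [Measure.restrict_apply measurableSet_Ioi, inter_eq_left.2 (Ioi_subset_Ioi ht.le)]
  · filter_upwards [ae_restrict_mem measurableSet_Ioi] with t ht using (mem_Ioi.1 ht).le

lemma IsLevyMeasure.integrableOn_exp_mul_tail (hν : IsLevyMeasure Φ ν) {z : ℝ} (hz : 0 < z) :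
    IntegrableOn (fun t => Real.exp (-(z * t)) * tail ν t) (Ioi 0) := by
  have hm : AEMeasurable (fun t => tail ν t * (z * Real.exp (-(z * t))))
      (volume.restrict (Ioi 0)) := hν.aemeasurable_tail.mul (by fun_prop)
  have : IntegrableOn (fun t => tail ν t * (z * Real.exp (-(z * t)))) (Ioi 0) := by
    refine ⟨hm.aestronglyMeasurable, ?_⟩
    rw [hasFiniteIntegral_iff_ofReal, hν.lintegral_tail hz]
    · exact ENNReal.ofReal_lt_top
    · exact Eventually.of_forall fun t => mul_nonneg measureReal_nonneg (by positivity)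
  refine (this.const_mul z⁻¹).congr (Eventually.of_forall fun t => ?_)
  simp only
  field_simp

lemma IsLevyMeasure.integral_exp_mul_tail (hν : IsLevyMeasure Φ ν) {z : ℝ} (hz : 0 < z) :
    ∫ t in Ioi 0, Real.exp (-(z * t)) * tail ν t = Φ z / z := by
  have hΦ : 0 ≤ Φ z := by
    rw [hν.laplace z hz.le]
    refine setIntegral_nonneg measurableSet_Ioi fun t ht => ?_
    have ht : 0 < t := ht
    have h1 : Real.exp (-(z * t)) ≤ 1 := Real.exp_le_one_iff.2 (by nlinarith)
    linarith
  have hm : AEMeasurable (fun t => tail ν t * (z * Real.exp (-(z * t))))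
      (volume.restrict (Ioi 0)) := hν.aemeasurable_tail.mul (by fun_prop)
  have h := integral_eq_lintegral_of_nonneg_ae
    (f := fun t => tail ν t * (z * Real.exp (-(z * t)))) (μ := volume.restrict (Ioi 0))
    (Eventually.of_forall fun t => mul_nonneg measureReal_nonneg (by positivity))
    hm.aestronglyMeasurable
  rw [hν.lintegral_tail hz, ENNReal.toReal_ofReal hΦ] at h
  rw [eq_div_iff hz.ne', ← h, mul_comm, ← integral_const_mul]
  refine integral_congr_ae (Eventually.of_forall fun t => ?_)
  simp only
  ring

/-- The tail of the Lévy measure of `z ↦ z ^ α`. -/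
lemma IsLevyMeasure.tail_rpow {α : ℝ} (hα1 : α < 1)
    (hν : IsLevyMeasure (fun z : ℝ => z ^ α) ν) :
    ∀ᵐ t, t ∈ Ioi (0 : ℝ) → tail ν t = t ^ (-α) / Real.Gamma (1 - α) := by
  have hΓ : 0 < Real.Gamma (1 - α) := Real.Gamma_pos_of_pos (by linarith)
  have hI (z : ℝ) (hz : 0 < z) : ∫ t in Ioi 0, Real.exp (-(z * t)) * (t ^ (-α) / Real.Gamma (1 - α))
      = z ^ α / z := by
    have h := Real.integral_rpow_mul_exp_neg_mul_Ioi (a := 1 - α) (r := z) (by linarith) hz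
    have e : (1 - α - 1) = -α := by ring
    rw [e, one_div, Real.inv_rpow hz.le, ← Real.rpow_neg hz.le, neg_sub, Real.rpow_sub hz,
      Real.rpow_one] at h
    calc ∫ t in Ioi 0, Real.exp (-(z * t)) * (t ^ (-α) / Real.Gamma (1 - α))
        = ∫ t in Ioi 0, (Real.Gamma (1 - α))⁻¹ * (t ^ (-α) * Real.exp (-(z * t))) := by
          refine integral_congr_ae (Eventually.of_forall fun t => ?_)
          simp only
          field_simp
      _ = z ^ α / z := by
          rw [integral_const_mul, h]
          field_simp
  have hJ (z : ℝ) (hz : 0 < z) :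
      IntegrableOn (fun t => Real.exp (-(z * t)) * (t ^ (-α) / Real.Gamma (1 - α))) (Ioi 0) := by
    -- The integral of a non-integrable function is 0 by convention, whereas `hI` gives a positive
    -- value.
    by_contra hcon
    have := hI z hz
    rw [integral_undef hcon] at this
    have : 0 < z ^ α / z := by positivity
    linarith
  have := ae_eq_zero_of_laplace_eq_zero
    (φ := fun t => tail ν t - t ^ (-α) / Real.Gamma (1 - α)) ?_ fun n => ?_
  · filter_upwards [this] with t ht ht0
    exact sub_eq_zero.1 (ht ht0)
  · have h1 := hν.integrableOn_exp_mul_tail one_pos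
    have h2 := hJ 1 one_pos
    simp only [one_mul] at h1 h2
    simp only [mul_sub]
    exact h1.sub h2
  · have hn : (0 : ℝ) < n + 1 := by positivity
    simp only [mul_sub]
    rw [integral_sub (hν.integrableOn_exp_mul_tail hn) (hJ _ hn), hν.integral_exp_mul_tail hn,
      hI _ hn, sub_self]

end tail

/-! ### Mittag-Leffler functions -/

/-- The kernel `t ^ (c - 1) / Γ(c)` of fractional integration of order `c`. -/
def rlKernel (c t : ℝ) : ℝ := t ^ (c - 1) / Real.Gamma c

lemma rlKernel_nonneg {c t : ℝ} (hc : 0 < c) (ht : 0 ≤ t) : 0 ≤ rlKernel c t :=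
  div_nonneg (Real.rpow_nonneg ht _) (Real.Gamma_pos_of_pos hc).le

lemma rlKernel_pos {c t : ℝ} (hc : 0 < c) (ht : 0 < t) : 0 < rlKernel c t :=
  div_pos (Real.rpow_pos_of_pos ht _) (Real.Gamma_pos_of_pos hc)

@[simp] lemma rlKernel_one (t : ℝ) : rlKernel 1 t = 1 := by simp [rlKernel]

lemma continuousOn_rlKernel (c : ℝ) : ContinuousOn (rlKernel c) (Ioi 0) := fun t ht =>
  ((Real.continuousAt_rpow_const t _ (Or.inl (ne_of_gt ht))).div_const _).continuousWithinAt

/-- Euler's Beta integral B(b, a) = Γ(a)Γ(b)/Γ(a+b), available over ℂ and transferred to real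
powers. -/
lemma integral_rlKernel_mul_rlKernel {a b t : ℝ} (ha : 0 < a) (hb : 0 < b) (ht : 0 < t) :
    ∫ τ in (0 : ℝ)..t, rlKernel a (t - τ) * rlKernel b τ = rlKernel (a + b) t := by
  have hGa := Real.Gamma_pos_of_pos ha
  have hGb := Real.Gamma_pos_of_pos hb
  have hGab := Real.Gamma_pos_of_pos (add_pos ha hb)
  have h1 := Complex.betaIntegral_scaled b a ht
  have h2 := Complex.Gamma_mul_Gamma_eq_betaIntegral (s := b) (t := a) (by simpa) (by simpa)
  have h3 : ∫ x in (0 : ℝ)..t, (x : ℂ) ^ ((b : ℂ) - 1) * ((t : ℂ) - x) ^ ((a : ℂ) - 1)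
      = ((∫ x in (0 : ℝ)..t, x ^ (b - 1) * (t - x) ^ (a - 1) : ℝ) : ℂ) := by
    rw [← intervalIntegral.integral_ofReal]
    refine intervalIntegral.integral_congr fun x hx => ?_
    rw [uIcc_of_le ht.le] at hx
    rw [Complex.ofReal_mul, Complex.ofReal_cpow hx.1, Complex.ofReal_cpow (sub_nonneg.2 hx.2)]
    push_cast
    rfl
  rw [h3] at h1
  have h4 : Complex.betaIntegral b a
      = ((Real.Gamma b * Real.Gamma a / Real.Gamma (a + b) : ℝ) : ℂ) := by
    rw [Complex.Gamma_ofReal, Complex.Gamma_ofReal, ← Complex.ofReal_add, Complex.Gamma_ofReal,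
      add_comm b a] at h2
    rw [Complex.ofReal_div, Complex.ofReal_mul, eq_div_iff (by exact_mod_cast hGab.ne'), h2,
      mul_comm]
  have h5 : ((t : ℂ)) ^ ((b : ℂ) + a - 1) = ((t ^ (a + b - 1) : ℝ) : ℂ) := by
    rw [Complex.ofReal_cpow ht.le]
    push_cast
    rw [add_comm (a : ℂ) b]
  rw [h4, h5] at h1
  have h6 : ∫ x in (0 : ℝ)..t, x ^ (b - 1) * (t - x) ^ (a - 1)
      = t ^ (a + b - 1) * (Real.Gamma b * Real.Gamma a / Real.Gamma (a + b)) := by exact_mod_cast h1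
  calc ∫ τ in (0 : ℝ)..t, rlKernel a (t - τ) * rlKernel b τ
      = ∫ τ in (0 : ℝ)..t, (Real.Gamma b * Real.Gamma a)⁻¹ * (τ ^ (b - 1) * (t - τ) ^ (a - 1)) := by
        refine intervalIntegral.integral_congr fun x _ => ?_
        simp only [rlKernel]
        field_simp
    _ = rlKernel (a + b) t := by
        rw [intervalIntegral.integral_const_mul, h6, rlKernel]
        field_simp

lemma intervalIntegrable_rlKernel_mul_rlKernel {a b t : ℝ} (ha : 0 < a) (hb : 0 < b) (ht : 0 < t) :
    IntervalIntegrable (fun τ => rlKernel a (t - τ) * rlKernel b τ) volume 0 t := by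
  by_contra h
  have h1 := integral_rlKernel_mul_rlKernel ha hb ht
  rw [intervalIntegral.integral_undef h] at h1
  exact (rlKernel_pos (add_pos ha hb) ht).ne h1

lemma intervalIntegrable_rlKernel_comp_sub {c : ℝ} (hc : 0 < c) {t : ℝ} (ht : 0 < t) :
    IntervalIntegrable (fun τ => rlKernel c (t - τ)) volume 0 t := by
  simpa using intervalIntegrable_rlKernel_mul_rlKernel hc one_pos ht

lemma integral_rlKernel_comp_sub {c : ℝ} (hc : 0 < c) {t : ℝ} (ht : 0 < t) :
    ∫ τ in (0 : ℝ)..t, rlKernel c (t - τ) = rlKernel (c + 1) t := by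
  simpa using integral_rlKernel_mul_rlKernel hc one_pos ht

/-- Keep only the part of the Gamma integral over (M, ∞) and bound y^{x-1} below by M^{x-1} there.
As M is free, Γ outgrows every exponential, which is what the Mittag-Leffler series needs. -/
lemma rpow_mul_exp_neg_le_Gamma {M x : ℝ} (hM : 0 < M) (hx : 1 ≤ x) :
    M ^ (x - 1) * Real.exp (-M) ≤ Real.Gamma x := by
  have hx0 : 0 < x := by linarith
  rw [Real.Gamma_eq_integral hx0]
  calc M ^ (x - 1) * Real.exp (-M) = ∫ y in Ioi M, Real.exp (-y) * M ^ (x - 1) := by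
        rw [integral_mul_const, integral_exp_neg_Ioi, mul_comm]
    _ ≤ ∫ y in Ioi M, Real.exp (-y) * y ^ (x - 1) := by
        refine setIntegral_mono_on ?_ ?_ measurableSet_Ioi fun y hy => ?_
        · exact (integrableOn_exp_neg_Ioi M).mul_const _
        · exact (Real.GammaIntegral_convergent hx0).mono_set (Ioi_subset_Ioi hM.le)
        · have := Real.rpow_le_rpow hM.le (mem_Ioi.1 hy).le (sub_nonneg.2 hx)
          gcongr
    _ ≤ ∫ y in Ioi 0, Real.exp (-y) * y ^ (x - 1) := by
        refine setIntegral_mono_set (Real.GammaIntegral_convergent hx0) ?_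
          (Ioi_subset_Ioi hM.le).eventuallyLE
        filter_upwards [ae_restrict_mem measurableSet_Ioi] with y hy
        exact mul_nonneg (Real.exp_pos _).le (Real.rpow_nonneg (mem_Ioi.1 hy).le _)

lemma summable_rlKernel {α β t : ℝ} (hα : 0 < α) (hβ : 0 < β) (ht : 0 < t) :
    Summable fun n : ℕ => rlKernel (α * n + β) t := by
  have hgeom : Summable fun n : ℕ => ((1 / 2 : ℝ) ^ α) ^ n * ((1 / 2 : ℝ) ^ (β - 1)
      * Real.exp (2 * t)) := by
    refine Summable.mul_right _ (summable_geometric_of_lt_one (by positivity) ?_)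
    exact Real.rpow_lt_one (by norm_num) (by norm_num) hα
  refine Summable.of_norm_bounded_eventually_nat hgeom ?_
  have hlarge : ∀ᶠ n : ℕ in atTop, 1 ≤ α * n + β := by
    have : Tendsto (fun n : ℕ => α * n + β) atTop atTop :=
      tendsto_atTop_add_const_right _ _ (tendsto_natCast_atTop_atTop.const_mul_atTop hα)
    exact this.eventually_ge_atTop 1
  filter_upwards [hlarge] with n hn
  have hpos : 0 < α * n + β := by positivity
  rw [Real.norm_of_nonneg (rlKernel_nonneg hpos ht.le), rlKernel,
    div_le_iff₀ (Real.Gamma_pos_of_pos hpos)]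
  -- The choice M = 2t leaves a geometric series of ratio 2^{-α}.
  have hG := rpow_mul_exp_neg_le_Gamma (M := 2 * t) (by positivity) hn
  have e2 : ((1 / 2 : ℝ) ^ α) ^ n * (1 / 2 : ℝ) ^ (β - 1) = (1 / 2 : ℝ) ^ (α * n + β - 1) := by
    rw [← Real.rpow_natCast, ← Real.rpow_mul (by norm_num), ← Real.rpow_add (by norm_num)]
    congr 1
    ring
  calc t ^ (α * n + β - 1)
      = (1 / 2 : ℝ) ^ (α * n + β - 1) * (2 * t) ^ (α * n + β - 1) := by
        rw [← Real.mul_rpow (by norm_num) (by positivity)]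
        congr 1
        ring
    _ = (1 / 2 : ℝ) ^ (α * n + β - 1) * Real.exp (2 * t)
          * ((2 * t) ^ (α * n + β - 1) * Real.exp (-(2 * t))) := by
        rw [Real.exp_neg]
        field_simp
    _ ≤ (1 / 2 : ℝ) ^ (α * n + β - 1) * Real.exp (2 * t) * Real.Gamma (α * n + β) := by gcongr
    _ = _ := by rw [← e2]; ring

/-- The function `t ^ (β - 1) * E_{α, β} (-t ^ α)`. -/
def mlKernel (α β t : ℝ) : ℝ := ∑' n : ℕ, (-1) ^ n * rlKernel (α * n + β) t

lemma summable_mlKernel {α β t : ℝ} (hα : 0 < α) (hβ : 0 < β) (ht : 0 < t) :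
    Summable fun n : ℕ => (-1) ^ n * rlKernel (α * n + β) t := by
  refine Summable.of_norm_bounded (summable_rlKernel hα hβ ht) fun n => ?_
  have : 0 < α * n + β := by positivity
  simp [abs_of_nonneg (rlKernel_nonneg this ht.le)]

lemma mlKernel_eq_sub {α β t : ℝ} (hα : 0 < α) (hβ : 0 < β) (ht : 0 < t) :
    mlKernel α β t = rlKernel β t - mlKernel α (β + α) t := by
  rw [mlKernel, (summable_mlKernel hα hβ ht).tsum_eq_zero_add, mlKernel]
  simp only [pow_zero, Nat.cast_zero, mul_zero, zero_add, one_mul, sub_eq_add_neg, ← tsum_neg]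
  congr 2
  funext n
  push_cast
  rw [pow_succ, show α * (n + 1) + β = α * n + (β + α) by ring]
  ring

/-- On (0, T] one has t^{αn} ≤ T^{αn}, so each term at t is at most the term at T times the ratio of
the leading terms. The singularity at 0 is therefore that of the leading term. -/
lemma abs_mlKernel_le {α β T : ℝ} (hα : 0 < α) (hβ : 0 < β) (hT : 0 < T) :
    ∃ C : ℝ, 0 < C ∧ ∀ t ∈ Ioc 0 T, |mlKernel α β t| ≤ C * rlKernel β t := by
  have hgT := rlKernel_pos hβ hT
  have hs := summable_rlKernel hα hβ hT
  have hnn (n : ℕ) : 0 ≤ rlKernel (α * n + β) T := rlKernel_nonneg (by positivity) hT.le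
  refine ⟨(∑' n : ℕ, rlKernel (α * n + β) T) / rlKernel β T, ?_, fun t ht => ?_⟩
  · refine div_pos (hs.tsum_pos hnn 0 ?_) hgT
    simpa using hgT
  · have ht0 : 0 < t := ht.1
    have hle (n : ℕ) : rlKernel (α * n + β) t
        ≤ rlKernel (α * n + β) T * (rlKernel β t / rlKernel β T) := by
      have hG : 0 < Real.Gamma (α * n + β) := Real.Gamma_pos_of_pos (by positivity)
      have hGβ : 0 < Real.Gamma β := Real.Gamma_pos_of_pos hβ
      have hsplit (y : ℝ) (hy : 0 < y) : y ^ (α * n + β - 1) = y ^ (α * n) * y ^ (β - 1) := by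
        rw [← Real.rpow_add hy]; congr 1; ring
      have hmono : t ^ (α * n) ≤ T ^ (α * n) := Real.rpow_le_rpow ht0.le ht.2 (by positivity)
      have hTp : 0 < T ^ (β - 1) := Real.rpow_pos_of_pos hT _
      have e : rlKernel (α * n + β) T * (rlKernel β t / rlKernel β T)
          = T ^ (α * n) * t ^ (β - 1) / Real.Gamma (α * n + β) := by
        simp only [rlKernel, hsplit T hT]
        field_simp
      rw [e, rlKernel, hsplit t ht0]
      gcongr
    calc |mlKernel α β t| ≤ ∑' n : ℕ, rlKernel (α * n + β) t := by
          rw [← Real.norm_eq_abs, mlKernel]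
          refine tsum_of_norm_bounded (summable_rlKernel hα hβ ht0).hasSum fun n => ?_
          have : 0 < α * n + β := by positivity
          simp [abs_of_nonneg (rlKernel_nonneg this ht0.le)]
      _ ≤ ∑' n : ℕ, rlKernel (α * n + β) T * (rlKernel β t / rlKernel β T) :=
          (summable_rlKernel hα hβ ht0).tsum_le_tsum hle (hs.mul_right _)
      _ = _ := by rw [tsum_mul_right]; ring

/-- The function is t^{β-1} F(t^α) with F an entire power series, and a locally uniform limit of
holomorphic functions is holomorphic. -/
lemma differentiableAt_mlKernel {α β t : ℝ} (hα : 0 < α) (hβ : 0 < β) (ht : 0 < t) :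
    DifferentiableAt ℝ (mlKernel α β) t := by
  let F : ℂ → ℂ := fun z => ∑' n : ℕ, (((-1) ^ n / Real.Gamma (α * n + β) : ℝ) : ℂ) * z ^ n
  have hF : Differentiable ℂ F := by
    intro z
    set R : ℝ := ‖z‖ + 1 with hR
    have hRpos : 0 < R := by positivity
    -- For |z| ≤ R the series has the majorant Rⁿ/Γ(αn+β), which is a rescaled kernel series at time
    -- T = R^{1/α}.
    have hs : Summable fun n : ℕ => (R ^ α⁻¹) ^ (1 - β) * rlKernel (α * n + β) (R ^ α⁻¹) :=
      (summable_rlKernel hα hβ (Real.rpow_pos_of_pos hRpos _)).mul_left _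
    have := Complex.differentiableOn_tsum_of_summable_norm hs
      (F := fun (n : ℕ) (z : ℂ) => (((-1) ^ n / Real.Gamma (α * n + β) : ℝ) : ℂ) * z ^ n)
      (U := Metric.ball 0 R) (fun n => by fun_prop) Metric.isOpen_ball fun n w hw => ?_
    · exact this.differentiableAt (Metric.isOpen_ball.mem_nhds (by simp [hR]))
    · have hG : 0 < Real.Gamma (α * n + β) := Real.Gamma_pos_of_pos (by positivity)
      have hw : ‖w‖ ≤ R := by simpa using (Metric.mem_ball.1 hw).le
      have hRa : 0 < R ^ α⁻¹ := Real.rpow_pos_of_pos hRpos _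
      have e : (R ^ α⁻¹) ^ (1 - β) * rlKernel (α * n + β) (R ^ α⁻¹)
          = R ^ n / Real.Gamma (α * n + β) := by
        rw [rlKernel, mul_div_assoc', ← Real.rpow_add hRa, ← Real.rpow_mul hRpos.le,
          ← Real.rpow_natCast]
        congr 2
        field_simp
        ring
      rw [e, norm_mul, norm_pow, Complex.norm_real, norm_div, norm_pow, norm_neg, norm_one, one_pow,
        Real.norm_of_nonneg hG.le, div_mul_eq_mul_div, one_mul]
      gcongr
  have heq : ∀ x ∈ Ioi (0 : ℝ), mlKernel α β x = x ^ (β - 1) * (F ((x ^ α : ℝ) : ℂ)).re := by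
    intro x hx
    have hx : 0 < x := hx
    have : F ((x ^ α : ℝ) : ℂ)
        = ((∑' n : ℕ, ((-1) ^ n / Real.Gamma (α * n + β)) * (x ^ α) ^ n : ℝ) : ℂ) := by
      rw [Complex.ofReal_tsum]
      simp [F]
    rw [this, Complex.ofReal_re, ← tsum_mul_left, mlKernel]
    congr 1
    funext n
    rw [rlKernel, show α * n + β - 1 = α * n + (β - 1) by ring, Real.rpow_add hx, Real.rpow_mul hx.le,
      Real.rpow_natCast]
    ring
  have hd : DifferentiableAt ℝ (fun x : ℝ => x ^ (β - 1) * (F ((x ^ α : ℝ) : ℂ)).re) t := by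
    have h1 : DifferentiableAt ℝ (fun x : ℝ => x ^ (β - 1)) t :=
      Real.differentiableAt_rpow_const_of_ne _ ht.ne'
    have h2 : DifferentiableAt ℝ (fun x : ℝ => x ^ α) t :=
      Real.differentiableAt_rpow_const_of_ne _ ht.ne'
    have h3 : DifferentiableAt ℝ (fun y : ℝ => (F (y : ℂ)).re) (t ^ α) :=
      ((hF _).hasDerivAt.real_of_complex).differentiableAt
    have h4 : DifferentiableAt ℝ (fun x : ℝ => (F ((x ^ α : ℝ) : ℂ)).re) t :=
      DifferentiableAt.comp (g := fun y : ℝ => (F (y : ℂ)).re) t h3 h2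
    exact h1.mul h4
  refine hd.congr_of_eventuallyEq ?_
  filter_upwards [Ioi_mem_nhds ht] with x hx using heq x hx

lemma continuousOn_mlKernel {α β : ℝ} (hα : 0 < α) (hβ : 0 < β) :
    ContinuousOn (mlKernel α β) (Ioi 0) := fun _ ht =>
  (differentiableAt_mlKernel hα hβ ht).continuousAt.continuousWithinAt

lemma intervalIntegrable_rlKernel_mul_mlKernel {α β c t : ℝ} (hα : 0 < α) (hβ : 0 < β) (hc : 0 < c)
    (ht : 0 < t) :
    IntervalIntegrable (fun τ => rlKernel c (t - τ) * mlKernel α β τ) volume 0 t := by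
  obtain ⟨C, hC, hle⟩ := abs_mlKernel_le hα hβ ht
  have h := (intervalIntegrable_rlKernel_mul_rlKernel hc hβ ht).const_mul C
  rw [intervalIntegrable_iff_integrableOn_Ioo_of_le ht.le] at h ⊢
  refine h.mono' ?_ ?_
  · refine ContinuousOn.aestronglyMeasurable ?_ measurableSet_Ioo
    refine ContinuousOn.mul ?_ ((continuousOn_mlKernel hα hβ).mono fun τ hτ => hτ.1)
    exact (continuousOn_rlKernel c).comp (by fun_prop) fun τ hτ => mem_Ioi.2 (sub_pos.2 hτ.2)
  · filter_upwards [ae_restrict_mem measurableSet_Ioo] with τ hτ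
    have h1 : 0 ≤ rlKernel c (t - τ) := rlKernel_nonneg hc (sub_pos.2 hτ.2).le
    rw [Real.norm_eq_abs, abs_mul, abs_of_nonneg h1]
    calc rlKernel c (t - τ) * |mlKernel α β τ| ≤ rlKernel c (t - τ) * (C * rlKernel β τ) :=
          mul_le_mul_of_nonneg_left (hle τ ⟨hτ.1, hτ.2.le⟩) h1
      _ = _ := by ring

/-- Fractional integration of order c raises the order of each term of the series by c. The exchange
of sum and integral is absolute convergence: the norms integrate to the series without signs. -/
lemma integral_rlKernel_mul_mlKernel {α β c t : ℝ} (hα : 0 < α) (hβ : 0 < β) (hc : 0 < c)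
    (ht : 0 < t) :
    ∫ τ in (0 : ℝ)..t, rlKernel c (t - τ) * mlKernel α β τ = mlKernel α (β + c) t := by
  let F : ℕ → ℝ → ℝ := fun n τ => (-1) ^ n * (rlKernel c (t - τ) * rlKernel (α * n + β) τ)
  have hpos (n : ℕ) : 0 < α * n + β := by positivity
  have hint (n : ℕ) : IntervalIntegrable (F n) volume 0 t :=
    (intervalIntegrable_rlKernel_mul_rlKernel hc (hpos n) ht).const_mul _
  have hnorm (n : ℕ) : ∫ τ in Ioc 0 t, ‖F n τ‖ = rlKernel (α * n + (β + c)) t := by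
    have : rlKernel (α * n + (β + c)) t = rlKernel (c + (α * n + β)) t := by congr 1; ring
    rw [this, ← integral_rlKernel_mul_rlKernel hc (hpos n) ht,
      intervalIntegral.integral_of_le ht.le]
    refine setIntegral_congr_fun measurableSet_Ioc fun τ hτ => ?_
    have h1 : 0 ≤ rlKernel c (t - τ) := rlKernel_nonneg hc (sub_nonneg.2 hτ.2)
    have h2 : 0 ≤ rlKernel (α * n + β) τ := rlKernel_nonneg (hpos n) hτ.1.le
    simp [F, abs_of_nonneg h1, abs_of_nonneg h2]
  have hsum := hasSum_integral_of_summable_integral_norm (μ := volume.restrict (Ioc 0 t)) (F := F)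
    (fun n => (intervalIntegrable_iff_integrableOn_Ioc_of_le ht.le).1 (hint n)) (by
      simp only [hnorm]
      exact summable_rlKernel hα (by positivity) ht)
  have hval (n : ℕ) : ∫ τ in Ioc 0 t, F n τ = (-1) ^ n * rlKernel (α * n + (β + c)) t := by
    rw [← intervalIntegral.integral_of_le ht.le]
    simp only [F]
    rw [intervalIntegral.integral_const_mul, integral_rlKernel_mul_rlKernel hc (hpos n) ht]
    congr 2
    ring
  simp only [hval] at hsum
  rw [mlKernel, hsum.tsum_eq, intervalIntegral.integral_of_le ht.le]
  refine setIntegral_congr_fun measurableSet_Ioc fun τ hτ => ?_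
  simp only [F, mlKernel]
  rw [← tsum_mul_left]
  congr 1
  funext n
  ring

lemma intervalIntegrable_mlKernel {α β t : ℝ} (hα : 0 < α) (hβ : 0 < β) (ht : 0 < t) :
    IntervalIntegrable (mlKernel α β) volume 0 t := by
  simpa using intervalIntegrable_rlKernel_mul_mlKernel hα hβ one_pos ht

lemma integral_mlKernel {α β t : ℝ} (hα : 0 < α) (hβ : 0 < β) (ht : 0 < t) :
    ∫ τ in (0 : ℝ)..t, mlKernel α β τ = mlKernel α (β + 1) t := by
  simpa using integral_rlKernel_mul_mlKernel hα hβ one_pos ht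

lemma rlKernel_antitoneOn {c : ℝ} (hc : 0 < c) (hc1 : c ≤ 1) : AntitoneOn (rlKernel c) (Ioi 0) :=
  fun x hx y _ hxy => by
    have hG := Real.Gamma_pos_of_pos hc
    have := Real.rpow_le_rpow_of_nonpos hx hxy (sub_nonpos.2 hc1)
    simp only [rlKernel]
    gcongr

lemma hasDerivAt_rlKernel {c t : ℝ} (hc : 0 < c) (ht : 0 < t) :
    HasDerivAt (rlKernel (c + 1)) (rlKernel c t) t := by
  have h := (Real.hasDerivAt_rpow_const (x := t) (p := c) (Or.inl ht.ne')).div_const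
    (Real.Gamma (c + 1))
  have e : rlKernel (c + 1) = fun x => x ^ c / Real.Gamma (c + 1) := by
    funext x; simp [rlKernel]
  rw [e]
  refine h.congr_deriv ?_
  have hG := Real.Gamma_pos_of_pos hc
  rw [Real.Gamma_add_one hc.ne', rlKernel]
  field_simp

/-! ### Positivity, monotonicity and decay of the relaxation function -/

section relaxation

variable {α : ℝ}

lemma mlKernel_one_eq (hα : 0 < α) {t : ℝ} (ht : 0 < t) :
    mlKernel α 1 t = 1 - mlKernel α (α + 1) t := by
  rw [mlKernel_eq_sub hα one_pos ht, rlKernel_one, add_comm]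

lemma mlKernel_one_eq_one_sub_integral (hα : 0 < α) {t : ℝ} (ht : 0 < t) :
    mlKernel α 1 t = 1 - ∫ τ in (0 : ℝ)..t, mlKernel α α τ := by
  rw [mlKernel_one_eq hα ht, integral_mlKernel hα hα ht]

lemma hasDerivAt_mlKernel_one (hα : 0 < α) {t : ℝ} (ht : 0 < t) :
    HasDerivAt (mlKernel α 1) (-mlKernel α α t) t := by
  have h : HasDerivAt (fun x => ∫ τ in (0 : ℝ)..x, mlKernel α α τ) (mlKernel α α t) t :=
    intervalIntegral.integral_hasDerivAt_right (intervalIntegrable_mlKernel hα hα ht)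
      ((continuousOn_mlKernel hα hα).stronglyMeasurableAtFilter isOpen_Ioi t ht)
      ((continuousOn_mlKernel hα hα).continuousAt (Ioi_mem_nhds ht))
  refine ((h.const_sub 1).congr_of_eventuallyEq ?_)
  filter_upwards [Ioi_mem_nhds ht] with x hx using mlKernel_one_eq_one_sub_integral hα hx

/-- The leading term t^{α-1}/Γ(α) dominates the remainder, which is O(t^{2α-1}). -/
lemma mlKernel_self_pos_near_zero (hα : 0 < α) :
    ∃ δ : ℝ, 0 < δ ∧ ∀ t ∈ Ioc 0 δ, 0 < mlKernel α α t := by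
  obtain ⟨C, hC, hle⟩ := abs_mlKernel_le hα (add_pos hα hα) one_pos
  have hG := Real.Gamma_pos_of_pos hα
  have hG2 := Real.Gamma_pos_of_pos (add_pos hα hα)
  have hcont : Tendsto (fun t : ℝ => 1 / Real.Gamma α - C * (t ^ α / Real.Gamma (α + α))) (𝓝 0)
      (𝓝 (1 / Real.Gamma α - C * ((0 : ℝ) ^ α / Real.Gamma (α + α)))) := by
    have : ContinuousAt (fun t : ℝ => t ^ α) 0 := Real.continuousAt_rpow_const _ _ (Or.inr hα.le)
    exact ((this.div_const _).const_mul C).const_sub _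
  rw [Real.zero_rpow hα.ne', zero_div, mul_zero, sub_zero] at hcont
  have hev := hcont.eventually (lt_mem_nhds (one_div_pos.2 hG))
  obtain ⟨δ, hδ, hball⟩ := Metric.eventually_nhds_iff.1 hev
  refine ⟨min (δ / 2) 1, by positivity, fun t ht => ?_⟩
  have ht0 : 0 < t := ht.1
  have h1 := hball (y := t) (by
    have := ht.2.trans (min_le_left _ _)
    rw [Real.dist_eq, sub_zero, abs_of_pos ht0]
    linarith)
  have h2 := hle t ⟨ht0, ht.2.trans (min_le_right _ _)⟩
  rw [mlKernel_eq_sub hα hα ht0]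
  have h3 : rlKernel α t - C * rlKernel (α + α) t
      = t ^ (α - 1) * (1 / Real.Gamma α - C * (t ^ α / Real.Gamma (α + α))) := by
    rw [rlKernel, rlKernel, show α + α - 1 = α - 1 + α by ring, Real.rpow_add ht0]
    ring
  have h4 : 0 < t ^ (α - 1) := Real.rpow_pos_of_pos ht0 _
  have h5 := mul_pos h4 h1
  have h6 := (abs_le.1 h2).2
  linarith

/-- The orders add up: α + (1 - α) = 1. This is the identity E = k * r with r = -E', from which
positivity and the lower bound for E are drawn. -/
lemma mlKernel_one_eq_integral (hα : 0 < α) (hα1 : α < 1) {t : ℝ} (ht : 0 < t) :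
    ∫ τ in (0 : ℝ)..t, rlKernel (1 - α) (t - τ) * mlKernel α α τ = mlKernel α 1 t := by
  rw [integral_rlKernel_mul_mlKernel hα hα (sub_pos.2 hα1) ht]
  congr 1
  ring

/-- The increment of `E = k * r` to the left of a point where `r` attains its minimum. -/
lemma mlKernel_one_sub_le (hα : 0 < α) (hα1 : α < 1) {t x η L : ℝ} (hx0 : 0 < x) (hxt : x < t)
    (hηx : t - η < x) (hL : 0 ≤ L)
    (hmin : ∀ τ ∈ Ioc 0 t, mlKernel α α t ≤ mlKernel α α τ)
    (hlip : ∀ τ ∈ Ioc (t - η) t, mlKernel α α τ - mlKernel α α t ≤ L * (t - τ)) :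
    mlKernel α 1 t - mlKernel α 1 x
      ≤ mlKernel α α t * (rlKernel (1 - α + 1) t - rlKernel (1 - α + 1) x)
        + L / Real.Gamma (1 - α) * (t - x) ^ (1 - α) * (t - x) := by
  set r := mlKernel α α with hr
  set k := rlKernel (1 - α) with hk
  have hc : 0 < 1 - α := sub_pos.2 hα1
  have hG := Real.Gamma_pos_of_pos hc
  have ht : 0 < t := hx0.trans hxt
  have hI (y : ℝ) (hy : 0 < y) : IntervalIntegrable (fun τ => k (y - τ) * (r τ - r t)) volume 0 y := by
    have h1 := intervalIntegrable_rlKernel_mul_mlKernel hα hα hc hy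
    have h2 := (intervalIntegrable_rlKernel_comp_sub hc hy).mul_const (r t)
    refine (h1.sub h2).congr (fun τ _ => ?_)
    simp only [← hr, ← hk]
    ring
  -- Split r = r(t) + (r - r(t)) in the convolution. The constant contributes r(t) times the
  -- integral of k, and the rest has a nonnegative factor because t is a minimum.
  have hE (y : ℝ) (hy : 0 < y) : mlKernel α 1 y
      = r t * rlKernel (1 - α + 1) y + ∫ τ in (0 : ℝ)..y, k (y - τ) * (r τ - r t) := by
    have h2 := (intervalIntegrable_rlKernel_comp_sub hc hy).mul_const (r t)
    rw [← mlKernel_one_eq_integral hα hα1 hy, ← integral_rlKernel_comp_sub hc hy, mul_comm,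
      ← intervalIntegral.integral_mul_const, ← intervalIntegral.integral_add h2 (hI y hy)]
    refine intervalIntegral.integral_congr fun τ _ => ?_
    simp only [← hr, ← hk]
    ring
  have hIt := hI t ht
  have hx_mem : x ∈ uIcc 0 t := by rw [uIcc_of_le ht.le]; exact ⟨hx0.le, hxt.le⟩
  have hI1 : IntervalIntegrable (fun τ => k (t - τ) * (r τ - r t)) volume 0 x :=
    hIt.mono_set (uIcc_subset_uIcc left_mem_uIcc hx_mem)
  have hI2 : IntervalIntegrable (fun τ => k (t - τ) * (r τ - r t)) volume x t :=
    hIt.mono_set (uIcc_subset_uIcc hx_mem right_mem_uIcc)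
  -- The kernel decreases, so moving the endpoint from x to t lowers the contribution of (0, x).
  have hle1 : ∫ τ in (0 : ℝ)..x, k (t - τ) * (r τ - r t) ≤ ∫ τ in (0 : ℝ)..x, k (x - τ) * (r τ - r t) := by
    refine intervalIntegral.integral_mono_on_of_le_Ioo hx0.le hI1 (hI x hx0) fun τ hτ => ?_
    refine mul_le_mul_of_nonneg_right ?_ (sub_nonneg.2 (hmin τ ⟨hτ.1, (hτ.2.trans hxt).le⟩))
    exact rlKernel_antitoneOn hc (by linarith) (mem_Ioi.2 (sub_pos.2 hτ.2))
      (mem_Ioi.2 (sub_pos.2 (hτ.2.trans hxt))) (by linarith)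
  -- Near t the factor L(t - τ) cancels the singularity of the kernel and leaves a power 1 - α, so
  -- this piece is o(t - x).
  have hle2 : ∫ τ in x..t, k (t - τ) * (r τ - r t)
      ≤ L / Real.Gamma (1 - α) * (t - x) ^ (1 - α) * (t - x) := by
    have : ∫ τ in x..t, k (t - τ) * (r τ - r t)
        ≤ ∫ _ in x..t, L / Real.Gamma (1 - α) * (t - x) ^ (1 - α) := by
      refine intervalIntegral.integral_mono_on_of_le_Ioo hxt.le hI2 (by simp) fun τ hτ => ?_
      have hpos : 0 < t - τ := sub_pos.2 hτ.2
      calc k (t - τ) * (r τ - r t) ≤ k (t - τ) * (L * (t - τ)) :=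
            mul_le_mul_of_nonneg_left (hlip τ ⟨hηx.trans hτ.1, hτ.2.le⟩)
              (rlKernel_nonneg hc hpos.le)
        _ = L / Real.Gamma (1 - α) * (t - τ) ^ (1 - α) := by
            have : (t - τ) ^ (1 - α) = (t - τ) ^ (1 - α - 1) * (t - τ) := by
              rw [← Real.rpow_add_one hpos.ne']; congr 1; ring
            rw [this, hk, rlKernel]
            ring
        _ ≤ L / Real.Gamma (1 - α) * (t - x) ^ (1 - α) := by
            have := Real.rpow_le_rpow hpos.le (by linarith [hτ.1] : t - τ ≤ t - x) hc.le
            gcongr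
    refine this.trans_eq ?_
    rw [intervalIntegral.integral_const, smul_eq_mul, mul_comm]
  have hsplit := intervalIntegral.integral_add_adjacent_intervals hI1 hI2
  rw [hE t ht, hE x hx0, ← hsplit]
  linarith

/-- Minimum principle. If r is negative somewhere, its minimum over (0, t₀] is negative and attained
at some t₀ > 0, because r is positive near 0. The left difference quotients of E = k * r then give
-r(t₀) = E'(t₀) ≤ r(t₀) k(t₀), which is impossible for r(t₀) < 0 < k(t₀). -/
lemma mlKernel_self_nonneg (hα : 0 < α) (hα1 : α < 1) {t : ℝ} (ht : 0 < t) :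
    0 ≤ mlKernel α α t := by
  by_contra! hneg
  obtain ⟨δ, hδ, hpos⟩ := mlKernel_self_pos_near_zero hα
  have hδt : δ < t := by
    by_contra! h
    exact absurd (hpos t ⟨ht, h⟩) (not_lt.2 hneg.le)
  obtain ⟨t₀, ht₀, hmin'⟩ := isCompact_Icc.exists_isMinOn (nonempty_Icc.2 hδt.le)
    ((continuousOn_mlKernel hα hα).mono fun τ (hτ : τ ∈ Icc δ t) => hδ.trans_le hτ.1)
  have hr0 : mlKernel α α t₀ < 0 := (hmin' (right_mem_Icc.2 hδt.le)).trans_lt hneg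
  have ht₀pos : 0 < t₀ := hδ.trans_le ht₀.1
  have hmin : ∀ τ ∈ Ioc 0 t₀, mlKernel α α t₀ ≤ mlKernel α α τ := fun τ hτ => by
    rcases le_total τ δ with h | h
    · exact (hr0.trans (hpos τ ⟨hτ.1, h⟩)).le
    · exact hmin' ⟨h, hτ.2.trans ht₀.2⟩
  have hdiff := differentiableAt_mlKernel hα hα ht₀pos
  obtain ⟨L, hLpos, hL⟩ := hdiff.isBigO_sub.exists_pos
  obtain ⟨η, hη, hball⟩ := Metric.eventually_nhds_iff.1 hL.bound
  have hlip : ∀ τ ∈ Ioc (t₀ - η) t₀, mlKernel α α τ - mlKernel α α t₀ ≤ L * (t₀ - τ) := by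
    intro τ hτ
    have := hball (y := τ) (by
      rw [Real.dist_eq, abs_sub_comm, abs_of_nonneg (sub_nonneg.2 hτ.2)]; linarith [hτ.1])
    rw [Real.norm_eq_abs, Real.norm_eq_abs, abs_sub_comm τ, abs_of_nonneg (sub_nonneg.2 hτ.2)] at this
    exact (le_abs_self _).trans this
  have hc : 0 < 1 - α := sub_pos.2 hα1
  have hslopeE := (hasDerivAt_iff_tendsto_slope.1 (hasDerivAt_mlKernel_one hα ht₀pos)).mono_left
    (nhdsWithin_mono t₀ (fun x (hx : x ∈ Iio t₀) => ne_of_lt hx))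
  have hslopeK := (hasDerivAt_iff_tendsto_slope.1 (hasDerivAt_rlKernel hc ht₀pos)).mono_left
    (nhdsWithin_mono t₀ (fun x (hx : x ∈ Iio t₀) => ne_of_lt hx))
  have hrem : Tendsto (fun x => L / Real.Gamma (1 - α) * (t₀ - x) ^ (1 - α)) (𝓝[<] t₀) (𝓝 0) := by
    have : ContinuousAt (fun x => L / Real.Gamma (1 - α) * (t₀ - x) ^ (1 - α)) t₀ := by
      refine ContinuousAt.mul continuousAt_const ?_
      exact (continuousAt_const.sub continuousAt_id).rpow_const (Or.inr hc.le)
    have h := this.tendsto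
    simp only [sub_self, Real.zero_rpow hc.ne', mul_zero] at h
    exact h.mono_left nhdsWithin_le_nhds
  have hlim := (hslopeK.const_mul (mlKernel α α t₀)).add hrem
  have hle := le_of_tendsto_of_tendsto hslopeE hlim (by
    have hη' : t₀ - η < t₀ := by linarith
    filter_upwards [self_mem_nhdsWithin, mem_nhdsWithin_of_mem_nhds (Ioi_mem_nhds hη'),
      mem_nhdsWithin_of_mem_nhds (Ioi_mem_nhds ht₀pos)] with x hx hx2 hx3
    have hx : x < t₀ := hx
    have h := mlKernel_one_sub_le hα hα1 hx3 hx hx2 hLpos.le hmin hlip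
    have hd : 0 < t₀ - x := sub_pos.2 hx
    rw [slope_comm, slope_comm (rlKernel _), slope_def_field, slope_def_field, div_le_iff₀ hd]
    have e : (mlKernel α α t₀ * ((rlKernel (1 - α + 1) t₀ - rlKernel (1 - α + 1) x) / (t₀ - x))
        + L / Real.Gamma (1 - α) * (t₀ - x) ^ (1 - α)) * (t₀ - x)
        = mlKernel α α t₀ * (rlKernel (1 - α + 1) t₀ - rlKernel (1 - α + 1) x)
        + L / Real.Gamma (1 - α) * (t₀ - x) ^ (1 - α) * (t₀ - x) := by
      field_simp
    rw [e]
    exact h)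
  rw [add_zero] at hle
  have hk := rlKernel_pos hc ht₀pos
  nlinarith

/-- The relaxation function `t ↦ E_α (-t ^ α)`. -/
def relax (α t : ℝ) : ℝ := mlKernel α 1 t

/-- At t = 0 only the term n = 0 of the series survives, through the convention 0 ^ 0 = 1. -/
lemma relax_zero (hα : 0 < α) : relax α 0 = 1 := by
  rw [relax, mlKernel, tsum_eq_single 0]
  · simp
  · intro n hn
    have : α * n ≠ 0 := by positivity
    simp [rlKernel, Real.zero_rpow this]

lemma relax_nonneg (hα : 0 < α) (hα1 : α < 1) {t : ℝ} (ht : 0 < t) : 0 ≤ relax α t := by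
  rw [relax, ← mlKernel_one_eq_integral hα hα1 ht, intervalIntegral.integral_of_le ht.le]
  exact setIntegral_nonneg measurableSet_Ioc fun τ hτ =>
    mul_nonneg (rlKernel_nonneg (sub_pos.2 hα1) (sub_nonneg.2 hτ.2))
      (mlKernel_self_nonneg hα hα1 hτ.1)

lemma relax_antitoneOn (hα : 0 < α) (hα1 : α < 1) : AntitoneOn (relax α) (Ioi 0) := by
  refine antitoneOn_of_deriv_nonpos (convex_Ioi 0) (continuousOn_mlKernel hα one_pos)
    (fun t ht => ?_) fun t ht => ?_
  · rw [interior_Ioi] at ht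
    exact (hasDerivAt_mlKernel_one hα ht).differentiableAt.differentiableWithinAt
  · rw [interior_Ioi] at ht
    change deriv (mlKernel α 1) t ≤ 0
    rw [(hasDerivAt_mlKernel_one hα ht).deriv]
    exact neg_nonpos.2 (mlKernel_self_nonneg hα hα1 ht)

lemma relax_le_one (hα : 0 < α) (hα1 : α < 1) {t : ℝ} (ht : 0 < t) : relax α t ≤ 1 := by
  rw [relax, mlKernel_one_eq_one_sub_integral hα ht, intervalIntegral.integral_of_le ht.le]
  have := setIntegral_nonneg (μ := volume) (measurableSet_Ioc (a := (0 : ℝ)) (b := t))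
    fun τ hτ => mlKernel_self_nonneg hα hα1 hτ.1
  linarith

lemma continuousOn_relax (hα : 0 < α) : ContinuousOn (relax α) (Ici 0) := by
  intro t ht
  rcases eq_or_lt_of_le (mem_Ici.1 ht) with h | h
  · subst h
    obtain ⟨C, hC, hle⟩ := abs_mlKernel_le hα (add_pos hα one_pos) one_pos
    rw [ContinuousWithinAt, relax_zero hα, tendsto_iff_norm_sub_tendsto_zero]
    have hlim : Tendsto (fun t : ℝ => C * rlKernel (α + 1) t) (𝓝[≥] 0) (𝓝 0) := by
      have : ContinuousAt (fun t : ℝ => C * (t ^ α / Real.Gamma (α + 1))) 0 :=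
        ContinuousAt.mul continuousAt_const
          ((Real.continuousAt_rpow_const _ _ (Or.inr hα.le)).div_const _)
      have h := this.tendsto
      simp only [Real.zero_rpow hα.ne', zero_div, mul_zero] at h
      simpa [rlKernel] using h.mono_left nhdsWithin_le_nhds
    refine squeeze_zero' (Eventually.of_forall fun _ => norm_nonneg _) ?_ hlim
    filter_upwards [self_mem_nhdsWithin, mem_nhdsWithin_of_mem_nhds (Iio_mem_nhds one_pos)]
      with x hx hx1
    rcases eq_or_lt_of_le (mem_Ici.1 hx) with h | h
    · subst h
      rw [relax_zero hα, sub_self, norm_zero]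
      exact mul_nonneg hC.le (rlKernel_nonneg (by positivity) le_rfl)
    · rw [relax, mlKernel_one_eq hα h, Real.norm_eq_abs, sub_sub_cancel_left, abs_neg]
      exact hle x ⟨h, le_of_lt hx1⟩
  · exact (differentiableAt_mlKernel hα one_pos h).continuousAt.continuousWithinAt

/-- The integrated relaxation equation. -/
lemma integral_rlKernel_mul_one_sub_relax (hα : 0 < α) (hα1 : α < 1) {t : ℝ} (ht : 0 < t) :
    ∫ τ in (0 : ℝ)..t, rlKernel (1 - α) (t - τ) * (1 - relax α τ)
      = ∫ τ in (0 : ℝ)..t, relax α τ := by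
  have h1 := integral_rlKernel_mul_mlKernel hα (add_pos hα one_pos) (sub_pos.2 hα1) ht
  have h2 := integral_mlKernel hα one_pos ht
  rw [show α + 1 + (1 - α) = 1 + 1 by ring, ← h2] at h1
  simp only [relax]
  rw [← h1]
  simp only [intervalIntegral.integral_of_le ht.le]
  refine setIntegral_congr_fun measurableSet_Ioc fun τ hτ => ?_
  rw [mlKernel_one_eq hα hτ.1, sub_sub_cancel]

/-- E decreases, so t E(t) ≤ ∫ E = k * (1 - E) ≤ ∫ k, the integrals being over (0, t), and ∫ k =
t^{1-α}/Γ(2-α). -/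
lemma relax_le (hα : 0 < α) (hα1 : α < 1) {t : ℝ} (ht : 0 < t) :
    relax α t ≤ t ^ (-α) / Real.Gamma (2 - α) := by
  have hc := sub_pos.2 hα1
  have h1 : t * relax α t ≤ ∫ τ in (0 : ℝ)..t, relax α τ := by
    have : ∫ _ in (0 : ℝ)..t, relax α t ≤ ∫ τ in (0 : ℝ)..t, relax α τ :=
      intervalIntegral.integral_mono_on_of_le_Ioo ht.le (by simp)
        (intervalIntegrable_mlKernel hα one_pos ht)
        fun τ hτ => relax_antitoneOn hα hα1 hτ.1 ht hτ.2.le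
    simpa using this
  have h2 : ∫ τ in (0 : ℝ)..t, rlKernel (1 - α) (t - τ) * (1 - relax α τ)
      ≤ ∫ τ in (0 : ℝ)..t, rlKernel (1 - α) (t - τ) := by
    have hI : IntervalIntegrable (fun τ => rlKernel (1 - α) (t - τ) * (1 - relax α τ)) volume 0 t := by
      have := (intervalIntegrable_rlKernel_comp_sub hc ht).sub
        (intervalIntegrable_rlKernel_mul_mlKernel hα one_pos hc ht)
      refine this.congr fun τ _ => ?_
      simp only [relax]
      ring
    refine intervalIntegral.integral_mono_on_of_le_Ioo ht.le hI
      (intervalIntegrable_rlKernel_comp_sub hc ht) fun τ hτ => ?_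
    have h3 := rlKernel_nonneg hc (sub_pos.2 hτ.2).le
    have h4 := relax_nonneg hα hα1 hτ.1
    nlinarith
  rw [integral_rlKernel_mul_one_sub_relax hα hα1 ht, integral_rlKernel_comp_sub hc ht] at h2
  have h3 : rlKernel (1 - α + 1) t = t * (t ^ (-α) / Real.Gamma (2 - α)) := by
    rw [rlKernel, show 1 - α + 1 - 1 = -α + 1 by ring, Real.rpow_add_one ht.ne',
      show 1 - α + 1 = 2 - α by ring]
    ring
  rw [h3] at h2
  exact le_of_mul_le_mul_left (h1.trans h2) ht

/-- 1 - E is the integral of r and E is the convolution k * r. As r ≥ 0, it suffices that k(t) ≤ k(t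
- τ). -/
lemma rlKernel_mul_one_sub_relax_le (hα : 0 < α) (hα1 : α < 1) {t : ℝ} (ht : 0 < t) :
    rlKernel (1 - α) t * (1 - relax α t) ≤ relax α t := by
  have hc := sub_pos.2 hα1
  have e : 1 - relax α t = ∫ τ in (0 : ℝ)..t, mlKernel α α τ := by
    rw [relax, mlKernel_one_eq_one_sub_integral hα ht, sub_sub_cancel]
  rw [e, relax, ← mlKernel_one_eq_integral hα hα1 ht, ← intervalIntegral.integral_const_mul]
  refine intervalIntegral.integral_mono_on_of_le_Ioo ht.le
    ((intervalIntegrable_mlKernel hα hα ht).const_mul _)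
    (intervalIntegrable_rlKernel_mul_mlKernel hα hα hc ht) fun τ hτ => ?_
  refine mul_le_mul_of_nonneg_right ?_ (mlKernel_self_nonneg hα hα1 hτ.1)
  exact rlKernel_antitoneOn hc (by linarith) (mem_Ioi.2 (sub_pos.2 hτ.2)) ht (by linarith [hτ.1])

/-- `E_α (-x)` does not decay faster than `1 / x`. -/
lemma exists_le_relax (hα : 0 < α) (hα1 : α < 1) :
    ∃ c : ℝ, 0 < c ∧ ∀ t, 0 < t → c / (1 + t ^ α) ≤ relax α t := by
  have hc := sub_pos.2 hα1
  have hG := Real.Gamma_pos_of_pos hc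
  refine ⟨1 / (1 + Real.Gamma (1 - α)), by positivity, fun t ht => ?_⟩
  have h := rlKernel_mul_one_sub_relax_le hα hα1 ht
  have hp : 0 < t ^ α := Real.rpow_pos_of_pos ht _
  have e : rlKernel (1 - α) t = 1 / (t ^ α * Real.Gamma (1 - α)) := by
    rw [rlKernel, show 1 - α - 1 = -α by ring, Real.rpow_neg ht.le]
    field_simp
  have hE := relax_nonneg hα hα1 ht
  rw [e, div_mul_eq_mul_div, div_le_iff₀ (by positivity)] at h
  rw [div_div, div_le_iff₀ (by positivity)]
  nlinarith [mul_pos hp hG]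

end relaxation

/-- The solution `t ↦ E_α (-lam * t ^ α)` of the relaxation equation with rate `lam`. -/
def relaxRate (α lam t : ℝ) : ℝ := relax α (lam ^ α⁻¹ * t)

/-! ### Relaxation with an arbitrary rate, by scaling of time -/

section relaxRate

variable {α lam : ℝ}

lemma relaxRate_zero (hα : 0 < α) : relaxRate α lam 0 = 1 := by
  rw [relaxRate, mul_zero, relax_zero hα]

lemma continuousOn_relaxRate (hα : 0 < α) (hlam : 0 ≤ lam) :
    ContinuousOn (relaxRate α lam) (Ici 0) :=
  (continuousOn_relax hα).comp (by fun_prop) fun _ ht =>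
    mul_nonneg (Real.rpow_nonneg hlam _) ht

lemma relaxRate_nonneg (hα : 0 < α) (hα1 : α < 1) (hlam : 0 ≤ lam) {t : ℝ} (ht : 0 ≤ t) :
    0 ≤ relaxRate α lam t := by
  rcases (mul_nonneg (Real.rpow_nonneg hlam α⁻¹) ht).eq_or_lt with h | h
  · rw [relaxRate, ← h, relax_zero hα]
    exact zero_le_one
  · exact relax_nonneg hα hα1 h

lemma relaxRate_le_one (hα : 0 < α) (hα1 : α < 1) (hlam : 0 ≤ lam) {t : ℝ} (ht : 0 ≤ t) :
    relaxRate α lam t ≤ 1 := by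
  rcases (mul_nonneg (Real.rpow_nonneg hlam α⁻¹) ht).eq_or_lt with h | h
  · rw [relaxRate, ← h, relax_zero hα]
  · exact relax_le_one hα hα1 h

lemma abs_relaxRate_le_one (hα : 0 < α) (hα1 : α < 1) (hlam : 0 ≤ lam) {t : ℝ} (ht : 0 ≤ t) :
    |relaxRate α lam t| ≤ 1 := by
  rw [abs_of_nonneg (relaxRate_nonneg hα hα1 hlam ht)]
  exact relaxRate_le_one hα hα1 hlam ht

lemma mul_relaxRate_le (hα : 0 < α) (hα1 : α < 1) (hlam : 0 ≤ lam) {t : ℝ} (ht : 0 < t) :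
    lam * relaxRate α lam t ≤ t ^ (-α) / Real.Gamma (2 - α) := by
  have hG : 0 < Real.Gamma (2 - α) := Real.Gamma_pos_of_pos (by linarith)
  rcases hlam.eq_or_lt with h | h
  · rw [← h, zero_mul]; positivity
  · have hr : 0 < lam ^ α⁻¹ := Real.rpow_pos_of_pos h _
    have := relax_le hα hα1 (mul_pos hr ht)
    rw [Real.mul_rpow hr.le ht.le, ← Real.rpow_mul hlam, mul_neg, inv_mul_cancel₀ hα.ne',
      Real.rpow_neg_one] at this
    calc lam * relaxRate α lam t ≤ lam * (lam⁻¹ * t ^ (-α) / Real.Gamma (2 - α)) := by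
          exact mul_le_mul_of_nonneg_left this hlam
      _ = _ := by field_simp

lemma exists_le_relaxRate (hα : 0 < α) (hα1 : α < 1) :
    ∃ c : ℝ, 0 < c ∧ ∀ lam t, 0 < lam → 0 < t → c / (1 + lam * t ^ α) ≤ relaxRate α lam t := by
  obtain ⟨c, hc, h⟩ := exists_le_relax hα hα1
  refine ⟨c, hc, fun lam t hlam ht => ?_⟩
  have hr : 0 < lam ^ α⁻¹ := Real.rpow_pos_of_pos hlam _
  have := h _ (mul_pos hr ht)
  rwa [Real.mul_rpow hr.le ht.le, Real.rpow_inv_rpow hlam.le hα.ne'] at this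

/-- Rescale time by lam^{1/α}: the kernel is homogeneous of degree -α, which produces the factor
lam. Rate 0, needed for l = 0, is treated apart because the scaling degenerates. -/
lemma integral_rlKernel_mul_one_sub_relaxRate (hα : 0 < α) (hα1 : α < 1) (hlam : 0 ≤ lam)
    {t : ℝ} (ht : 0 < t) :
    ∫ τ in (0 : ℝ)..t, rlKernel (1 - α) (t - τ) * (1 - relaxRate α lam τ)
      = lam * ∫ τ in (0 : ℝ)..t, relaxRate α lam τ := by
  rcases hlam.eq_or_lt with h | h
  · subst h
    have : (0 : ℝ) ^ α⁻¹ = 0 := Real.zero_rpow (by positivity)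
    simp [relaxRate, this, relax_zero hα]
  · have hr : 0 < lam ^ α⁻¹ := Real.rpow_pos_of_pos h _
    have hkey := integral_rlKernel_mul_one_sub_relax hα hα1 (mul_pos hr ht)
    have h1 := intervalIntegral.integral_comp_mul_left (a := 0) (b := t)
      (fun τ => rlKernel (1 - α) (lam ^ α⁻¹ * t - τ) * (1 - relax α τ)) hr.ne'
    have h2 := intervalIntegral.integral_comp_mul_left (a := 0) (b := t) (relax α) hr.ne'
    rw [mul_zero] at h1 h2
    rw [hkey] at h1
    have h3 : ∫ τ in (0 : ℝ)..t, relaxRate α lam τ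
        = (lam ^ α⁻¹)⁻¹ • ∫ x in (0 : ℝ)..lam ^ α⁻¹ * t, relax α x := h2
    rw [h3, ← h1, ← intervalIntegral.integral_const_mul]
    refine intervalIntegral.integral_congr fun τ hτ => ?_
    rw [uIcc_of_le ht.le] at hτ
    have e : rlKernel (1 - α) (t - τ) = lam * rlKernel (1 - α) (lam ^ α⁻¹ * t - lam ^ α⁻¹ * τ) := by
      rw [← mul_sub, rlKernel, rlKernel, Real.mul_rpow hr.le (sub_nonneg.2 hτ.2),
        ← Real.rpow_mul hlam, show α⁻¹ * (1 - α - 1) = -1 by field_simp; ring, Real.rpow_neg_one]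
      field_simp
    simp only [relaxRate]
    rw [e]
    ring

end relaxRate

/-! ### Uniqueness for the scalar equation -/

lemma measurable_rlKernel (c : ℝ) : Measurable (rlKernel c) := by
  unfold rlKernel
  fun_prop

/-- The semigroup property of fractional integration. -/
lemma integral_rlKernel_smul_integral {a b t : ℝ} (ha : 0 < a) (hb : 0 < b) (ht : 0 < t)
    {c : ℝ → ℂ} (hc : Continuous c) :
    ∫ x in (0 : ℝ)..t, rlKernel a (t - x) • ∫ τ in (0 : ℝ)..x, rlKernel b (x - τ) • c τ
      = ∫ τ in (0 : ℝ)..t, rlKernel (a + b) (t - τ) • c τ := by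
  let m : Measure ℝ := volume.restrict (Ioc 0 t)
  -- The indicator of τ < x extends the integrand from the triangle to the square (0, t]², where
  -- Fubini applies and the inner integral becomes a Beta integral.
  let F0 : ℝ → ℝ → ℝ := fun x τ => rlKernel a (t - x) * (Iio x).indicator (fun τ => rlKernel b (x - τ)) τ
  let F : ℝ → ℝ → ℂ := fun x τ => F0 x τ • c τ
  have hF0meas : Measurable (Function.uncurry F0) := by
    refine ((measurable_rlKernel a).comp (by fun_prop)).mul ?_
    have : (fun p : ℝ × ℝ => (Iio p.1).indicator (fun τ => rlKernel b (p.1 - τ)) p.2)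
        = {p : ℝ × ℝ | p.2 < p.1}.indicator (fun p => rlKernel b (p.1 - p.2)) := by
      funext p
      simp [indicator]
    rw [this]
    exact ((measurable_rlKernel b).comp (by fun_prop)).indicator
      (measurableSet_lt measurable_snd measurable_fst)
  have hae : ∀ᵐ x ∂m, x ∈ Ioo 0 t := by
    simp only [m]
    rw [← Measure.restrict_congr_set Ioo_ae_eq_Ioc]
    exact ae_restrict_mem measurableSet_Ioo
  have hinner {E : Type} [NormedAddCommGroup E] [NormedSpace ℝ E] (f : ℝ → E) (x : ℝ)
      (hx : x ∈ Ioo 0 t) :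
      ∫ τ, (Iio x).indicator f τ ∂m = ∫ τ in (0 : ℝ)..x, f τ := by
    rw [integral_indicator measurableSet_Iio, Measure.restrict_restrict measurableSet_Iio,
      intervalIntegral.integral_of_le hx.1.le, integral_Ioc_eq_integral_Ioo]
    congr 2
    ext y
    simp only [mem_inter_iff, mem_Iio, mem_Ioc, mem_Ioo]
    exact ⟨fun h => ⟨h.2.1, h.1⟩, fun h => ⟨h.2, h.1, (h.2.trans hx.2).le⟩⟩
  have hF0int : Integrable (Function.uncurry F0) (m.prod m) := by
    rw [integrable_prod_iff hF0meas.aestronglyMeasurable]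
    refine ⟨?_, ?_⟩
    · filter_upwards [hae] with x hx
      change Integrable (fun τ => rlKernel a (t - x)
        * (Iio x).indicator (fun τ => rlKernel b (x - τ)) τ) m
      refine Integrable.const_mul ?_ _
      rw [integrable_indicator_iff measurableSet_Iio, IntegrableOn,
        Measure.restrict_restrict measurableSet_Iio]
      have := (intervalIntegrable_iff_integrableOn_Ioc_of_le hx.1.le).1
        (intervalIntegrable_rlKernel_comp_sub hb hx.1)
      exact this.mono_set fun y hy => ⟨hy.2.1, (mem_Iio.1 hy.1).le⟩
    · have h1 := (intervalIntegrable_iff_integrableOn_Ioc_of_le ht.le).1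
        (intervalIntegrable_rlKernel_mul_rlKernel ha (add_pos hb one_pos) ht)
      refine Integrable.congr h1 ?_
      filter_upwards [hae] with x hx
      have hax := rlKernel_nonneg ha (sub_pos.2 hx.2).le
      rw [← integral_rlKernel_comp_sub hb hx.1, ← hinner _ x hx, ← integral_const_mul]
      refine integral_congr_ae (Eventually.of_forall fun τ => ?_)
      simp only [Function.uncurry, F0]
      rw [Real.norm_of_nonneg]
      refine mul_nonneg hax (indicator_nonneg (fun y hy => ?_) _)
      exact rlKernel_nonneg hb (sub_pos.2 hy).le
  have hFint : Integrable (Function.uncurry F) (m.prod m) := by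
    obtain ⟨C, hC⟩ := isCompact_Icc.exists_bound_of_continuousOn (hc.continuousOn (s := Icc 0 t))
    have hae2 : ∀ᵐ p ∂(m.prod m), p ∈ (Ioc 0 t ×ˢ Ioc 0 t : Set (ℝ × ℝ)) := by
      rw [Measure.prod_restrict]
      exact ae_restrict_mem (measurableSet_Ioc.prod measurableSet_Ioc)
    refine (hF0int.norm.const_mul C).mono' ?_ ?_
    · exact hF0meas.aestronglyMeasurable.smul
        (hc.comp continuous_snd).measurable.aestronglyMeasurable
    · filter_upwards [hae2] with p hp
      simp only [Function.uncurry, F]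
      rw [norm_smul, mul_comm]
      gcongr
      exact hC _ ⟨hp.2.1.le, hp.2.2⟩
  have hswap := integral_integral_swap hFint
  rw [intervalIntegral.integral_of_le ht.le, intervalIntegral.integral_of_le ht.le]
  have hL : ∫ x in Ioc 0 t, rlKernel a (t - x) • ∫ τ in (0 : ℝ)..x, rlKernel b (x - τ) • c τ
      = ∫ x, ∫ τ, F x τ ∂m ∂m := by
    refine integral_congr_ae ?_
    filter_upwards [hae] with x hx
    rw [← hinner _ x hx, ← integral_smul]
    refine integral_congr_ae (Eventually.of_forall fun τ => ?_)
    simp only [F, F0, indicator]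
    split_ifs
    · rw [smul_smul]
    · simp
  rw [hL, hswap]
  refine integral_congr_ae ?_
  filter_upwards [hae] with τ hτ
  simp only [F]
  rw [integral_smul_const]
  congr 1
  have htτ : 0 < t - τ := sub_pos.2 hτ.2
  rw [← integral_rlKernel_mul_rlKernel ha hb htτ]
  have hshift := intervalIntegral.integral_comp_sub_right (a := τ) (b := t)
    (fun y => rlKernel a (t - τ - y) * rlKernel b y) τ
  rw [sub_self] at hshift
  rw [← hshift, intervalIntegral.integral_of_le hτ.2.le]
  have : ∀ x, F0 x τ = (Ioi τ).indicator (fun x => rlKernel a (t - x) * rlKernel b (x - τ)) x := by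
    intro x
    simp only [F0, indicator, mem_Iio, mem_Ioi]
    split_ifs <;> simp
  simp only [this]
  rw [integral_indicator measurableSet_Ioi, Measure.restrict_restrict measurableSet_Ioi]
  have hset : Ioi τ ∩ Ioc 0 t = Ioc τ t := by
    ext y
    simp only [mem_inter_iff, mem_Ioi, mem_Ioc]
    exact ⟨fun h => ⟨h.1, h.2.2⟩, fun h => ⟨h.1, hτ.1.trans h.1, h.2⟩⟩
  rw [hset]
  simp

/-- The total mass over (0, ∞) of the exponentially damped kernel is γ^{-a}; a large γ makes
fractional integration a contraction in a weighted sup norm. -/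
lemma integral_rlKernel_mul_exp_le {a γ t : ℝ} (ha : 0 < a) (hγ : 0 < γ) (ht : 0 < t) :
    ∫ x in (0 : ℝ)..t, rlKernel a (t - x) * Real.exp (-(γ * (t - x))) ≤ γ ^ (-a) := by
  have hG := Real.Gamma_pos_of_pos ha
  have h := Real.integral_rpow_mul_exp_neg_mul_Ioi ha hγ
  have hint : IntegrableOn (fun y => rlKernel a y * Real.exp (-(γ * y))) (Ioi 0) := by
    have : IntegrableOn (fun y : ℝ => y ^ (a - 1) * Real.exp (-(γ * y))) (Ioi 0) := by
      by_contra hcon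
      rw [integral_undef hcon] at h
      have : 0 < (1 / γ) ^ a * Real.Gamma a := by positivity
      linarith
    refine (this.div_const (Real.Gamma a)).congr (Eventually.of_forall fun y => ?_)
    simp only [rlKernel]
    ring
  have hsub := intervalIntegral.integral_comp_sub_left (a := 0) (b := t)
    (fun y => rlKernel a y * Real.exp (-(γ * y))) t
  rw [sub_self, sub_zero] at hsub
  rw [hsub, intervalIntegral.integral_of_le ht.le]
  calc ∫ y in Ioc 0 t, rlKernel a y * Real.exp (-(γ * y))
      ≤ ∫ y in Ioi 0, rlKernel a y * Real.exp (-(γ * y)) := by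
        refine setIntegral_mono_set hint ?_ Ioc_subset_Ioi_self.eventuallyLE
        filter_upwards [ae_restrict_mem measurableSet_Ioi] with y hy
        exact mul_nonneg (rlKernel_nonneg ha (mem_Ioi.1 hy).le) (Real.exp_pos _).le
    _ = (Real.Gamma a)⁻¹ * ∫ y in Ioi 0, y ^ (a - 1) * Real.exp (-(γ * y)) := by
        rw [← integral_const_mul]
        refine integral_congr_ae (Eventually.of_forall fun y => ?_)
        simp only [rlKernel]
        ring
    _ = γ ^ (-a) := by
        rw [h, one_div, Real.inv_rpow hγ.le, Real.rpow_neg hγ.le]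
        field_simp

/-- The homogeneous fractional Volterra equation has only the zero solution. -/
lemma eq_zero_of_eq_integral_rlKernel {a : ℝ} (ha : 0 < a) (z : ℂ) {w : ℝ → ℂ} (hw : Continuous w)
    (h0 : w 0 = 0)
    (h : ∀ t, 0 < t → w t = z * ∫ x in (0 : ℝ)..t, rlKernel a (t - x) • w x) :
    ∀ t, 0 ≤ t → w t = 0 := by
  intro T hT
  -- With the weight e^{-γt}, this γ gives z times the integral operator a norm of at most
  -- ‖z‖/(2(‖z‖+1)) < 1/2, so the weighted maximum M satisfies M ≤ M/2.
  set γ : ℝ := (2 * (‖z‖ + 1)) ^ a⁻¹ with hγdef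
  have hz2 : 0 < 2 * (‖z‖ + 1) := by positivity
  have hγ : 0 < γ := Real.rpow_pos_of_pos hz2 _
  have hγa : γ ^ (-a) = (2 * (‖z‖ + 1))⁻¹ := by
    rw [Real.rpow_neg hγ.le, hγdef, Real.rpow_inv_rpow hz2.le ha.ne']
  obtain ⟨t₀, ht₀, hmax⟩ := isCompact_Icc.exists_isMaxOn (nonempty_Icc.2 hT)
    (f := fun t => Real.exp (-(γ * t)) * ‖w t‖) (by fun_prop)
  set M := Real.exp (-(γ * t₀)) * ‖w t₀‖ with hM
  have hM0 : 0 ≤ M := by positivity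
  have hMz : M = 0 := by
    rcases eq_or_lt_of_le ht₀.1 with h00 | h00
    · rw [hM, ← h00, h0, norm_zero, mul_zero]
    · have hb : ‖∫ x in (0 : ℝ)..t₀, rlKernel a (t₀ - x) • w x‖
          ≤ ∫ x in (0 : ℝ)..t₀, Real.exp (γ * t₀) * M
            * (rlKernel a (t₀ - x) * Real.exp (-(γ * (t₀ - x)))) := by
        refine intervalIntegral.norm_integral_le_of_norm_le h00.le ?_ ?_
        · refine Eventually.of_forall fun x hx => ?_
          have hk := rlKernel_nonneg ha (sub_nonneg.2 hx.2)
          have hmx : Real.exp (-(γ * x)) * ‖w x‖ ≤ M := hmax ⟨hx.1.le, hx.2.trans ht₀.2⟩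
          rw [norm_smul, Real.norm_of_nonneg hk]
          have e : Real.exp (γ * t₀) * Real.exp (-(γ * (t₀ - x))) = Real.exp (γ * x) := by
            rw [← Real.exp_add]; congr 1; ring
          have hwx : ‖w x‖ ≤ Real.exp (γ * x) * M := by
            calc ‖w x‖ = Real.exp (γ * x) * (Real.exp (-(γ * x)) * ‖w x‖) := by
                  rw [← mul_assoc, ← Real.exp_add]; simp
              _ ≤ _ := by gcongr
          calc rlKernel a (t₀ - x) * ‖w x‖ ≤ rlKernel a (t₀ - x) * (Real.exp (γ * x) * M) := by gcongr
            _ = _ := by rw [← e]; ring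
        · refine IntervalIntegrable.const_mul ?_ _
          exact (intervalIntegrable_rlKernel_comp_sub ha h00).mul_continuousOn (by fun_prop)
      rw [intervalIntegral.integral_const_mul] at hb
      have hle := integral_rlKernel_mul_exp_le ha hγ h00
      rw [hγa] at hle
      have hw0 : ‖w t₀‖ ≤ ‖z‖ * (Real.exp (γ * t₀) * M * (2 * (‖z‖ + 1))⁻¹) := by
        rw [h t₀ h00, norm_mul]
        gcongr
        refine hb.trans ?_
        gcongr
      have : M ≤ M / 2 := by
        calc M ≤ Real.exp (-(γ * t₀)) * (‖z‖ * (Real.exp (γ * t₀) * M * (2 * (‖z‖ + 1))⁻¹)) := by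
              rw [hM]; gcongr
          _ = (Real.exp (-(γ * t₀)) * Real.exp (γ * t₀)) * (‖z‖ / (‖z‖ + 1)) * (M / 2) := by
              field_simp
          _ = ‖z‖ / (‖z‖ + 1) * (M / 2) := by rw [← Real.exp_add]; simp
          _ ≤ 1 * (M / 2) := by
              gcongr
              rw [div_le_one (by positivity)]
              linarith
          _ = M / 2 := one_mul _
      linarith
  have hmT : Real.exp (-(γ * T)) * ‖w T‖ ≤ M := hmax (right_mem_Icc.2 hT)
  rw [hMz] at hmT
  have := Real.exp_pos (-(γ * T))
  have hn := norm_nonneg (w T)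
  have : ‖w T‖ = 0 := by nlinarith
  exact norm_eq_zero.1 this

/-- Uniqueness for the scalar time-fractional equation with zero initial value. -/
lemma eq_zero_of_hasDerivAt_integral_rlKernel {α : ℝ} (hα : 0 < α) (hα1 : α < 1) (z : ℂ)
    {c : ℝ → ℂ} (hc : ContinuousOn c (Ici 0))
    (h : ∀ t, 0 < t → HasDerivAt (fun r => ∫ τ in (0 : ℝ)..r, rlKernel (1 - α) (r - τ) • c τ)
      (z * c t) t) :
    ∀ t, 0 < t → c t = 0 := by
  have hc1 := sub_pos.2 hα1
  -- Freezing c at its value at 0 for negative times gives a function continuous on ℝ whose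
  -- primitive w is differentiable everywhere.
  let c' : ℝ → ℂ := fun t => c (max 0 t)
  have hc' : Continuous c' :=
    hc.comp_continuous (by fun_prop) fun t => mem_Ici.2 (le_max_left _ _)
  have hcc (t : ℝ) (ht : 0 ≤ t) : c' t = c t := by simp [c', max_eq_right ht]
  let w : ℝ → ℂ := fun t => ∫ τ in (0 : ℝ)..t, c' τ
  have hwd (t : ℝ) : HasDerivAt w (c' t) t := hc'.integral_hasStrictDerivAt 0 t |>.hasDerivAt
  have hw : Continuous w := continuous_iff_continuousAt.2 fun t => (hwd t).continuousAt
  let J : ℝ → ℂ := fun r => ∫ τ in (0 : ℝ)..r, rlKernel (1 - α) (r - τ) • c' τ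
  have hJ (r : ℝ) (hr : 0 < r) : J r = ∫ τ in (0 : ℝ)..r, rlKernel (1 - α) (r - τ) • c τ := by
    refine intervalIntegral.integral_congr fun τ hτ => ?_
    rw [uIcc_of_le hr.le] at hτ
    simp only [hcc τ hτ.1]
  have hJd (t : ℝ) (ht : 0 < t) : HasDerivAt (fun r => J r - z * w r) 0 t := by
    have h1 : HasDerivAt J (z * c t) t := (h t ht).congr_of_eventuallyEq (by
      filter_upwards [Ioi_mem_nhds ht] with r hr using hJ r hr)
    have h2 := (hwd t).const_mul z
    rw [hcc t ht.le] at h2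
    exact (h1.sub h2).congr_deriv (sub_self _)
  obtain ⟨A, hA⟩ : ∃ A, ∀ t ∈ Ioi (0 : ℝ), J t - z * w t = A :=
    isOpen_Ioi.exists_is_const_of_deriv_eq_zero isPreconnected_Ioi
      (fun t ht => (hJd t ht).differentiableAt.differentiableWithinAt) fun t ht => (hJd t ht).deriv
  -- J is bounded by a multiple of t^{1-α} near 0, so the constant of integration in J = z w + A
  -- vanishes.
  have hJlim : Tendsto J (𝓝[>] 0) (𝓝 0) := by
    obtain ⟨C, hC⟩ := isCompact_Icc.exists_bound_of_continuousOn (hc'.continuousOn (s := Icc 0 1))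
    have hlim : Tendsto (fun t : ℝ => C * rlKernel (1 - α + 1) t) (𝓝[>] 0) (𝓝 0) := by
      have : ContinuousAt (fun t : ℝ => C * (t ^ (1 - α) / Real.Gamma (1 - α + 1))) 0 :=
        ContinuousAt.mul continuousAt_const
          ((Real.continuousAt_rpow_const _ _ (Or.inr hc1.le)).div_const _)
      have h := this.tendsto
      simp only [Real.zero_rpow hc1.ne', zero_div, mul_zero] at h
      simpa [rlKernel] using h.mono_left nhdsWithin_le_nhds
    refine squeeze_zero_norm' ?_ hlim
    filter_upwards [self_mem_nhdsWithin, mem_nhdsWithin_of_mem_nhds (Iio_mem_nhds one_pos)]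
      with t ht ht1
    have ht : 0 < t := ht
    rw [← integral_rlKernel_comp_sub hc1 ht, ← intervalIntegral.integral_const_mul]
    refine intervalIntegral.norm_integral_le_of_norm_le ht.le (Eventually.of_forall fun τ hτ => ?_)
      ((intervalIntegrable_rlKernel_comp_sub hc1 ht).const_mul C)
    have hk := rlKernel_nonneg hc1 (sub_nonneg.2 hτ.2)
    rw [norm_smul, Real.norm_of_nonneg hk, mul_comm]
    exact mul_le_mul_of_nonneg_right (hC τ ⟨hτ.1.le, hτ.2.trans (le_of_lt ht1)⟩) hk
  have hA0 : A = 0 := by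
    have hwlim : Tendsto w (𝓝[>] 0) (𝓝 0) := by
      have := hw.tendsto 0
      rw [show w 0 = 0 from intervalIntegral.integral_same] at this
      exact this.mono_left nhdsWithin_le_nhds
    have h1 := hJlim.sub (hwlim.const_mul z)
    rw [mul_zero, sub_zero] at h1
    refine tendsto_nhds_unique (tendsto_const_nhds.congr' ?_) h1
    filter_upwards [self_mem_nhdsWithin] with t ht using (hA t ht).symm
  have hJw (t : ℝ) (ht : 0 ≤ t) : J t = z * w t := by
    rcases ht.eq_or_lt with h | h
    · subst h; simp [J, w]
    · rw [← sub_eq_zero, hA t h, hA0]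
  -- Apply fractional integration of order α to J = z w. By the semigroup property the left side
  -- becomes the ordinary primitive w, leaving a Volterra equation for w.
  have hwz := eq_zero_of_eq_integral_rlKernel hα z hw intervalIntegral.integral_same fun t ht => by
    have h1 := integral_rlKernel_smul_integral hα hc1 ht hc'
    simp only [add_sub_cancel, rlKernel_one, one_smul] at h1
    change ∫ τ in (0 : ℝ)..t, c' τ = _
    rw [← h1, ← intervalIntegral.integral_const_mul]
    refine intervalIntegral.integral_congr fun x hx => ?_
    rw [uIcc_of_le ht.le] at hx
    have := hJw x hx.1
    simp only [J] at this
    rw [this, mul_smul_comm]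
  intro t ht
  rw [← hcc t ht.le, ← (hwd t).deriv]
  have : w =ᶠ[𝓝 t] fun _ => 0 := by
    filter_upwards [Ioi_mem_nhds ht] with x hx using hwz x (le_of_lt hx)
  rw [this.deriv_eq, deriv_const]

/-! ### Rotation invariance and integration by parts on the sphere -/

/-- The map of the sphere induced by a linear isometry of the space. -/
def sphereMap (R : E3 ≃ₗᵢ[ℝ] E3) (x : S2) : S2 := ⟨R x.1, by simp⟩

lemma continuous_sphereMap (R : E3 ≃ₗᵢ[ℝ] E3) : Continuous (sphereMap R) :=
  (R.continuous.comp continuous_subtype_val).subtype_mk _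

-- The surface measure of s is a multiple of the volume of the cone (0, 1) • s. A linear isometry
-- maps cones to cones and preserves volume.
open scoped Pointwise in
lemma measurePreserving_sphereMap (R : E3 ≃ₗᵢ[ℝ] E3) :
    MeasurePreserving (sphereMap R) surf surf := by
  refine ⟨(continuous_sphereMap R).measurable, ?_⟩
  ext s hs
  rw [Measure.map_apply (continuous_sphereMap R).measurable hs, surf,
    Measure.toSphere_apply' _ hs,
    Measure.toSphere_apply' _ ((continuous_sphereMap R).measurable hs)]
  congr 1
  have hset : Ioo (0 : ℝ) 1 • (Subtype.val '' (sphereMap R ⁻¹' s))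
      = R.toMeasurableEquiv ⁻¹' (Ioo (0 : ℝ) 1 • (Subtype.val '' s)) := by
    ext y
    rw [mem_preimage, Set.mem_smul, Set.mem_smul]
    constructor
    · rintro ⟨r, hr, _, ⟨x, hx, rfl⟩, rfl⟩
      exact ⟨r, hr, _, ⟨sphereMap R x, hx, rfl⟩, (R.map_smul r x.1).symm⟩
    · rintro ⟨r, hr, _, ⟨x, hx, rfl⟩, h⟩
      refine ⟨r, hr, _, ⟨sphereMap R.symm x, ?_, rfl⟩, ?_⟩
      · have : sphereMap R (sphereMap R.symm x) = x := Subtype.ext (by simp [sphereMap])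
        rwa [mem_preimage, this]
      · change r • R.symm x.1 = y
        rw [← R.symm.map_smul]
        change R.symm (r • x.1) = y
        have h' : r • x.1 = R y := h
        rw [h', R.symm_apply_apply]
  rw [hset]
  exact R.measurePreserving.measure_preimage_equiv (f := R.toMeasurableEquiv) _

/-- The one-parameter group of rotations with a skew generator. -/
def rotation (A : E3 →L[ℝ] E3) (hA : A ∈ skewAdjoint (E3 →L[ℝ] E3)) (θ : ℝ) : E3 ≃ₗᵢ[ℝ] E3 :=
  letI : NormedAlgebra ℚ (E3 →L[ℝ] E3) := NormedAlgebra.restrictScalars ℚ ℝ _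
  Unitary.linearIsometryEquiv ⟨NormedSpace.exp (θ • A),
    NormedSpace.exp_mem_unitary_of_mem_skewAdjoint (skewAdjoint.smul_mem θ hA)⟩

lemma rotation_apply (A : E3 →L[ℝ] E3) (hA : A ∈ skewAdjoint (E3 →L[ℝ] E3)) (θ : ℝ) (x : E3) :
    rotation A hA θ x = NormedSpace.exp (θ • A) x := rfl

lemma rotation_zero (A : E3 →L[ℝ] E3) (hA : A ∈ skewAdjoint (E3 →L[ℝ] E3)) (x : E3) :
    rotation A hA 0 x = x := by
  rw [rotation_apply, show (0 : ℝ) • A = 0 from zero_smul ℝ A, NormedSpace.exp_zero]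
  rfl

lemma hasDerivAt_rotation (A : E3 →L[ℝ] E3) (hA : A ∈ skewAdjoint (E3 →L[ℝ] E3)) (x : E3) (θ : ℝ) :
    HasDerivAt (fun θ => rotation A hA θ x) (A (rotation A hA θ x)) θ := by
  have h := hasDerivAt_exp_smul_const' (𝕂 := ℝ) A θ
  exact h.clm_apply (hasDerivAt_const θ x) |>.congr_deriv (by simp [rotation_apply])

/-- The derivative along the linear vector field `A`. -/
def lieD (A : E3 →L[ℝ] E3) (g : E3 → ℂ) (x : E3) : ℂ := fderiv ℝ g x (A x)

lemma isOpen_compl_zero : IsOpen ({0}ᶜ : Set E3) := isOpen_compl_singleton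

lemma S2.ne_zero (x : S2) : x.1 ≠ 0 := ne_zero_of_mem_unit_sphere x

lemma S2.compl_mem_nhds (x : S2) : ({0}ᶜ : Set E3) ∈ 𝓝 x.1 :=
  isOpen_compl_zero.mem_nhds (S2.ne_zero x)

lemma ContDiffOn.lieD {A : E3 →L[ℝ] E3} {g : E3 → ℂ} {m n : WithTop ℕ∞}
    (hg : ContDiffOn ℝ n g {0}ᶜ) (hmn : m + 1 ≤ n) :
    ContDiffOn ℝ m (SphereKolmogorov.lieD A g) {0}ᶜ :=
  (hg.fderiv_of_isOpen isOpen_compl_zero hmn).clm_apply A.contDiff.contDiffOn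

lemma ContDiffOn.differentiableAt_sphere {g : E3 → ℂ} {n : WithTop ℕ∞}
    (hg : ContDiffOn ℝ n g {0}ᶜ) (hn : n ≠ 0) (x : S2) : DifferentiableAt ℝ g x.1 :=
  (hg.contDiffAt (S2.compl_mem_nhds x)).differentiableAt hn

lemma ContinuousOn.continuous_sphere {g : E3 → ℂ} (hg : ContinuousOn g {0}ᶜ) :
    Continuous fun x : S2 => g x.1 :=
  hg.comp_continuous continuous_subtype_val fun x => S2.ne_zero x

lemma Continuous.integrable_surf {g : S2 → ℂ} (hg : Continuous g) : Integrable g surf :=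
  hg.integrable_of_hasCompactSupport (HasCompactSupport.of_compactSpace g)

/-- A derivative along a rotation field has mean zero on the sphere. -/
lemma integral_lieD_eq_zero {A : E3 →L[ℝ] E3} (hA : A ∈ skewAdjoint (E3 →L[ℝ] E3)) {g : E3 → ℂ}
    (hg : ContDiffOn ℝ 1 g {0}ᶜ) : ∫ x : S2, lieD A g x.1 ∂surf = 0 := by
  have hL : Continuous fun x : S2 => lieD A g x.1 :=
    ContinuousOn.continuous_sphere (ContDiffOn.lieD (m := 0) hg (by simp)).continuousOn
  have hg0 : Continuous fun x : S2 => g x.1 := ContinuousOn.continuous_sphere hg.continuousOn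
  obtain ⟨C, hC⟩ := isCompact_univ.exists_bound_of_continuousOn hL.continuousOn
  -- Differentiate the integral of g(R_θ x) at θ = 0 under the integral sign; by rotation invariance
  -- it does not depend on θ.
  have h := hasDerivAt_integral_of_dominated_loc_of_deriv_le (μ := surf) (s := univ) (x₀ := (0 : ℝ))
    (F := fun θ (x : S2) => g (sphereMap (rotation A hA θ) x).1)
    (F' := fun θ (x : S2) => lieD A g (sphereMap (rotation A hA θ) x).1) (bound := fun _ => C)
    univ_mem
    (Eventually.of_forall fun θ =>
      (hg0.comp (continuous_sphereMap _)).measurable.aestronglyMeasurable)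
    (Continuous.integrable_surf (hg0.comp (continuous_sphereMap _)))
    (hL.comp (continuous_sphereMap _)).measurable.aestronglyMeasurable
    (Eventually.of_forall fun x θ _ => hC _ (mem_univ _)) (integrable_const C)
    (Eventually.of_forall fun x θ _ => by
      have h1 := hasDerivAt_rotation A hA x.1 θ
      have h2 := (ContDiffOn.differentiableAt_sphere hg one_ne_zero
        (sphereMap (rotation A hA θ) x)).hasFDerivAt
      exact h2.comp_hasDerivAt θ h1)
  have hconst (θ : ℝ) : ∫ x : S2, g (sphereMap (rotation A hA θ) x).1 ∂surf
      = ∫ x : S2, g x.1 ∂surf := by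
    have hmp := measurePreserving_sphereMap (rotation A hA θ)
    have h := integral_map (μ := surf) hmp.measurable.aemeasurable
      (f := fun x : S2 => g x.1) hg0.measurable.aestronglyMeasurable
    rw [hmp.map_eq] at h
    exact h.symm
  simp only [hconst] at h
  have h3 := h.2.unique (hasDerivAt_const (0 : ℝ) (∫ x : S2, g x.1 ∂surf))
  rw [← h3]
  refine integral_congr_ae (Eventually.of_forall fun x => ?_)
  simp only [sphereMap, rotation_zero]

lemma lieD_mul {A : E3 →L[ℝ] E3} {g h : E3 → ℂ} {x : E3} (hg : DifferentiableAt ℝ g x)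
    (hh : DifferentiableAt ℝ h x) :
    lieD A (fun y => g y * h y) x = g x * lieD A h x + lieD A g x * h x := by
  have := (hg.hasFDerivAt.mul hh.hasFDerivAt).fderiv
  simp only [lieD]
  change fderiv ℝ (g * h) x (A x) = _
  rw [this]
  simp [mul_comm]

/-- Integration by parts along a rotation field. -/
lemma integral_lieD_mul {A : E3 →L[ℝ] E3} (hA : A ∈ skewAdjoint (E3 →L[ℝ] E3)) {g h : E3 → ℂ}
    (hg : ContDiffOn ℝ 1 g {0}ᶜ) (hh : ContDiffOn ℝ 1 h {0}ᶜ) :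
    ∫ x : S2, g x.1 * lieD A h x.1 ∂surf = -∫ x : S2, lieD A g x.1 * h x.1 ∂surf := by
  have h0 := integral_lieD_eq_zero hA (hg.mul hh)
  have hc1 : Continuous fun x : S2 => g x.1 * lieD A h x.1 :=
    (ContinuousOn.continuous_sphere hg.continuousOn).mul
      (ContinuousOn.continuous_sphere (ContDiffOn.lieD (m := 0) hh (by simp)).continuousOn)
  have hc2 : Continuous fun x : S2 => lieD A g x.1 * h x.1 :=
    (ContinuousOn.continuous_sphere (ContDiffOn.lieD (m := 0) hg (by simp)).continuousOn).mul
      (ContinuousOn.continuous_sphere hh.continuousOn)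
  have e : ∫ x : S2, lieD A (fun y => g y * h y) x.1 ∂surf
      = ∫ x : S2, (g x.1 * lieD A h x.1 + lieD A g x.1 * h x.1) ∂surf :=
    integral_congr_ae (Eventually.of_forall fun x =>
      lieD_mul (ContDiffOn.differentiableAt_sphere hg one_ne_zero x)
        (ContDiffOn.differentiableAt_sphere hh one_ne_zero x))
  rw [integral_add (Continuous.integrable_surf hc1) (Continuous.integrable_surf hc2)] at e
  have h0' : ∫ x : S2, lieD A (fun y => g y * h y) x.1 ∂surf = 0 := h0
  rw [e] at h0'
  exact eq_neg_of_add_eq_zero_left h0'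

/-- Derivatives along a rotation field only depend on the values on the sphere. -/
lemma lieD_congr_sphere {A : E3 →L[ℝ] E3} (hA : A ∈ skewAdjoint (E3 →L[ℝ] E3)) {g h : E3 → ℂ}
    (hgh : ∀ x : S2, g x.1 = h x.1) (x : S2) (hg : DifferentiableAt ℝ g x.1)
    (hh : DifferentiableAt ℝ h x.1) : lieD A g x.1 = lieD A h x.1 := by
  have h1 := hasDerivAt_rotation A hA x.1 0
  have hx : rotation A hA 0 x.1 = x.1 := rotation_zero A hA x.1
  rw [hx] at h1
  have h2 := HasFDerivAt.comp_hasDerivAt (l := g) (0 : ℝ) (by rw [hx]; exact hg.hasFDerivAt) h1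
  have h3 := HasFDerivAt.comp_hasDerivAt (l := h) (0 : ℝ) (by rw [hx]; exact hh.hasFDerivAt) h1
  -- The orbit of x under the rotations stays on the sphere, where g and h agree.
  have e : g ∘ (fun θ => rotation A hA θ x.1) = h ∘ (fun θ => rotation A hA θ x.1) := by
    funext θ
    exact hgh (sphereMap (rotation A hA θ) x)
  rw [e] at h2
  exact h2.unique h3

lemma lieD_conj (A : E3 →L[ℝ] E3) (g : E3 → ℂ) (x : E3) :
    lieD A (fun y => conj (g y)) x = conj (lieD A g x) := by
  have := Complex.conjCLE.comp_fderiv (f := g) (x := x)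
  simp only [lieD]
  change fderiv ℝ (Complex.conjCLE ∘ g) x (A x) = _
  rw [this]
  simp

/-! ### The Laplace–Beltrami operator through the rotation fields -/

/-- The generators `x ↦ e_i × x` of the rotations about the coordinate axes. -/
def rotGen (i : Fin 3) : E3 →L[ℝ] E3 :=
  LinearMap.toContinuousLinearMap
    { toFun := fun x => ![!₂[0, -x 2, x 1], !₂[x 2, 0, -x 0], !₂[-x 1, x 0, 0]] i
      map_add' := fun x y => by
        ext j
        fin_cases i <;> fin_cases j <;> simp <;> ring
      map_smul' := fun c x => by
        ext j
        fin_cases i <;> fin_cases j <;> simp }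

lemma rotGen_zero_apply (x : E3) : rotGen 0 x = !₂[0, -x 2, x 1] := rfl

lemma rotGen_one_apply (x : E3) : rotGen 1 x = !₂[x 2, 0, -x 0] := rfl

lemma rotGen_two_apply (x : E3) : rotGen 2 x = !₂[-x 1, x 0, 0] := rfl

lemma rotGen_mem_skewAdjoint (i : Fin 3) : rotGen i ∈ skewAdjoint (E3 →L[ℝ] E3) := by
  rw [skewAdjoint.mem_iff, ContinuousLinearMap.star_eq_adjoint]
  symm
  rw [ContinuousLinearMap.eq_adjoint_iff]
  intro x y
  fin_cases i <;>
  simp [rotGen_zero_apply, rotGen_one_apply, rotGen_two_apply, PiLp.inner_apply, Fin.sum_univ_three,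
    mul_comm]

/-- The sum of the squares of the rotation fields. -/
def lieLap (g : E3 → ℂ) (x : E3) : ℂ := ∑ i, lieD (rotGen i) (lieD (rotGen i) g) x

lemma ContDiffOn.lieLap {g : E3 → ℂ} (hg : ContDiffOn ℝ 2 g {0}ᶜ) :
    ContinuousOn (SphereKolmogorov.lieLap g) {0}ᶜ :=
  continuousOn_finsetSum _ fun _ _ =>
    (ContDiffOn.lieD (m := 0) (ContDiffOn.lieD (m := 1) hg (by norm_num)) (by simp)).continuousOn

lemma lieLap_conj (g : E3 → ℂ) (x : E3) :
    lieLap (fun y => conj (g y)) x = conj (lieLap g x) := by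
  have (i : Fin 3) : lieD (rotGen i) (fun y => conj (g y)) = fun y => conj (lieD (rotGen i) g y) :=
    funext fun y => lieD_conj _ g y
  simp only [lieLap, this, lieD_conj, map_sum]

/-- Green's formula on the sphere. -/
lemma integral_mul_lieLap {g h : E3 → ℂ} (hg : ContDiffOn ℝ 2 g {0}ᶜ)
    (hh : ContDiffOn ℝ 2 h {0}ᶜ) :
    ∫ x : S2, g x.1 * lieLap h x.1 ∂surf = ∫ x : S2, lieLap g x.1 * h x.1 ∂surf := by
  have hg1 : ContDiffOn ℝ 1 g {0}ᶜ := hg.of_le (by norm_num)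
  have hh1 : ContDiffOn ℝ 1 h {0}ᶜ := hh.of_le (by norm_num)
  have hcont {k : E3 → ℂ} (hk : ContDiffOn ℝ 2 k {0}ᶜ) (i : Fin 3) :
      Continuous fun x : S2 => lieD (rotGen i) (lieD (rotGen i) k) x.1 :=
    ContinuousOn.continuous_sphere
      (ContDiffOn.lieD (m := 0) (ContDiffOn.lieD (m := 1) hk (by norm_num)) (by simp)).continuousOn
  simp only [lieLap, Finset.mul_sum, Finset.sum_mul]
  rw [integral_finsetSum, integral_finsetSum]
  · refine Finset.sum_congr rfl fun i _ => ?_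
    have hDg : ContDiffOn ℝ 1 (lieD (rotGen i) g) {0}ᶜ := ContDiffOn.lieD hg (by norm_num)
    have hDh : ContDiffOn ℝ 1 (lieD (rotGen i) h) {0}ᶜ := ContDiffOn.lieD hh (by norm_num)
    rw [integral_lieD_mul (rotGen_mem_skewAdjoint i) hg1 hDh,
      integral_lieD_mul (rotGen_mem_skewAdjoint i) hDg hh1, neg_neg]
  · exact fun i _ => Continuous.integrable_surf
      ((hcont hg i).mul (ContinuousOn.continuous_sphere hh.continuousOn))
  · exact fun i _ => Continuous.integrable_surf
      ((ContinuousOn.continuous_sphere hg.continuousOn).mul (hcont hh i))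

lemma lieLap_congr_sphere {g h : E3 → ℂ} (hgh : ∀ x : S2, g x.1 = h x.1)
    (hg : ContDiffOn ℝ 2 g {0}ᶜ) (hh : ContDiffOn ℝ 2 h {0}ᶜ) (x : S2) :
    lieLap g x.1 = lieLap h x.1 := by
  refine Finset.sum_congr rfl fun i _ => ?_
  have hA := rotGen_mem_skewAdjoint i
  have hDg : ContDiffOn ℝ 1 (lieD (rotGen i) g) {0}ᶜ := ContDiffOn.lieD hg (by norm_num)
  have hDh : ContDiffOn ℝ 1 (lieD (rotGen i) h) {0}ᶜ := ContDiffOn.lieD hh (by norm_num)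
  refine lieD_congr_sphere hA (fun y => ?_) x (ContDiffOn.differentiableAt_sphere hDg one_ne_zero x)
    (ContDiffOn.differentiableAt_sphere hDh one_ne_zero x)
  exact lieD_congr_sphere hA hgh y (ContDiffOn.differentiableAt_sphere hg two_ne_zero y)
    (ContDiffOn.differentiableAt_sphere hh two_ne_zero y)

lemma homExt_sphere (h : S2 → ℂ) (x : S2) : homExt h x.1 = h x := by
  rw [homExt, dif_neg (S2.ne_zero x)]
  congr 1
  ext1
  have : ‖x.1‖ = 1 := norm_eq_of_mem_sphere x
  simp [this]

lemma homExt_smul (h : S2 → ℂ) {c : ℝ} (hc : 0 < c) (x : E3) : homExt h (c • x) = homExt h x := by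
  by_cases hx : x = 0
  · simp [hx]
  · have hcx : c • x ≠ 0 := smul_ne_zero hc.ne' hx
    rw [homExt, homExt, dif_neg hx, dif_neg hcx]
    congr 1
    ext1
    simp only [norm_smul, Real.norm_of_nonneg hc.le, smul_smul]
    congr 1
    field_simp

/-- Euler's relation for a function homogeneous of degree 0. -/
lemma fderiv_homExt_self {h : S2 → ℂ} (hh : IsC2 h) {x : E3} (hx : x ≠ 0) :
    fderiv ℝ (homExt h) x x = 0 := by
  have hd : DifferentiableAt ℝ (homExt h) x :=
    (hh.contDiffAt (isOpen_compl_zero.mem_nhds hx)).differentiableAt two_ne_zero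
  have h1 : HasDerivAt (fun c : ℝ => c • x) x 1 := by
    simpa using (hasDerivAt_id (1 : ℝ)).smul_const x
  have h2 := HasFDerivAt.comp_hasDerivAt (l := homExt h) (1 : ℝ)
    (by rw [one_smul]; exact hd.hasFDerivAt) h1
  refine h2.unique ((hasDerivAt_const (1 : ℝ) (homExt h x)).congr_of_eventuallyEq ?_)
  filter_upwards [Ioi_mem_nhds one_pos] with c hc using homExt_smul h hc x

/-- Differentiate Euler's relation along the ray through x, with the direction x held fixed. -/
lemma fderiv_fderiv_homExt_self {h : S2 → ℂ} (hh : IsC2 h) {x : E3} (hx : x ≠ 0) :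
    fderiv ℝ (fderiv ℝ (homExt h)) x x x = 0 := by
  have hd : DifferentiableAt ℝ (fderiv ℝ (homExt h)) x :=
    ((hh.contDiffAt (isOpen_compl_zero.mem_nhds hx)).fderiv_right (m := 1)
      (by norm_num)).differentiableAt one_ne_zero
  have h1 : HasDerivAt (fun c : ℝ => c • x) x 1 := by
    simpa using (hasDerivAt_id (1 : ℝ)).smul_const x
  have h2 := HasFDerivAt.comp_hasDerivAt (l := fderiv ℝ (homExt h)) (1 : ℝ)
    (by rw [one_smul]; exact hd.hasFDerivAt) h1
  have h3 := h2.clm_apply (hasDerivAt_const (1 : ℝ) x)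
  rw [map_zero, add_zero] at h3
  refine h3.unique ((hasDerivAt_const (1 : ℝ) (0 : ℂ)).congr_of_eventuallyEq ?_)
  filter_upwards [Ioi_mem_nhds one_pos] with c hc
  have hc : 0 < c := hc
  have h4 := fderiv_homExt_self hh (smul_ne_zero hc.ne' hx)
  rw [map_smul] at h4
  exact (smul_eq_zero.1 h4).resolve_left hc.ne'

lemma E3.eq_sum (x : E3) : x = x 0 • EuclideanSpace.single 0 1 + x 1 • EuclideanSpace.single 1 1
    + x 2 • EuclideanSpace.single 2 1 := by
  ext j
  fin_cases j <;> simp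

lemma S2.sum_sq (x : S2) : x.1 0 ^ 2 + x.1 1 ^ 2 + x.1 2 ^ 2 = 1 := by
  have h := EuclideanSpace.norm_sq_eq x.1
  rw [norm_eq_of_mem_sphere x, Fin.sum_univ_three] at h
  simpa using h.symm

/-- With A_i x = e_i × x one has A_i(A_i F) = D²F(A_i x, A_i x) + DF(A_i A_i x). On the unit sphere
∑ A_i x ⊗ A_i x = I - x ⊗ x, and ∑ A_i A_i x = -2x. Both extra terms vanish because F is constant
along rays. -/
lemma lapC2_eq_lieLap {h : S2 → ℂ} (hh : IsC2 h) (x : S2) :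
    lapC2 h x = lieLap (homExt h) x.1 := by
  set F := homExt h with hF
  set B := fderiv ℝ (fderiv ℝ F) x.1 with hB
  have hd : DifferentiableAt ℝ (fderiv ℝ F) x.1 :=
    ((hh.contDiffAt (S2.compl_mem_nhds x)).fderiv_right (m := 1)
      (by norm_num)).differentiableAt one_ne_zero
  have hlap : lapC2 h x = ∑ i, B (EuclideanSpace.single i 1) (EuclideanSpace.single i 1) := by
    rw [lapC2, InnerProductSpace.laplacian_eq_iteratedFDeriv_orthonormalBasis _
      (EuclideanSpace.basisFun (Fin 3) ℝ)]
    simp [iteratedFDeriv_two_apply, hB, hF]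
  have hLL (A : E3 →L[ℝ] E3) :
      lieD A (lieD A F) x.1 = B (A x.1) (A x.1) + fderiv ℝ F x.1 (A (A x.1)) := by
    have h1 : HasFDerivAt (fun y => fderiv ℝ F y (A y))
        ((fderiv ℝ F x.1).comp A + B.flip (A x.1)) x.1 :=
      hd.hasFDerivAt.clm_apply A.hasFDerivAt
    change fderiv ℝ (fun y => fderiv ℝ F y (A y)) x.1 (A x.1) = _
    rw [h1.fderiv]
    simp [add_comm]
  have h1 := fderiv_homExt_self hh (S2.ne_zero x)
  have h2 := fderiv_fderiv_homExt_self hh (S2.ne_zero x)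
  rw [← hF, ← hB] at h2
  rw [← hF] at h1
  have hx := S2.sum_sq x
  have hsum : ∑ i, rotGen i (rotGen i x.1) = (-2 : ℝ) • x.1 := by
    ext j
    rw [Fin.sum_univ_three, rotGen_zero_apply, rotGen_zero_apply, rotGen_one_apply,
      rotGen_one_apply, rotGen_two_apply, rotGen_two_apply]
    fin_cases j <;> simp <;> ring
  rw [hlap, lieLap]
  simp only [hLL, Finset.sum_add_distrib, ← map_sum]
  rw [hsum, map_smul, h1, smul_zero, add_zero]
  have e0 : rotGen 0 x.1 = -x.1 2 • EuclideanSpace.single 1 1 + x.1 1 • EuclideanSpace.single 2 1 := by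
    rw [rotGen_zero_apply]; ext j; fin_cases j <;> simp
  have e1 : rotGen 1 x.1 = x.1 2 • EuclideanSpace.single 0 1 + -x.1 0 • EuclideanSpace.single 2 1 := by
    rw [rotGen_one_apply]; ext j; fin_cases j <;> simp
  have e2 : rotGen 2 x.1 = -x.1 1 • EuclideanSpace.single 0 1 + x.1 0 • EuclideanSpace.single 1 1 := by
    rw [rotGen_two_apply]; ext j; fin_cases j <;> simp
  have ex := E3.eq_sum x.1
  rw [ex] at h2
  rw [Fin.sum_univ_three, Fin.sum_univ_three, e0, e1, e2]
  simp only [map_add, map_smul, add_apply, smul_apply,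
    Complex.real_smul] at h2 ⊢
  have hxc : (x.1 0 : ℂ) ^ 2 + (x.1 1 : ℂ) ^ 2 + (x.1 2 : ℂ) ^ 2 = 1 := by
    have := congrArg (fun r : ℝ => (r : ℂ)) hx
    simpa using this
  push_cast
  linear_combination h2 - (B (EuclideanSpace.single 0 1) (EuclideanSpace.single 0 1)
    + B (EuclideanSpace.single 1 1) (EuclideanSpace.single 1 1)
    + B (EuclideanSpace.single 2 1) (EuclideanSpace.single 2 1)) * hxc

lemma driftC1_eq_lieD (μ : ℝ) (h : S2 → ℂ) (x : S2) :
    driftC1 μ h x = μ * lieD (rotGen 2) (homExt h) x.1 := by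
  rw [driftC1, map_smul, Complex.real_smul]
  rfl

lemma isC2_of_contDiff {P : E3 → ℂ} (hP : ContDiff ℝ 2 P) : IsC2 fun x : S2 => P x.1 := by
  have : ∀ x ∈ ({0}ᶜ : Set E3), homExt (fun x : S2 => P x.1) x = P (‖x‖⁻¹ • x) := fun x hx => by
    have hx : x ≠ 0 := hx
    rw [homExt, dif_neg hx]
  refine ContDiffOn.congr (fun x hx => ?_) this
  have hn : ContDiffAt ℝ 2 (fun x : E3 => ‖x‖⁻¹ • x) x :=
    ((contDiffAt_norm ℝ hx).inv (norm_ne_zero_iff.2 hx)).smul contDiffAt_id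
  exact (hP.contDiffAt.comp x hn).contDiffWithinAt

lemma lapC2_of_contDiff {P : E3 → ℂ} (hP : ContDiff ℝ 2 P) (x : S2) :
    lapC2 (fun x : S2 => P x.1) x = lieLap P x.1 := by
  rw [lapC2_eq_lieLap (isC2_of_contDiff hP)]
  exact lieLap_congr_sphere (homExt_sphere _) (isC2_of_contDiff hP) hP.contDiffOn x

lemma driftC1_of_contDiff (μ : ℝ) {P : E3 → ℂ} (hP : ContDiff ℝ 2 P) (x : S2) :
    driftC1 μ (fun x : S2 => P x.1) x = μ * lieD (rotGen 2) P x.1 := by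
  rw [driftC1_eq_lieD]
  congr 1
  exact lieD_congr_sphere (rotGen_mem_skewAdjoint 2) (homExt_sphere _) x
    (ContDiffOn.differentiableAt_sphere (isC2_of_contDiff hP) two_ne_zero x)
    (hP.differentiable two_ne_zero _)

lemma integral_mul_conj_lapC2 {P : E3 → ℂ} (hP : ContDiff ℝ 2 P) {h : S2 → ℂ} (hh : IsC2 h) :
    ∫ x : S2, P x.1 * conj (lapC2 h x) ∂surf = ∫ x : S2, lieLap P x.1 * conj (h x) ∂surf := by
  have hc : ContDiffOn ℝ 2 (fun y => conj (homExt h y)) {0}ᶜ :=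
    Complex.conjCLE.contDiff.comp_contDiffOn hh
  have := integral_mul_lieLap hP.contDiffOn hc
  simpa only [lieLap_conj, ← lapC2_eq_lieLap hh, homExt_sphere] using this

lemma integral_mul_conj_driftC1 (μ : ℝ) {P : E3 → ℂ} (hP : ContDiff ℝ 2 P) {h : S2 → ℂ}
    (hh : IsC2 h) :
    ∫ x : S2, P x.1 * conj (driftC1 μ h x) ∂surf
      = -(μ * ∫ x : S2, lieD (rotGen 2) P x.1 * conj (h x) ∂surf) := by
  have hc : ContDiffOn ℝ 1 (fun y => conj (homExt h y)) {0}ᶜ :=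
    (Complex.conjCLE.contDiff.comp_contDiffOn hh).of_le (by norm_num)
  have := integral_lieD_mul (rotGen_mem_skewAdjoint 2) (hP.contDiffOn.of_le (by norm_num)) hc
  simp only [lieD_conj, homExt_sphere] at this
  simp only [driftC1_eq_lieD, map_mul, Complex.conj_ofReal]
  rw [← mul_neg, ← this, ← integral_const_mul]
  refine integral_congr_ae (Eventually.of_forall fun x => ?_)
  simp only
  ring

lemma continuous_lapC2 {h : S2 → ℂ} (hh : IsC2 h) : Continuous (lapC2 h) := by
  rw [funext fun x => lapC2_eq_lieLap hh x]
  exact ContinuousOn.continuous_sphere (ContDiffOn.lieLap hh)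

lemma continuous_driftC1 (μ : ℝ) {h : S2 → ℂ} (hh : IsC2 h) : Continuous (driftC1 μ h) := by
  rw [funext fun x => driftC1_eq_lieD μ h x]
  exact continuous_const.mul (ContinuousOn.continuous_sphere
    (ContDiffOn.lieD (m := 1) hh (by norm_num)).continuousOn)

lemma IsC2.continuous {h : S2 → ℂ} (hh : IsC2 h) : Continuous h := by
  have := ContinuousOn.continuous_sphere hh.continuousOn
  simpa only [homExt_sphere] using this

/-! ### Spherical harmonics as eigenfunctions -/

/-- The function `p (x₂) * (x₀ + i x₁) ^ k`. -/
def axial (p : Polynomial ℝ) (k : ℕ) (x : E3) : ℂ :=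
  ((p.eval (x 2) : ℝ) : ℂ) * ((x 0 : ℂ) + Complex.I * (x 1 : ℂ)) ^ k

lemma hasFDerivAt_coord (i : Fin 3) (x : E3) :
    HasFDerivAt (fun y : E3 => ((y i : ℝ) : ℂ))
      (Complex.ofRealCLM.comp (EuclideanSpace.proj i : E3 →L[ℝ] ℝ)) x :=
  (Complex.ofRealCLM.comp (EuclideanSpace.proj i : E3 →L[ℝ] ℝ)).hasFDerivAt

lemma contDiff_coord (i : Fin 3) {n : WithTop ℕ∞} : ContDiff ℝ n fun y : E3 => ((y i : ℝ) : ℂ) :=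
  (Complex.ofRealCLM.comp (EuclideanSpace.proj i : E3 →L[ℝ] ℝ)).contDiff

lemma contDiff_axial (p : Polynomial ℝ) (k : ℕ) {n : WithTop ℕ∞} : ContDiff ℝ n (axial p k) := by
  have h1 : ContDiff ℝ n fun x : E3 => ((p.eval (x 2) : ℝ) : ℂ) :=
    Complex.ofRealCLM.contDiff.comp
      ((Polynomial.contDiff_aeval p n).comp (EuclideanSpace.proj 2 : E3 →L[ℝ] ℝ).contDiff)
  exact h1.mul (((contDiff_coord 0).add (contDiff_const.mul (contDiff_coord 1))).pow k)

lemma differentiable_axial (p : Polynomial ℝ) (k : ℕ) : Differentiable ℝ (axial p k) :=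
  (contDiff_axial p k (n := 1)).differentiable one_ne_zero

lemma lieD_axial (A : E3 →L[ℝ] E3) (p : Polynomial ℝ) (k : ℕ) (x : E3) :
    lieD A (axial p k) x = ((A x 2 : ℝ) : ℂ) * axial p.derivative k x
      + (((A x 0 : ℝ) : ℂ) + Complex.I * ((A x 1 : ℝ) : ℂ)) * (k * axial p (k - 1) x) := by
  have hz : HasFDerivAt (fun y : E3 => y 2) (EuclideanSpace.proj 2 : E3 →L[ℝ] ℝ) x :=
    (EuclideanSpace.proj 2 : E3 →L[ℝ] ℝ).hasFDerivAt
  have hp : HasFDerivAt (fun y : E3 => p.eval (y 2)) _ x :=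
    (p.hasDerivAt (x 2)).hasFDerivAt.comp (g := fun z => p.eval z) x hz
  have h1 : HasFDerivAt (fun y : E3 => ((p.eval (y 2) : ℝ) : ℂ)) _ x :=
    Complex.ofRealCLM.hasFDerivAt.comp x hp
  have h2 := ((hasFDerivAt_coord 0 x).add ((hasFDerivAt_coord 1 x).const_mul Complex.I)).pow k
  have h3 := h1.mul h2
  have h4 : HasFDerivAt (axial p k) _ x := h3
  rw [lieD, h4.fderiv]
  simp [axial]
  ring

lemma lieD_coord_mul (A : E3 →L[ℝ] E3) (i : Fin 3) {g : E3 → ℂ} (hg : Differentiable ℝ g) (x : E3) :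
    lieD A (fun y => ((y i : ℝ) : ℂ) * g y) x
      = ((x i : ℝ) : ℂ) * lieD A g x + ((A x i : ℝ) : ℂ) * g x := by
  rw [lieD_mul (hasFDerivAt_coord i x).differentiableAt (hg x)]
  congr 2
  rw [lieD, (hasFDerivAt_coord i x).fderiv]
  simp

lemma lieD_const_mul (A : E3 →L[ℝ] E3) (c : ℂ) {g : E3 → ℂ} (hg : Differentiable ℝ g) (x : E3) :
    lieD A (fun y => c * g y) x = c * lieD A g x := by
  rw [lieD, fderiv_const_mul (hg x)]
  rfl

lemma lieD_add (A : E3 →L[ℝ] E3) {g h : E3 → ℂ} (hg : Differentiable ℝ g) (hh : Differentiable ℝ h)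
    (x : E3) : lieD A (fun y => g y + h y) x = lieD A g x + lieD A h x := by
  have := (hg x).hasFDerivAt.add (hh x).hasFDerivAt
  rw [lieD, HasFDerivAt.fderiv (f := fun y => g y + h y) this]
  rfl

lemma lieD_rotGen_two_axial (p : Polynomial ℝ) (k : ℕ) (x : E3) :
    lieD (rotGen 2) (axial p k) x = Complex.I * k * axial p k x := by
  rw [lieD_axial, rotGen_two_apply]
  cases k with
  | zero => simp
  | succ k =>
    simp [axial]
    linear_combination (-(k + 1) * ((p.eval (x 2) : ℝ) : ℂ) * x 1 * (x 0 + Complex.I * x 1) ^ k)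
      * Complex.I_sq

/-- Once (x₀ + i x₁)^k is split off, the Laplace–Beltrami operator becomes the associated Legendre
operator acting on p. The relation |x|² = 1 is used, so this holds only on the sphere. -/
lemma lieLap_axial (p : Polynomial ℝ) (k : ℕ) (x : S2) :
    lieLap (axial p k) x.1
      = axial ((1 - Polynomial.X ^ 2) * p.derivative.derivative
          - (2 * (k + 1) : ℝ) • (Polynomial.X * p.derivative) - (k * (k + 1) : ℝ) • p) k x.1 := by
  have h0 : lieD (rotGen 0) (axial p k) = fun y => ((y 1 : ℝ) : ℂ) * axial p.derivative k y
      + (-Complex.I * k) * (((y 2 : ℝ) : ℂ) * axial p (k - 1) y) := by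
    funext y
    rw [lieD_axial, rotGen_zero_apply]
    simp
    ring
  have h1 : lieD (rotGen 1) (axial p k) = fun y => (-1) * (((y 0 : ℝ) : ℂ) * axial p.derivative k y)
      + k * (((y 2 : ℝ) : ℂ) * axial p (k - 1) y) := by
    funext y
    rw [lieD_axial, rotGen_one_apply]
    simp
    ring
  have h2 : lieD (rotGen 2) (axial p k) = fun y => (Complex.I * k) * axial p k y := by
    funext y
    rw [lieD_rotGen_two_axial]
  have hd (i : Fin 3) (q : Polynomial ℝ) (j : ℕ) :
      Differentiable ℝ fun y : E3 => ((y i : ℝ) : ℂ) * axial q j y :=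
    fun y => (hasFDerivAt_coord i y).differentiableAt.mul (differentiable_axial q j y)
  have hx := S2.sum_sq x
  have hxc : (x.1 0 : ℂ) ^ 2 + (x.1 1 : ℂ) ^ 2 + (x.1 2 : ℂ) ^ 2 = 1 := by
    have := congrArg (fun r : ℝ => (r : ℂ)) hx
    simpa using this
  rw [lieLap, Fin.sum_univ_three, h0, h1, h2, lieD_add _ (hd _ _ _) ((hd _ _ _).const_mul _),
    lieD_add _ ((hd _ _ _).const_mul _) ((hd _ _ _).const_mul _),
    lieD_const_mul _ _ (hd _ _ _), lieD_const_mul _ _ (hd _ _ _), lieD_const_mul _ _ (hd _ _ _),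
    lieD_const_mul _ _ (differentiable_axial _ _)]
  rw [lieD_rotGen_two_axial]
  simp only [lieD_coord_mul _ _ (differentiable_axial _ _), lieD_axial]
  rw [rotGen_zero_apply, rotGen_one_apply]
  -- Two derivatives produce the truncated exponents k - 1 and k - 1 - 1, hence separate cases k = 0
  -- and k = 1.
  rcases k with _ | _ | k
  · simp [axial]
    linear_combination ((p.derivative.derivative.eval (x.1 2) : ℝ) : ℂ) * hxc
  · simp [axial]
    linear_combination ((p.derivative.derivative.eval (x.1 2) : ℝ) : ℂ)
      * (x.1 0 + Complex.I * x.1 1) * hxc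
      + ((p.eval (x.1 2) : ℝ) : ℂ) * (x.1 0 + Complex.I * x.1 1) * Complex.I_sq
  · simp [axial]
    linear_combination ((p.derivative.derivative.eval (x.1 2) : ℝ) : ℂ)
      * (x.1 0 + Complex.I * x.1 1) ^ (k + 2) * hxc
      + ((k + 2) * (k + 1) * (x.1 2 : ℂ) ^ 2 * ((p.eval (x.1 2) : ℝ) : ℂ)
        * (x.1 0 + Complex.I * x.1 1) ^ k
      + (k + 2) ^ 2 * ((p.eval (x.1 2) : ℝ) : ℂ) * (x.1 0 + Complex.I * x.1 1) ^ (k + 2))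
      * Complex.I_sq

/-- The `n`-th derivative of `(X² - 1) ^ l`. -/
def rodrigues (l n : ℕ) : Polynomial ℝ :=
  Polynomial.derivative^[n] ((Polynomial.X ^ 2 - 1 : Polynomial ℝ) ^ l)

lemma derivative_rodrigues (l n : ℕ) : (rodrigues l n).derivative = rodrigues l (n + 1) :=
  (Function.iterate_succ_apply' _ _ _).symm

/-- Q = (X² - 1)^l satisfies (X² - 1) Q' = 2l X Q; the recurrence is this relation differentiated n
+ 1 times. -/
lemma rodrigues_recurrence (l n : ℕ) :
    (Polynomial.X ^ 2 - 1) * rodrigues l (n + 2)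
      + (2 * (n + 1 - l) : ℝ) • (Polynomial.X * rodrigues l (n + 1))
      + ((n + 1) * (n - 2 * l) : ℝ) • rodrigues l n = 0 := by
  induction n with
  | zero =>
    have h1 : (Polynomial.X ^ 2 - 1) * rodrigues l 1
        = (2 * l : ℝ) • (Polynomial.X * rodrigues l 0) := by
      cases l with
      | zero => simp [rodrigues]
      | succ l =>
        simp [rodrigues, Polynomial.derivative_pow, Polynomial.smul_eq_C_mul]
        ring
    have h2 := congrArg Polynomial.derivative h1
    simp only [Polynomial.derivative_mul, derivative_rodrigues,
      Polynomial.derivative_sub, Polynomial.derivative_X_pow, Polynomial.derivative_one,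
      Polynomial.derivative_X, Polynomial.smul_eq_C_mul] at h2 ⊢
    simp only [map_mul, map_sub, map_natCast, map_ofNat, map_one, Nat.cast_zero, map_zero,
      zero_add] at h2 ⊢
    norm_num at h2 ⊢
    linear_combination h2
  | succ n ih =>
    have h2 := congrArg Polynomial.derivative ih
    simp only [Polynomial.derivative_mul, derivative_rodrigues,
      Polynomial.derivative_sub, Polynomial.derivative_X_pow, Polynomial.derivative_one,
      Polynomial.derivative_X, Polynomial.smul_eq_C_mul, Polynomial.derivative_add,
      Polynomial.derivative_zero] at h2 ⊢
    simp only [map_mul, map_add, map_sub, map_natCast, map_ofNat, map_one, Nat.cast_add,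
      Nat.cast_one] at h2 ⊢
    norm_num at h2 ⊢
    rw [show n + 1 + 2 = n + 2 + 1 by ring, show n + 1 + 1 = n + 2 by ring]
    linear_combination h2

lemma natDegree_sq_sub_one_pow (l : ℕ) :
    ((Polynomial.X ^ 2 - 1 : Polynomial ℝ) ^ l).natDegree = 2 * l := by
  rw [Polynomial.natDegree_pow, ← Polynomial.C_1, Polynomial.natDegree_X_pow_sub_C, mul_comm]

lemma monic_sq_sub_one_pow (l : ℕ) : ((Polynomial.X ^ 2 - 1 : Polynomial ℝ) ^ l).Monic := by
  refine Polynomial.Monic.pow ?_ _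
  rw [← Polynomial.C_1]
  exact Polynomial.monic_X_pow_sub_C _ two_ne_zero

lemma degree_rodrigues {l n : ℕ} (h : n ≤ 2 * l) : (rodrigues l n).degree = (2 * l - n : ℕ) := by
  refine Polynomial.degree_eq_of_le_of_coeff_ne_zero ?_ ?_
  · refine Polynomial.natDegree_le_iff_degree_le.1 ?_
    refine (Polynomial.natDegree_iterate_derivative _ _).trans ?_
    rw [natDegree_sq_sub_one_pow]
  · rw [rodrigues, Polynomial.coeff_iterate_derivative, Nat.sub_add_cancel h]
    have : ((Polynomial.X ^ 2 - 1 : Polynomial ℝ) ^ l).coeff (2 * l) = 1 := by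
      rw [← natDegree_sq_sub_one_pow l]
      exact monic_sq_sub_one_pow l
    rw [this, nsmul_one, Nat.cast_ne_zero]
    exact (Nat.descFactorial_pos.2 h).ne'

lemma axial_add (p q : Polynomial ℝ) (k : ℕ) (x : E3) :
    axial (p + q) k x = axial p k x + axial q k x := by
  simp [axial, add_mul]

lemma axial_smul (c : ℝ) (p : Polynomial ℝ) (k : ℕ) (x : E3) :
    axial (c • p) k x = c * axial p k x := by
  simp [axial, mul_assoc]

/-- The recurrence at n = l + k is the associated Legendre equation, since (l+k+1)(k-l) = k(k+1) -
l(l+1). -/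
lemma lieLap_axial_rodrigues (l k : ℕ) (c : ℝ) (x : S2) :
    lieLap (axial (c • rodrigues l (l + k)) k) x.1
      = -(l * (l + 1)) * axial (c • rodrigues l (l + k)) k x.1 := by
  have hz := congrArg (Polynomial.eval (x.1 2)) (rodrigues_recurrence l (l + k))
  rw [lieLap_axial]
  have e : -(l * (l + 1) : ℂ) = ((-(l * (l + 1) : ℝ) : ℝ) : ℂ) := by push_cast; ring
  rw [e, ← axial_smul]
  simp only [axial]
  congr 2
  simp only [Polynomial.derivative_smul, derivative_rodrigues, Polynomial.eval_sub,
    Polynomial.eval_mul, Polynomial.eval_smul, smul_eq_mul, Polynomial.eval_pow, Polynomial.eval_X,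
    Polynomial.eval_one, Polynomial.eval_add, Polynomial.eval_zero] at hz ⊢
  push_cast at hz
  rw [show l + k + 1 + 1 = l + k + 2 by ring]
  linear_combination (-c) * hz

/-- The normalizing constant of `Y_{l,k}`. -/
def sphConst (l k : ℕ) : ℝ :=
  Real.sqrt ((2 * l + 1) * (l - k).factorial / (4 * Real.pi * (l + k).factorial))
      * ((-1) ^ k / (2 ^ l * l.factorial))

lemma sphConst_ne_zero (l k : ℕ) : sphConst l k ≠ 0 := by
  have h1 : 0 < (2 * l + 1) * ((l - k).factorial : ℝ) / (4 * Real.pi * (l + k).factorial) := by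
    have := Real.pi_pos
    positivity
  refine mul_ne_zero (Real.sqrt_pos.2 h1).ne' (div_ne_zero ?_ ?_)
  · exact pow_ne_zero _ (by norm_num)
  · positivity

lemma sphHarmNonneg_apply (l k : ℕ) (x : S2) :
    sphHarmNonneg l k x = axial (sphConst l k • rodrigues l (l + k)) k x.1 := by
  simp [sphHarmNonneg, axial, sphConst, rodrigues]

/-- Each spherical harmonic is the restriction of a smooth function that is an eigenfunction of the
Laplace–Beltrami operator and of the rotation about the polar axis. -/
lemma exists_extension_sphHarm (l : ℕ) (m : ℤ) :
    ∃ P : E3 → ℂ, ContDiff ℝ 2 P ∧ (∀ x : S2, sphHarm l m x = P x.1) ∧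
      (∀ x : S2, lieLap P x.1 = -(l * (l + 1)) * P x.1) ∧
      ∀ x : S2, lieD (rotGen 2) P x.1 = Complex.I * m * P x.1 := by
  by_cases hm : 0 ≤ m
  · have hmk : ((m.natAbs : ℕ) : ℂ) = (m : ℂ) := by
      have := congrArg (fun j : ℤ => (j : ℂ)) (Int.natAbs_of_nonneg hm)
      simpa only [Int.cast_natCast] using this
    refine ⟨axial (sphConst l m.natAbs • rodrigues l (l + m.natAbs)) m.natAbs, contDiff_axial _ _,
      fun x => ?_, fun x => lieLap_axial_rodrigues _ _ _ x, fun x => ?_⟩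
    · rw [sphHarm, if_pos hm, sphHarmNonneg_apply]
    · rw [lieD_rotGen_two_axial, hmk]
  · have hmk : ((m.natAbs : ℕ) : ℂ) = -(m : ℂ) := by
      have := congrArg (fun j : ℤ => (j : ℂ)) (Int.ofNat_natAbs_of_nonpos (not_le.1 hm).le)
      simpa only [Int.cast_natCast, Int.cast_neg] using this
    set k := m.natAbs with hk
    set c : ℝ := (-1) ^ k * sphConst l k with hc
    refine ⟨fun y => conj (axial (c • rodrigues l (l + k)) k y),
      Complex.conjCLE.contDiff.comp (contDiff_axial _ _), fun x => ?_, fun x => ?_, fun x => ?_⟩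
    · rw [sphHarm, if_neg hm]
      simp [sphHarmNonneg_apply, axial_smul, hc, ← hk, mul_assoc]
    · rw [lieLap_conj, lieLap_axial_rodrigues]
      simp
    · rw [lieD_conj, lieD_rotGen_two_axial]
      simp only [map_mul, Complex.conj_I, map_natCast]
      rw [hmk]
      ring

lemma isC2_sphHarm (l : ℕ) (m : ℤ) : IsC2 (sphHarm l m) := by
  obtain ⟨P, hP, hPx, -, -⟩ := exists_extension_sphHarm l m
  rw [funext hPx]
  exact isC2_of_contDiff hP

lemma lapC2_sphHarm (l : ℕ) (m : ℤ) (x : S2) :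
    lapC2 (sphHarm l m) x = -(l * (l + 1)) * sphHarm l m x := by
  obtain ⟨P, hP, hPx, hlap, -⟩ := exists_extension_sphHarm l m
  rw [hPx x, funext hPx, lapC2_of_contDiff hP, hlap]

lemma driftC1_sphHarm (μ : ℝ) (l : ℕ) (m : ℤ) (x : S2) :
    driftC1 μ (sphHarm l m) x = Complex.I * μ * m * sphHarm l m x := by
  obtain ⟨P, hP, hPx, -, hdr⟩ := exists_extension_sphHarm l m
  rw [hPx x, funext hPx, driftC1_of_contDiff μ hP, hdr]
  ring

lemma integral_sphHarm_mul_conj_lapC2 (l : ℕ) (m : ℤ) {h : S2 → ℂ} (hh : IsC2 h) :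
    ∫ x, sphHarm l m x * conj (lapC2 h x) ∂surf
      = -(l * (l + 1)) * ∫ x, sphHarm l m x * conj (h x) ∂surf := by
  obtain ⟨P, hP, hPx, hlap, -⟩ := exists_extension_sphHarm l m
  simp only [hPx]
  rw [integral_mul_conj_lapC2 hP hh, ← integral_const_mul]
  simp only [hlap, mul_assoc]

lemma integral_sphHarm_mul_conj_driftC1 (μ : ℝ) (l : ℕ) (m : ℤ) {h : S2 → ℂ} (hh : IsC2 h) :
    ∫ x, sphHarm l m x * conj (driftC1 μ h x) ∂surf
      = -(Complex.I * μ * m) * ∫ x, sphHarm l m x * conj (h x) ∂surf := by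
  obtain ⟨P, hP, hPx, -, hdr⟩ := exists_extension_sphHarm l m
  simp only [hPx]
  rw [integral_mul_conj_driftC1 μ hP hh]
  simp only [hdr, mul_assoc]
  rw [integral_const_mul, integral_const_mul]
  ring

/-- Degrees are separated by the symmetric operator Δ, as l(l+1) - l'(l'+1) = (l-l')(l+l'+1). Orders
are separated by the skew-symmetric rotation field ∂/∂φ, the drift with μ = 1. -/
lemma integral_sphHarm_mul_conj_of_ne {l l' : ℕ} {m m' : ℤ} (h : l ≠ l' ∨ m ≠ m') :
    ∫ x, sphHarm l m x * conj (sphHarm l' m' x) ∂surf = 0 := by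
  rcases h with h | h
  · have h1 := integral_sphHarm_mul_conj_lapC2 l m (isC2_sphHarm l' m')
    simp only [lapC2_sphHarm, map_mul, map_neg, map_natCast, map_add, map_one,
      mul_left_comm (sphHarm l m _)] at h1
    rw [integral_const_mul] at h1
    have h2 : ((l : ℂ) - l') * (l + l' + 1)
        * ∫ x, sphHarm l m x * conj (sphHarm l' m' x) ∂surf = 0 := by
      linear_combination h1
    have h3 : ((l : ℂ) - l') ≠ 0 := sub_ne_zero.2 (by exact_mod_cast h)
    have h4 : ((l : ℂ) + l' + 1) ≠ 0 := by exact_mod_cast Nat.succ_ne_zero (l + l')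
    exact (mul_eq_zero.1 h2).resolve_left (mul_ne_zero h3 h4)
  · have h1 := integral_sphHarm_mul_conj_driftC1 1 l m (isC2_sphHarm l' m')
    simp only [driftC1_sphHarm, map_mul, Complex.conj_I, Complex.conj_ofReal, map_intCast,
      mul_left_comm (sphHarm l m _)] at h1
    rw [integral_const_mul] at h1
    have h2 : Complex.I * ((m : ℂ) - m')
        * ∫ x, sphHarm l m x * conj (sphHarm l' m' x) ∂surf = 0 := by
      push_cast at h1
      linear_combination h1
    have h3 : ((m : ℂ) - m') ≠ 0 := sub_ne_zero.2 (by exact_mod_cast h)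
    exact (mul_eq_zero.1 h2).resolve_left (mul_ne_zero Complex.I_ne_zero h3)

/-- The generator acts diagonally on the Fourier–Laplace coefficients. -/
lemma IsGenerator.coeff_eq {μ : ℝ} {v w : L2S} (h : IsGenerator μ v w) (l : ℕ) (m : ℤ) :
    coeff l m w = (-(l * (l + 1)) + Complex.I * μ * m) * coeff l m v := by
  obtain ⟨a, b, ha, hb, rfl⟩ := h
  have h1 := ha _ (isC2_sphHarm l m)
  have h2 := hb _ (isC2_sphHarm l m)
  simp only [lapC2_sphHarm, driftC1_sphHarm, map_mul, map_neg, map_natCast, map_add, map_one,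
    Complex.conj_I, Complex.conj_ofReal, map_intCast] at h1 h2
  have h1' : coeff l m a = -(l * (l + 1)) * coeff l m v := by
    rw [coeff, h1, coeff, ← integral_const_mul]
    congr 1
    funext x
    ring
  have h2' : coeff l m b = Complex.I * μ * m * coeff l m v := by
    rw [coeff, h2, coeff, ← integral_const_mul, ← integral_neg]
    congr 1
    funext x
    ring
  rw [coeff_eq_inner, inner_add_right, ← coeff_eq_inner, ← coeff_eq_inner, h1', h2']
  ring

/-! ### Normalization of the zonal harmonics -/

lemma surf_real_univ : surf.real univ = 4 * Real.pi := by
  rw [surf, Measure.toSphere_real_apply_univ, Measure.real, EuclideanSpace.volume_ball_fin_three]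
  rw [finrank_euclideanSpace, Fintype.card_fin]
  have : 0 ≤ Real.pi := Real.pi_pos.le
  rw [ENNReal.toReal_mul, ENNReal.toReal_ofReal (by positivity)]
  norm_num
  ring

lemma integral_lieLap_eq_zero {P : E3 → ℂ} (hP : ContDiff ℝ 2 P) :
    ∫ x : S2, lieLap P x.1 ∂surf = 0 := by
  have h1 : lieLap (fun _ : E3 => (1 : ℂ)) = fun _ => 0 := by
    have : ∀ i, lieD (rotGen i) (fun _ : E3 => (1 : ℂ)) = fun _ => 0 := fun i => by
      funext x; simp [lieD]
    funext x
    simp only [lieLap, this]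
    simp [lieD]
  have h := integral_mul_lieLap hP.contDiffOn
    (contDiffOn_const (c := (1 : ℂ)) : ContDiffOn ℝ 2 (fun _ : E3 => (1 : ℂ)) {0}ᶜ)
  rw [h1] at h
  simpa using h.symm

/-- The integral of Δ(x₂^{n+2}) = (n+2)(n+1) x₂^n - (n+2)(n+3) x₂^{n+2} vanishes, which gives a
two-step recursion for the moments without spherical coordinates. -/
lemma integral_axial_X_pow (n : ℕ) :
    (n + 1) * ∫ x : S2, axial (Polynomial.X ^ n) 0 x.1 ∂surf = 2 * Real.pi * (1 - (-1) ^ (n + 1)) := by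
  have hint (p : Polynomial ℝ) : Integrable (fun x : S2 => axial p 0 x.1) surf :=
    Continuous.integrable_surf
      ((contDiff_axial p 0 (n := 0)).continuous.comp continuous_subtype_val)
  have hrec (p : Polynomial ℝ) := integral_lieLap_eq_zero (contDiff_axial p 0)
  induction n using Nat.twoStepInduction with
  | zero =>
    have : ∫ x : S2, axial (Polynomial.X ^ 0) 0 x.1 ∂surf = ((4 * Real.pi : ℝ) : ℂ) := by
      simp only [axial, pow_zero, Polynomial.eval_one, mul_one, Complex.ofReal_one]
      rw [integral_const, surf_real_univ]
      simp
    rw [this]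
    push_cast
    ring
  | one =>
    have h := hrec Polynomial.X
    simp only [lieLap_axial] at h
    have e : ((1 - Polynomial.X ^ 2) * (Polynomial.X : Polynomial ℝ).derivative.derivative
        - (2 * (((0 : ℕ) : ℝ) + 1)) • (Polynomial.X * (Polynomial.X : Polynomial ℝ).derivative)
        - (((0 : ℕ) : ℝ) * (((0 : ℕ) : ℝ) + 1)) • Polynomial.X)
        = (-2 : ℝ) • (Polynomial.X ^ 1 : Polynomial ℝ) := by
      simp [Polynomial.smul_eq_C_mul]
    rw [e] at h
    simp only [axial_smul] at h
    rw [integral_const_mul] at h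
    have h2 := (mul_eq_zero.1 h).resolve_left (by norm_num)
    rw [h2]
    simp
  | more n ih1 _ =>
    have h := hrec (Polynomial.X ^ (n + 2))
    simp only [lieLap_axial] at h
    have e : ((1 - Polynomial.X ^ 2)
          * (Polynomial.X ^ (n + 2) : Polynomial ℝ).derivative.derivative
        - (2 * (((0 : ℕ) : ℝ) + 1))
          • (Polynomial.X * (Polynomial.X ^ (n + 2) : Polynomial ℝ).derivative)
        - (((0 : ℕ) : ℝ) * (((0 : ℕ) : ℝ) + 1)) • Polynomial.X ^ (n + 2))
        = ((n + 2) * (n + 1) : ℝ) • (Polynomial.X ^ n : Polynomial ℝ)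
          + (-((n + 2) * (n + 3)) : ℝ) • (Polynomial.X ^ (n + 2) : Polynomial ℝ) := by
      simp [Polynomial.smul_eq_C_mul]
      simp only [map_ofNat]
      ring
    rw [e] at h
    simp only [axial_add, axial_smul] at h
    rw [integral_add ((hint _).const_mul _) ((hint _).const_mul _), integral_const_mul,
      integral_const_mul] at h
    have hn : (n : ℂ) + 2 ≠ 0 := by exact_mod_cast Nat.succ_ne_zero (n + 1)
    push_cast at h ⊢
    apply mul_left_cancel₀ hn
    linear_combination (n + 2 : ℂ) * ih1 - h

/-- Archimedes' formula for polynomials. -/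
lemma integral_axial_zero (p : Polynomial ℝ) :
    ∫ x : S2, axial p 0 x.1 ∂surf = ((2 * Real.pi * ∫ z in (-1 : ℝ)..1, p.eval z : ℝ) : ℂ) := by
  have hint (p : Polynomial ℝ) : Integrable (fun x : S2 => axial p 0 x.1) surf :=
    Continuous.integrable_surf
      ((contDiff_axial p 0 (n := 0)).continuous.comp continuous_subtype_val)
  induction p using Polynomial.induction_on' with
  | add p q hp hq =>
    simp only [axial_add, Polynomial.eval_add]
    rw [integral_add (hint _) (hint _), hp, hq, intervalIntegral.integral_add
      (p.continuous.intervalIntegrable _ _) (q.continuous.intervalIntegrable _ _)]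
    push_cast
    ring
  | monomial n a =>
    rw [← Polynomial.C_mul_X_pow_eq_monomial, ← Polynomial.smul_eq_C_mul]
    simp only [axial_smul, Polynomial.eval_smul, smul_eq_mul, Polynomial.eval_pow,
      Polynomial.eval_X]
    rw [integral_const_mul, intervalIntegral.integral_const_mul, integral_pow]
    have hn : (n : ℂ) + 1 ≠ 0 := by exact_mod_cast Nat.succ_ne_zero n
    have h := integral_axial_X_pow n
    push_cast
    field_simp
    rw [one_pow]
    linear_combination (a : ℂ) * h

lemma eval_rodrigues_eq_zero {l n : ℕ} (h : n < l) {z : ℝ} (hz : z ^ 2 = 1) :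
    (rodrigues l n).eval z = 0 := by
  have hd := Polynomial.pow_sub_dvd_iterate_derivative_pow (Polynomial.X ^ 2 - 1 : Polynomial ℝ) l n
  refine Polynomial.eval_eq_zero_of_dvd_of_eval_eq_zero hd ?_
  have : l - n ≠ 0 := by omega
  simp [hz, this]

/-- Integrate by parts j times. The boundary terms vanish because derivatives of (X² - 1)^l of order
below l are zero at ±1. -/
lemma integral_rodrigues_sq (l j : ℕ) (hj : j ≤ l) :
    ∫ z in (-1 : ℝ)..1, (rodrigues l l).eval z * (rodrigues l l).eval z
      = (-1) ^ j * ∫ z in (-1 : ℝ)..1, (rodrigues l (l - j)).eval z * (rodrigues l (l + j)).eval z := by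
  induction j with
  | zero => simp
  | succ j ih =>
    rw [ih (by omega)]
    have hd (n : ℕ) (z : ℝ) : HasDerivAt (fun z => (rodrigues l n).eval z)
        ((rodrigues l (n + 1)).eval z) z := by
      rw [← derivative_rodrigues]
      exact (rodrigues l n).hasDerivAt z
    have h := intervalIntegral.integral_mul_deriv_eq_deriv_mul (a := (-1 : ℝ)) (b := 1)
      (fun z _ => hd (l + j) z) (fun z _ => hd (l - (j + 1)) z)
      ((rodrigues l (l + j + 1)).continuous.intervalIntegrable _ _)
      ((rodrigues l (l - (j + 1) + 1)).continuous.intervalIntegrable _ _)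
    have hlt : l - (j + 1) < l := by omega
    rw [eval_rodrigues_eq_zero hlt (by norm_num), eval_rodrigues_eq_zero hlt (by norm_num), mul_zero,
      mul_zero, sub_zero, zero_sub,
      show l - (j + 1) + 1 = l - j by omega] at h
    simp only [mul_comm (Polynomial.eval _ (rodrigues l (l + j)))] at h
    rw [h, pow_succ]
    simp only [mul_comm (Polynomial.eval _ (rodrigues l (l + j + 1)))]
    rw [show l + (j + 1) = l + j + 1 by ring]
    ring

/-- Integration by parts against z' = 1 yields (2l+3) I_{l+1} = -(2l+2) I_l. -/
lemma integral_sq_sub_one_pow (l : ℕ) :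
    ((2 * l + 1).factorial : ℝ) * ∫ z in (-1 : ℝ)..1, (z ^ 2 - 1) ^ l
      = (-1) ^ l * 2 ^ (2 * l + 1) * (l.factorial : ℝ) ^ 2 := by
  induction l with
  | zero => norm_num
  | succ l ih =>
    have hd1 (z : ℝ) : HasDerivAt (fun z : ℝ => (z ^ 2 - 1) ^ (l + 1))
        (2 * (l + 1) * z * (z ^ 2 - 1) ^ l) z := by
      have h := (((hasDerivAt_id z).pow 2).sub_const 1).pow (l + 1)
      refine h.congr_deriv ?_
      simp
      ring
    have h := intervalIntegral.integral_mul_deriv_eq_deriv_mul (a := (-1 : ℝ)) (b := 1)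
      (fun z _ => hd1 z) (fun z _ => hasDerivAt_id z)
      (Continuous.intervalIntegrable (by fun_prop) _ _)
      (Continuous.intervalIntegrable (by fun_prop) _ _)
    have e : ∫ z in (-1 : ℝ)..1, 2 * ((l : ℝ) + 1) * z * (z ^ 2 - 1) ^ l * id z
        = 2 * ((l : ℝ) + 1) * ((∫ z in (-1 : ℝ)..1, (z ^ 2 - 1) ^ (l + 1))
          + ∫ z in (-1 : ℝ)..1, (z ^ 2 - 1) ^ l) := by
      rw [← intervalIntegral.integral_add (Continuous.intervalIntegrable (by fun_prop) _ _)
        (Continuous.intervalIntegrable (by fun_prop) _ _), ← intervalIntegral.integral_const_mul]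
      refine intervalIntegral.integral_congr fun z _ => ?_
      simp only [id]
      ring
    rw [e] at h
    norm_num at h
    have hrec : (2 * l + 3 : ℝ) * ∫ z in (-1 : ℝ)..1, (z ^ 2 - 1) ^ (l + 1)
        = -(2 * (l + 1)) * ∫ z in (-1 : ℝ)..1, (z ^ 2 - 1) ^ l := by
      linear_combination h
    rw [show 2 * (l + 1) + 1 = (2 * l + 1) + 1 + 1 by ring, Nat.factorial_succ, Nat.factorial_succ,
      Nat.factorial_succ l]
    push_cast
    linear_combination ((2 * l + 1).factorial : ℝ) * (2 * l + 2) * hrec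
      - (2 * (l + 1)) * (2 * l + 2) * ih

lemma rodrigues_two_mul (l : ℕ) : rodrigues l (2 * l) = Polynomial.C ((2 * l).factorial : ℝ) := by
  have hdeg := degree_rodrigues (le_refl (2 * l))
  rw [Nat.sub_self, Nat.cast_zero] at hdeg
  rw [Polynomial.eq_C_of_degree_eq_zero hdeg]
  congr 1
  rw [rodrigues, Polynomial.coeff_iterate_derivative, zero_add, Nat.descFactorial_self]
  have : ((Polynomial.X ^ 2 - 1 : Polynomial ℝ) ^ l).coeff (2 * l) = 1 := by
    rw [← natDegree_sq_sub_one_pow l]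
    exact monic_sq_sub_one_pow l
  rw [this, nsmul_one]

/-- By Archimedes' formula this is an integral over [-1, 1]. Taking j = l in the integrations by
parts replaces one factor by the constant (2l)! and the other by (z² - 1)^l. -/
lemma integral_sphHarm_zero_mul_conj (l : ℕ) :
    ∫ x, sphHarm l 0 x * conj (sphHarm l 0 x) ∂surf = 1 := by
  have h0 (x : S2) : sphHarm l 0 x * conj (sphHarm l 0 x)
      = ((sphConst l 0 ^ 2 : ℝ) : ℂ) * axial (rodrigues l l * rodrigues l l) 0 x.1 := by
    rw [sphHarm, if_pos le_rfl, Int.natAbs_zero, sphHarmNonneg_apply]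
    simp [axial]
    ring
  simp only [h0]
  rw [integral_const_mul, integral_axial_zero]
  have h1 := integral_rodrigues_sq l l le_rfl
  rw [Nat.sub_self, ← two_mul, rodrigues_two_mul] at h1
  simp only [Polynomial.eval_mul, Polynomial.eval_C] at h1 ⊢
  have h2 := integral_sq_sub_one_pow l
  have h3 : ∫ z in (-1 : ℝ)..1, (rodrigues l 0).eval z * ((2 * l).factorial : ℝ)
      = ((2 * l).factorial : ℝ) * ∫ z in (-1 : ℝ)..1, (z ^ 2 - 1) ^ l := by
    rw [intervalIntegral.integral_mul_const, mul_comm]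
    simp [rodrigues]
  rw [h3] at h1
  rw [h1]
  have hJ : ∫ z in (-1 : ℝ)..1, (z ^ 2 - 1) ^ l
      = (-1) ^ l * 2 ^ (2 * l + 1) * (l.factorial : ℝ) ^ 2 / ((2 * l + 1).factorial : ℝ) := by
    rw [eq_div_iff (by positivity), mul_comm, h2]
  rw [hJ]
  have hpi := Real.pi_pos
  have hsq : sphConst l 0 ^ 2 = (2 * l + 1) / (4 * Real.pi) * (1 / (2 ^ l * (l.factorial : ℝ)) ^ 2) := by
    rw [sphConst, mul_pow, Real.sq_sqrt (by positivity)]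
    simp
    field_simp
  rw [hsq]
  norm_cast
  rw [Nat.factorial_succ]
  have hs : ((-1 : ℝ) ^ l) * (-1) ^ l = 1 := by rw [← mul_pow]; norm_num
  have hf : ((2 * l).factorial : ℝ) ≠ 0 := by positivity
  have hfl : (l.factorial : ℝ) ≠ 0 := by positivity
  push_cast
  field_simp
  linear_combination (4 * (2 ^ l) ^ 2 : ℝ) * hs

/-! ### Completeness of the spherical harmonics -/

/-- The restriction of `axial p k` to the sphere. -/
def axialC (p : Polynomial ℝ) (k : ℕ) : C(S2, ℂ) :=
  ⟨fun x => axial p k x.1, (contDiff_axial p k (n := 0)).continuous.comp continuous_subtype_val⟩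

lemma axialC_apply (p : Polynomial ℝ) (k : ℕ) (x : S2) : axialC p k x = axial p k x.1 := rfl

lemma sphHarm_natCast (l k : ℕ) :
    sphHarm l k = ((sphConst l k : ℝ) : ℂ) • axialC (rodrigues l (l + k)) k := by
  ext x
  rw [sphHarm, if_pos (Int.natCast_nonneg k), Int.natAbs_natCast, sphHarmNonneg_apply, axial_smul]
  rfl

lemma sphHarm_neg_natCast (l k : ℕ) :
    sphHarm l (-k) = (((-1) ^ k * sphConst l k : ℝ) : ℂ) • star (axialC (rodrigues l (l + k)) k) := by
  rcases Nat.eq_zero_or_pos k with rfl | hk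
  · have := sphHarm_natCast l 0
    simp only [Nat.cast_zero, neg_zero] at this ⊢
    rw [this]
    ext x
    simp [axialC_apply, axial]
  · have hneg : ¬ (0 : ℤ) ≤ -(k : ℤ) := by omega
    ext x
    rw [sphHarm, if_neg hneg, Int.natAbs_neg, Int.natAbs_natCast]
    simp [sphHarmNonneg_apply, axial_smul, axialC_apply, mul_assoc]

/-- The i-th polynomial has degree 2(i+k) - (i+2k) = i, so every degree occurs exactly once. -/
lemma span_rodrigues_eq_top (k : ℕ) :
    Submodule.span ℝ (range fun i : ℕ => rodrigues (i + k) (i + k + k)) = ⊤ := by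
  let S : Polynomial.Sequence ℝ :=
    { elems' := fun i => rodrigues (i + k) (i + k + k)
      degree_eq' := fun i => by
        rw [degree_rodrigues (by omega)]
        congr 1
        omega }
  exact S.span fun i => (Polynomial.leadingCoeff_ne_zero.2 (S.ne_zero i)).isUnit

lemma S2.normSq_axis (x : S2) :
    ((x.1 0 : ℂ) + Complex.I * (x.1 1 : ℂ)) * ((x.1 0 : ℂ) - Complex.I * (x.1 1 : ℂ))
      = 1 - (x.1 2 : ℂ) ^ 2 := by
  have hxc : (x.1 0 : ℂ) ^ 2 + (x.1 1 : ℂ) ^ 2 + (x.1 2 : ℂ) ^ 2 = 1 := by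
    have := congrArg (fun r : ℝ => (r : ℂ)) (S2.sum_sq x)
    simpa using this
  linear_combination hxc - (x.1 1 : ℂ) ^ 2 * Complex.I_sq

lemma axialC_mul_axialC (p q : Polynomial ℝ) (k j : ℕ) :
    axialC p k * axialC q j = axialC (p * q) (k + j) := by
  ext x
  simp [axialC_apply, axial]
  ring

/-- On the sphere |x₀ + i x₁|² = 1 - x₂², so the conjugate factors are absorbed into the polynomial
in x₂. -/
lemma axialC_mul_star_axialC (p q : Polynomial ℝ) {k j : ℕ} (h : j ≤ k) :
    axialC p k * star (axialC q j) = axialC (p * q * (1 - Polynomial.X ^ 2) ^ j) (k - j) := by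
  obtain ⟨i, rfl⟩ := Nat.exists_eq_add_of_le h
  ext x
  have hx := congrArg (fun r : ℂ => r ^ j) (S2.normSq_axis x)
  simp only [mul_pow] at hx
  simp only [ContinuousMap.mul_apply, ContinuousMap.star_apply, axialC_apply, axial]
  simp [← sub_eq_add_neg, pow_add]
  rw [← hx]
  ring

/-- The functions `p (x₂) * (x₀ + i x₁) ^ k` and their conjugates are closed under
multiplication. -/
lemma mem_closure_axialC {g : C(S2, ℂ)}
    (hg : g ∈ Submonoid.closure (({axialC Polynomial.X 0, axialC 1 1} : Set C(S2, ℂ))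
      ∪ star {axialC Polynomial.X 0, axialC 1 1})) :
    ∃ (p : Polynomial ℝ) (k : ℕ), g = axialC p k ∨ g = star (axialC p k) := by
  induction hg using Submonoid.closure_induction with
  | mem g hg =>
    rcases hg with (rfl | rfl) | hg
    · exact ⟨_, _, Or.inl rfl⟩
    · exact ⟨_, _, Or.inl rfl⟩
    · rcases hg with h | h
      · exact ⟨_, _, Or.inr (by rw [← h, star_star])⟩
      · exact ⟨_, _, Or.inr (by rw [← mem_singleton_iff.1 h, star_star])⟩
  | one => exact ⟨1, 0, Or.inl (by ext x; simp [axialC_apply, axial])⟩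
  | mul g h _ _ ihg ihh =>
    have mixed (p q : Polynomial ℝ) (k j : ℕ) : ∃ (r : Polynomial ℝ) (i : ℕ),
        axialC p k * star (axialC q j) = axialC r i
          ∨ axialC p k * star (axialC q j) = star (axialC r i) := by
      rcases le_total j k with hjk | hkj
      · exact ⟨_, _, Or.inl (axialC_mul_star_axialC p q hjk)⟩
      · refine ⟨q * p * (1 - Polynomial.X ^ 2) ^ k, j - k, Or.inr ?_⟩
        rw [← axialC_mul_star_axialC q p hkj, star_mul, star_star]
    obtain ⟨p, k, rfl | rfl⟩ := ihg <;> obtain ⟨q, j, rfl | rfl⟩ := ihh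
    · exact ⟨_, _, Or.inl (axialC_mul_axialC p q k j)⟩
    · exact mixed p q k j
    · rw [mul_comm]
      exact mixed q p j k
    · refine ⟨p * q, k + j, Or.inr ?_⟩
      rw [← axialC_mul_axialC, star_mul, mul_comm]

/-- Stone–Weierstrass: x₂ and x₀ + i x₁ determine all three coordinates and hence separate points.
-/
lemma starAdjoin_axialC_topologicalClosure :
    (StarAlgebra.adjoin ℂ
      ({axialC Polynomial.X 0, axialC 1 1} : Set C(S2, ℂ))).topologicalClosure = ⊤ := by
  refine ContinuousMap.starSubalgebra_topologicalClosure_eq_top_of_separatesPoints _ ?_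
  intro x y hxy
  have hz : axialC Polynomial.X 0 ∈ StarAlgebra.adjoin ℂ
      ({axialC Polynomial.X 0, axialC 1 1} : Set C(S2, ℂ)) :=
    StarAlgebra.subset_adjoin ℂ _ (by simp)
  have hw : axialC 1 1 ∈ StarAlgebra.adjoin ℂ
      ({axialC Polynomial.X 0, axialC 1 1} : Set C(S2, ℂ)) :=
    StarAlgebra.subset_adjoin ℂ _ (by simp)
  by_contra hcon
  push Not at hcon
  have h1 := hcon _ ⟨_, hz, rfl⟩
  have h2 := hcon _ ⟨_, hw, rfl⟩
  simp only [axialC_apply, axial, Polynomial.eval_X, pow_zero, mul_one, Polynomial.eval_one,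
    Complex.ofReal_one, one_mul, pow_one, Complex.ofReal_inj] at h1 h2
  have h3 := congrArg Complex.re h2
  have h4 := congrArg Complex.im h2
  simp at h3 h4
  refine hxy (Subtype.ext ?_)
  ext i
  fin_cases i
  · exact h3
  · exact h4
  · exact h1

/-- The spherical harmonics are complete in `L²(S²)`. -/
lemma eq_zero_of_coeff_eq_zero {f : L2S}
    (h : ∀ (l : ℕ) (m : ℤ), m ∈ Finset.Icc (-(l : ℤ)) l → coeff l m f = 0) : f = 0 := by
  -- V consists of the continuous functions orthogonal to f. It is closed and contains the
  -- harmonics, hence all functions p(x₂)(x₀ + i x₁)^k and their conjugates. These include every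
  -- product of the generators, so V is everything, and f is orthogonal to a dense set.
  let V : Submodule ℂ C(S2, ℂ) :=
    (ℂ ∙ f)ᗮ.comap (ContinuousMap.toLp (E := ℂ) 2 surf ℂ).toLinearMap
  have hV (g : C(S2, ℂ)) : g ∈ V ↔ inner ℂ f (ContinuousMap.toLp 2 surf ℂ g) = 0 :=
    Submodule.mem_orthogonal_singleton_iff_inner_right
  have hVclosed : IsClosed (V : Set C(S2, ℂ)) :=
    ((ℂ ∙ f).isClosed_orthogonal).preimage (ContinuousMap.toLp (E := ℂ) 2 surf ℂ).continuous
  have hY (l : ℕ) (m : ℤ) (hm : m ∈ Finset.Icc (-(l : ℤ)) l) : sphHarm l m ∈ V := by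
    rw [hV, inner_eq_zero_symm]
    have := h l m hm
    rwa [coeff_eq_inner] at this
  have hlin (k : ℕ) : IsLinearMap ℝ fun p : Polynomial ℝ => axialC p k :=
    { map_add := fun p q => by ext x; exact axial_add p q k x.1
      map_smul := fun c p => by
        ext x
        rw [axialC_apply, axial_smul]
        simp [axialC_apply] }
  have hspan (k : ℕ) (W : Submodule ℝ (Polynomial ℝ))
      (hW : ∀ i : ℕ, rodrigues (i + k) (i + k + k) ∈ W) (p : Polynomial ℝ) : p ∈ W := by
    have : Submodule.span ℝ (range fun i : ℕ => rodrigues (i + k) (i + k + k)) ≤ W :=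
      Submodule.span_le.2 (by rintro _ ⟨i, rfl⟩; exact hW i)
    rw [span_rodrigues_eq_top] at this
    exact this Submodule.mem_top
  have hax (k : ℕ) (p : Polynomial ℝ) : axialC p k ∈ V := by
    refine hspan k ((V.restrictScalars ℝ).comap (hlin k).mk') (fun i => ?_) p
    change axialC _ k ∈ V
    have := hY (i + k) k (by rw [Finset.mem_Icc]; omega)
    rw [sphHarm_natCast] at this
    exact (Submodule.smul_mem_iff _ (by exact_mod_cast sphConst_ne_zero _ _)).1 this
  have hstar (k : ℕ) (p : Polynomial ℝ) : star (axialC p k) ∈ V := by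
    have hlin' : IsLinearMap ℝ fun p : Polynomial ℝ => star (axialC p k) :=
      { map_add := fun p q => by rw [(hlin k).map_add, star_add]
        map_smul := fun c p => by rw [(hlin k).map_smul, star_smul, star_trivial] }
    refine hspan k ((V.restrictScalars ℝ).comap hlin'.mk') (fun i => ?_) p
    change star (axialC _ k) ∈ V
    have := hY (i + k) (-k) (by rw [Finset.mem_Icc]; omega)
    rw [sphHarm_neg_natCast] at this
    refine (Submodule.smul_mem_iff _ ?_).1 this
    exact Complex.ofReal_ne_zero.2
      (mul_ne_zero (pow_ne_zero _ (by norm_num)) (sphConst_ne_zero _ _))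
  have hle : (StarAlgebra.adjoin ℂ
      ({axialC Polynomial.X 0, axialC 1 1} : Set C(S2, ℂ)) : Set C(S2, ℂ)) ⊆ V := by
    intro g hg
    have hg' : g ∈ Subalgebra.toSubmodule (StarAlgebra.adjoin ℂ
      ({axialC Polynomial.X 0, axialC 1 1} : Set C(S2, ℂ))).toSubalgebra := hg
    rw [StarAlgebra.adjoin_eq_span] at hg'
    refine (Submodule.span_le.2 fun g hg => ?_) hg'
    obtain ⟨p, k, rfl | rfl⟩ := mem_closure_axialC hg
    · exact hax k p
    · exact hstar k p
  have hall (g : C(S2, ℂ)) : g ∈ V := by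
    have h1 : g ∈ (StarAlgebra.adjoin ℂ
        ({axialC Polynomial.X 0, axialC 1 1} : Set C(S2, ℂ))).topologicalClosure := by
      rw [starAdjoin_axialC_topologicalClosure]
      exact StarSubalgebra.mem_top
    exact hVclosed.closure_subset_iff.2 hle h1
  have hdense : DenseRange (ContinuousMap.toLp (E := ℂ) 2 surf ℂ) :=
    ContinuousMap.toLp_denseRange ℂ surf ℂ (by norm_num)
  exact hdense.eq_zero_of_inner_left ℂ fun g => (hV g).1 (hall g)

lemma coeff_sphHarmL2 (l l' : ℕ) (m m' : ℤ) :
    coeff l m (sphHarmL2 l' m') = ∫ x, sphHarm l' m' x * conj (sphHarm l m x) ∂surf := by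
  refine integral_congr_ae ?_
  filter_upwards [ContinuousMap.coeFn_toLp (p := 2) (𝕜 := ℂ) surf (sphHarm l' m')] with x hx
  rw [sphHarmL2, hx]

lemma coeff_sphHarmL2_zero (l l' : ℕ) (m : ℤ) :
    coeff l m (sphHarmL2 l' 0) = if l = l' ∧ m = 0 then 1 else 0 := by
  rw [coeff_sphHarmL2]
  split_ifs with h
  · obtain ⟨rfl, rfl⟩ := h
    exact integral_sphHarm_zero_mul_conj l
  · refine integral_sphHarm_mul_conj_of_ne ?_
    by_contra! hcon
    exact h ⟨hcon.1.symm, hcon.2.symm⟩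

lemma orthonormal_zonal : Orthonormal ℂ fun l : ℕ => sphHarmL2 l 0 := by
  rw [orthonormal_iff_ite]
  intro i j
  rw [← coeff_eq_inner, coeff_sphHarmL2_zero]
  simp

/-! ### Zonal series -/

/-- The zonal function `∑ l, c l • Y_{l,0}`. -/
def zonal (c : ℕ → ℂ) : L2S := ∑' l, c l • sphHarmL2 l 0

lemma hasSum_zonal {c : ℕ → ℂ} (hc : Summable fun l => ‖c l‖ ^ 2) :
    HasSum (fun l => c l • sphHarmL2 l 0) (zonal c) :=
  ((orthonormal_zonal.orthogonalFamily.summable_iff_norm_sq_summable c).2 hc).hasSum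

lemma norm_zonal {c : ℕ → ℂ} (hc : Summable fun l => ‖c l‖ ^ 2) :
    ‖zonal c‖ = √(∑' l, ‖c l‖ ^ 2) := by
  have hmem : Memℓp c 2 := (memℓp_gen_iff (by norm_num)).2 (by simpa using hc)
  have h1 := orthonormal_zonal.orthogonalFamily.hasSum_linearIsometry ⟨c, hmem⟩
  rw [(hasSum_zonal hc).unique h1, LinearIsometry.norm_map,
    lp.norm_eq_tsum_rpow (by norm_num), Real.sqrt_eq_rpow]
  simp

lemma coeff_zonal {c : ℕ → ℂ} (hc : Summable fun l => ‖c l‖ ^ 2) (l : ℕ) (m : ℤ) :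
    coeff l m (zonal c) = if m = 0 then c l else 0 := by
  have h1 := (hasSum_zonal hc).mapL (innerSL ℂ (sphHarmL2 l m))
  simp only [innerSL_apply_apply, inner_smul_right, ← coeff_eq_inner, coeff_sphHarmL2_zero] at h1
  refine h1.unique ?_
  have h2 : (fun j => c j * if l = j ∧ m = 0 then (1 : ℂ) else 0)
      = fun j => if j = l then (if m = 0 then c l else 0) else 0 := by
    funext j
    by_cases hj : j = l
    · subst hj
      by_cases hm : m = 0 <;> simp [hm]
    · rw [if_neg (fun h => hj h.1.symm), if_neg hj, mul_zero]
  rw [h2]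
  exact hasSum_ite_eq l _

lemma powerSpectrum_zonal {c : ℕ → ℂ} (hc : Summable fun l => ‖c l‖ ^ 2) (l : ℕ) :
    powerSpectrum l (zonal c) = ‖c l‖ ^ 2 := by
  rw [powerSpectrum, Finset.sum_eq_single 0]
  · rw [coeff_zonal hc, if_pos rfl]
  · intro m _ hm
    rw [coeff_zonal hc, if_neg hm]
    simp
  · intro h
    simp at h

lemma zonal_mem_sobolev_iff {s : ℝ} {c : ℕ → ℂ} (hc : Summable fun l => ‖c l‖ ^ 2) :
    zonal c ∈ sobolev s ↔ Summable fun l : ℕ => ‖c l‖ ^ 2 * (l : ℝ) ^ (2 * s) := by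
  change (Summable fun l : ℕ => powerSpectrum l (zonal c) * (l : ℝ) ^ (2 * s)) ↔ _
  simp only [powerSpectrum_zonal hc]

/-- The coefficients of a zonal function of `H^s(S²)` with zero mean. -/
structure IsSobCoeff (s : ℝ) (c : ℕ → ℂ) : Prop where
  map_zero : c 0 = 0
  summable : Summable fun l : ℕ => ‖c l‖ ^ 2 * (l : ℝ) ^ (2 * s)

lemma norm_sq_le_mul_rpow {s : ℝ} (hs : 0 ≤ s) {c : ℕ → ℂ} (h0 : c 0 = 0) (l : ℕ) :
    ‖c l‖ ^ 2 ≤ ‖c l‖ ^ 2 * (l : ℝ) ^ (2 * s) := by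
  rcases Nat.eq_zero_or_pos l with rfl | hl
  · simp [h0]
  · exact le_mul_of_one_le_right (sq_nonneg _)
      (Real.one_le_rpow (by exact_mod_cast hl) (by positivity))

namespace IsSobCoeff

variable {s : ℝ} {c c' : ℕ → ℂ}

lemma summable_norm_sq (hc : IsSobCoeff s c) (hs : 0 ≤ s) : Summable fun l => ‖c l‖ ^ 2 :=
  hc.summable.of_nonneg_of_le (fun _ => sq_nonneg _) (norm_sq_le_mul_rpow hs hc.map_zero)

lemma of_norm_le (hc : IsSobCoeff s c) (K : ℝ) (h : ∀ l, ‖c' l‖ ≤ K * ‖c l‖) :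
    IsSobCoeff s c' where
  map_zero := by
    have := h 0
    rw [hc.map_zero, norm_zero, mul_zero] at this
    exact norm_le_zero_iff.1 this
  summable := by
    refine (hc.summable.mul_left (K ^ 2)).of_nonneg_of_le (fun l => by positivity) fun l => ?_
    rw [← mul_assoc, ← mul_pow]
    gcongr
    exact h l

lemma sub (hc : IsSobCoeff s c) (hc' : IsSobCoeff s c') : IsSobCoeff s (c - c') where
  map_zero := by simp [hc.map_zero, hc'.map_zero]
  summable := by
    refine ((hc.summable.add hc'.summable).mul_left 2).of_nonneg_of_le
      (fun l => by positivity) fun l => ?_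
    rw [← add_mul, ← mul_assoc]
    gcongr
    have h1 := norm_sub_le (c l) (c' l)
    simp only [Pi.sub_apply]
    nlinarith [norm_nonneg (c l - c' l), sq_nonneg (‖c l‖ - ‖c' l‖)]

end IsSobCoeff

/-- An element of `L²(S²)` in the subspace `H^s(S²)`, as an element of `H^s(S²)`. -/
def Sob.mk {s : ℝ} (f : L2S) (h : f ∈ sobolev s) : Sob s :=
  (⟨f, h⟩ : ↥(sobolev s))

open Classical in
/-- The zonal function with coefficients `c` as an element of `H^s(S²)`, if it is one. -/
def zonalSob (s : ℝ) (c : ℕ → ℂ) : Sob s :=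
  if h : zonal c ∈ sobolev s then Sob.mk (zonal c) h else 0

lemma toL2_zonalSob {s : ℝ} (hs : 0 ≤ s) {c : ℕ → ℂ} (hc : IsSobCoeff s c) :
    (zonalSob s c).toL2 = zonal c := by
  have h : zonal c ∈ sobolev s := (zonal_mem_sobolev_iff (hc.summable_norm_sq hs)).2 hc.summable
  rw [zonalSob, dif_pos h]
  rfl

/-- The coefficient at l = 0 vanishes and l^{2s} ≥ 1 otherwise, so the L² norm is dominated by the
seminorm; this explains the factor 2. -/
lemma norm_zonalSob_le {s : ℝ} (hs : 0 ≤ s) {c : ℕ → ℂ} (hc : IsSobCoeff s c) :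
    ‖zonalSob s c‖ ≤ 2 * √(∑' l : ℕ, ‖c l‖ ^ 2 * (l : ℝ) ^ (2 * s)) := by
  have hc2 := hc.summable_norm_sq hs
  rw [Sob.norm_def, toL2_zonalSob hs hc, norm_zonal hc2, sobSeminorm]
  simp only [powerSpectrum_zonal hc2]
  exact (add_le_add (Real.sqrt_le_sqrt
    (hc2.tsum_le_tsum (norm_sq_le_mul_rpow hs hc.map_zero) hc.summable)) le_rfl).trans (two_mul _).ge

lemma zonalSob_sub {s : ℝ} (hs : 0 ≤ s) {c c' : ℕ → ℂ} (hc : IsSobCoeff s c)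
    (hc' : IsSobCoeff s c') : zonalSob s (c - c') = zonalSob s c - zonalSob s c' := by
  refine Sob.toL2_injective ?_
  rw [map_sub, toL2_zonalSob hs hc, toL2_zonalSob hs hc', toL2_zonalSob hs (hc.sub hc')]
  refine (hasSum_zonal ((hc.sub hc').summable_norm_sq hs)).unique ?_
  convert (hasSum_zonal (hc.summable_norm_sq hs)).sub (hasSum_zonal (hc'.summable_norm_sq hs))
    using 2 with l
  rw [← sub_smul]
  rfl

/-- A zonal function depends continuously on a parameter if its coefficients do and have a
majorant. -/
lemma continuousWithinAt_zonalSob {s : ℝ} (hs : 0 ≤ s) {c : ℝ → ℕ → ℂ} {A : ℕ → ℂ} {K : ℝ}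
    {U : Set ℝ} {t : ℝ} (ht : t ∈ U) (hA : IsSobCoeff s A)
    (hle : ∀ᶠ r in 𝓝[U] t, ∀ l, ‖c r l‖ ≤ K * ‖A l‖)
    (hcont : ∀ l, ContinuousWithinAt (fun r => c r l) U t) :
    ContinuousWithinAt (fun r => zonalSob s (c r)) U t := by
  have htl : ∀ l, ‖c t l‖ ≤ K * ‖A l‖ := hle.self_of_nhdsWithin ht
  rw [ContinuousWithinAt, tendsto_iff_norm_sub_tendsto_zero]
  have hlim : Tendsto (fun r => ∑' l : ℕ, ‖c r l - c t l‖ ^ 2 * (l : ℝ) ^ (2 * s)) (𝓝[U] t)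
      (𝓝 (∑' l : ℕ, (0 : ℝ))) := by
    refine tendsto_tsum_of_dominated_convergence
      (bound := fun l => (2 * K) ^ 2 * (‖A l‖ ^ 2 * (l : ℝ) ^ (2 * s)))
      (hA.summable.mul_left _) (fun l => ?_) ?_
    · have h1 : Tendsto (fun r => c r l - c t l) (𝓝[U] t) (𝓝 (c t l - c t l)) :=
        (hcont l).sub tendsto_const_nhds
      simpa using (h1.norm.pow 2).mul_const ((l : ℝ) ^ (2 * s))
    · filter_upwards [hle] with r hr l
      rw [Real.norm_of_nonneg (by positivity), ← mul_assoc, ← mul_pow]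
      gcongr
      linarith [norm_sub_le (c r l) (c t l), hr l, htl l]
  rw [tsum_zero] at hlim
  have h2 := (hlim.sqrt).const_mul 2
  rw [Real.sqrt_zero, mul_zero] at h2
  refine squeeze_zero' (Eventually.of_forall fun _ => norm_nonneg _) ?_ h2
  filter_upwards [hle] with r hr
  have hcr := hA.of_norm_le K hr
  have hct := hA.of_norm_le K htl
  rw [← zonalSob_sub hs hcr hct]
  exact norm_zonalSob_le hs (hcr.sub hct)

/-! ### The generator on zonal series -/

lemma integral_mul_conj_eq_inner (g : C(S2, ℂ)) (f : L2S) :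
    ∫ x, f x * conj (g x) ∂surf = inner ℂ (ContinuousMap.toLp 2 surf ℂ g) f := by
  rw [L2.inner_def]
  refine integral_congr_ae ?_
  filter_upwards [ContinuousMap.coeFn_toLp (p := 2) (𝕜 := ℂ) surf g] with x hx
  rw [hx]
  simp

lemma integral_sphHarmL2_mul_conj (l : ℕ) (m : ℤ) (g : S2 → ℂ) :
    ∫ x, sphHarmL2 l m x * conj (g x) ∂surf = ∫ x, sphHarm l m x * conj (g x) ∂surf := by
  refine integral_congr_ae ?_
  filter_upwards [ContinuousMap.coeFn_toLp (p := 2) (𝕜 := ℂ) surf (sphHarm l m)] with x hx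
  rw [sphHarmL2, hx]

lemma hasSum_integral_zonal_mul_conj {c : ℕ → ℂ} (hc : Summable fun l => ‖c l‖ ^ 2)
    {g : S2 → ℂ} (hg : Continuous g) :
    HasSum (fun l => c l * ∫ x, sphHarm l 0 x * conj (g x) ∂surf)
      (∫ x, zonal c x * conj (g x) ∂surf) := by
  have h1 := (hasSum_zonal hc).mapL (innerSL ℂ (ContinuousMap.toLp 2 surf ℂ ⟨g, hg⟩))
  simp only [innerSL_apply_apply, inner_smul_right, ← integral_mul_conj_eq_inner,
    ContinuousMap.coe_mk, integral_sphHarmL2_mul_conj] at h1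
  exact h1

/-- Against a C² test function the series may be paired term by term, and each Y_{l,0} carries Δ and
the drift over as eigenvalues. The drift eigenvalue is 0 for m = 0, so the drift part is 0. -/
lemma isGenerator_zonal (μ : ℝ) {c d : ℕ → ℂ} (hc : Summable fun l => ‖c l‖ ^ 2)
    (hd : Summable fun l => ‖d l‖ ^ 2) (h : ∀ l : ℕ, d l = -(l * (l + 1)) * c l) :
    IsGenerator μ (zonal c) (zonal d) := by
  refine ⟨zonal d, 0, fun g hg => ?_, fun g hg => ?_, (add_zero _).symm⟩
  · refine (hasSum_integral_zonal_mul_conj hd hg.continuous).unique ?_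
    convert hasSum_integral_zonal_mul_conj hc (continuous_lapC2 hg) using 2 with l
    rw [integral_sphHarm_mul_conj_lapC2 l 0 hg, h l]
    ring
  · have h1 := hasSum_integral_zonal_mul_conj hc (continuous_driftC1 μ hg)
    simp only [integral_sphHarm_mul_conj_driftC1 μ _ 0 hg, Int.cast_zero, mul_zero, neg_zero,
      zero_mul] at h1
    rw [h1.unique hasSum_zero, neg_zero]
    have h0 : ∀ᵐ x ∂surf, (0 : L2S) x = 0 := Lp.coeFn_zero ℂ 2 surf
    rw [integral_congr_ae (g := fun _ => (0 : ℂ)) (h0.mono fun x hx => by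
      rw [hx, zero_mul]),
      integral_zero]

/-! ### Coefficients as functionals on `H^s(S²)` -/

/-- The inclusion of `H^s(S²)` in `L²(S²)` as a continuous linear map. -/
def Sob.toL2L {s : ℝ} : Sob s →L[ℂ] L2S :=
  Sob.toL2.mkContinuous 1 fun f => by
    rw [Sob.norm_def, one_mul]
    exact le_add_of_nonneg_right (Real.sqrt_nonneg _)

/-- The coefficient `f_{l,m}` as a functional on `H^s(S²)`. -/
def sobCoeff (s : ℝ) (l : ℕ) (m : ℤ) : Sob s →L[ℂ] ℂ :=
  (innerSL ℂ (sphHarmL2 l m)).comp Sob.toL2L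

lemma sobCoeff_apply {s : ℝ} (l : ℕ) (m : ℤ) (f : Sob s) :
    sobCoeff s l m f = coeff l m f.toL2 := (coeff_eq_inner l m _).symm

lemma Sob.ext_coeff {s : ℝ} {f g : Sob s} (h : ∀ l m, sobCoeff s l m f = sobCoeff s l m g) :
    f = g := by
  rw [← sub_eq_zero]
  refine Sob.toL2_injective ?_
  rw [map_zero]
  refine eq_zero_of_coeff_eq_zero fun l m _ => ?_
  rw [← sobCoeff_apply, map_sub, h l m, sub_self]

lemma sobCoeff_zonalSob {s : ℝ} (hs : 0 ≤ s) {c : ℕ → ℂ} (hc : IsSobCoeff s c) (l : ℕ) (m : ℤ) :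
    sobCoeff s l m (zonalSob s c) = if m = 0 then c l else 0 := by
  rw [sobCoeff_apply, toL2_zonalSob hs hc, coeff_zonal (hc.summable_norm_sq hs)]

/-! ### The nonlocal derivative of a power -/

/-- The tail of the Lévy measure of `z ^ α` is the kernel of the Riemann-Liouville integral of
order `1 - α`. -/
lemma IsLevyMeasure.ae_tail_sub_eq {α : ℝ} (hα1 : α < 1) {ν : Measure ℝ}
    (hν : IsLevyMeasure (fun z => z ^ α) ν) {r : ℝ} (hr : 0 ≤ r) :
    ∀ᵐ τ, τ ∈ uIoc 0 r → tail ν (r - τ) = rlKernel (1 - α) (r - τ) := by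
  have h1 := (Measure.measurePreserving_sub_left volume r).quasiMeasurePreserving.ae
    (hν.tail_rpow hα1)
  have h2 : ∀ᵐ τ : ℝ, τ ≠ r := by simp [ae_iff]
  filter_upwards [h1, h2] with τ h3 h4 h5
  rw [uIoc_of_le hr] at h5
  rw [h3 (sub_pos.2 (lt_of_le_of_ne h5.2 h4)), rlKernel]
  ring_nf

section NonlocalIntegral

variable {α : ℝ} {ν : Measure ℝ} {B : Type*} [NormedAddCommGroup B] [NormedSpace ℝ B]

lemma intervalIntegrable_tail_smul (hα1 : α < 1)
    (hν : IsLevyMeasure (fun z => z ^ α) ν) {w : ℝ → B} (hw : ContinuousOn w (Ici 0)) {r : ℝ}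
    (hr : 0 < r) : IntervalIntegrable (fun τ => tail ν (r - τ) • w τ) volume 0 r := by
  refine ((intervalIntegrable_rlKernel_comp_sub (c := 1 - α) (by linarith) hr).smul_continuousOn
    (g := w) (hw.mono fun τ hτ => ?_)).congr_ae ?_
  · rw [uIcc_of_le hr.le] at hτ
    exact hτ.1
  · rw [Filter.EventuallyEq, ae_restrict_iff' measurableSet_uIoc]
    filter_upwards [hν.ae_tail_sub_eq hα1 hr.le] with τ h1 h2
    rw [h1 h2]

lemma integral_tail_smul (hα1 : α < 1) (hν : IsLevyMeasure (fun z => z ^ α) ν) (w : ℝ → B)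
    {r : ℝ} (hr : 0 < r) :
    ∫ τ in (0 : ℝ)..r, tail ν (r - τ) • w τ = ∫ τ in (0 : ℝ)..r, rlKernel (1 - α) (r - τ) • w τ := by
  refine intervalIntegral.integral_congr_ae ?_
  filter_upwards [hν.ae_tail_sub_eq hα1 hr.le] with τ h1 h2
  rw [h1 h2]

end NonlocalIntegral

/-! ### The solution -/

/-- The coefficients of the solution with zonal initial value `∑ l, a l • Y_{l,0}`. -/
def solCoeff (α : ℝ) (a : ℕ → ℂ) (t : ℝ) (l : ℕ) : ℂ :=
  a l * (relaxRate α (l * (l + 1)) t : ℝ)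

/-- The coefficients of the image of the solution under the generator. -/
def solRateCoeff (α : ℝ) (a : ℕ → ℂ) (t : ℝ) (l : ℕ) : ℂ :=
  -(l * (l + 1)) * solCoeff α a t l

lemma natCast_mul_add_one_nonneg (l : ℕ) : (0 : ℝ) ≤ l * (l + 1) := by positivity

lemma norm_neg_natCast_mul_add_one (l : ℕ) : ‖-((l : ℂ) * (l + 1))‖ = (l * (l + 1) : ℝ) := by
  have : (l : ℂ) * (l + 1) = ((l * (l + 1) : ℝ) : ℂ) := by push_cast; ring
  rw [norm_neg, this, Complex.norm_real, Real.norm_of_nonneg (natCast_mul_add_one_nonneg l)]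

lemma solCoeff_zero {α : ℝ} (hα : 0 < α) (a : ℕ → ℂ) : solCoeff α a 0 = a := by
  funext l
  simp [solCoeff, relaxRate_zero hα]

lemma continuousOn_solCoeff {α : ℝ} (hα : 0 < α) (a : ℕ → ℂ) (l : ℕ) :
    ContinuousOn (fun t => solCoeff α a t l) (Ici 0) :=
  continuousOn_const.mul (Complex.continuous_ofReal.comp_continuousOn
    (continuousOn_relaxRate hα (natCast_mul_add_one_nonneg l)))

lemma norm_solCoeff_le {α : ℝ} (hα : 0 < α) (hα1 : α < 1) (a : ℕ → ℂ) {t : ℝ} (ht : 0 ≤ t)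
    (l : ℕ) : ‖solCoeff α a t l‖ ≤ 1 * ‖a l‖ := by
  rw [solCoeff, norm_mul, Complex.norm_real, Real.norm_eq_abs, mul_comm]
  gcongr
  exact abs_relaxRate_le_one hα hα1 (natCast_mul_add_one_nonneg l) ht

lemma norm_solRateCoeff_eq {α : ℝ} (hα : 0 < α) (hα1 : α < 1) (a : ℕ → ℂ) {t : ℝ} (ht : 0 ≤ t)
    (l : ℕ) :
    ‖solRateCoeff α a t l‖ = (l * (l + 1) : ℝ) * relaxRate α (l * (l + 1)) t * ‖a l‖ := by
  rw [solRateCoeff, solCoeff, norm_mul, norm_mul, norm_neg_natCast_mul_add_one, Complex.norm_real,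
    Real.norm_of_nonneg (relaxRate_nonneg hα hα1 (natCast_mul_add_one_nonneg l) ht)]
  ring

lemma norm_solRateCoeff_le {α : ℝ} (hα : 0 < α) (hα1 : α < 1) (a : ℕ → ℂ) {t : ℝ} (ht : 0 < t)
    (l : ℕ) : ‖solRateCoeff α a t l‖ ≤ t ^ (-α) / Real.Gamma (2 - α) * ‖a l‖ := by
  rw [norm_solRateCoeff_eq hα hα1 a ht.le]
  gcongr
  exact mul_relaxRate_le hα hα1 (natCast_mul_add_one_nonneg l) ht

/-- Near a positive time the coefficients of the rate have a common majorant. -/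
lemma eventually_norm_solRateCoeff_le {α : ℝ} (hα : 0 < α) (hα1 : α < 1) (a : ℕ → ℂ) {t : ℝ}
    (ht : 0 < t) : ∀ᶠ r in 𝓝[Ioi 0] t, ∀ l,
      ‖solRateCoeff α a r l‖ ≤ (t / 2) ^ (-α) / Real.Gamma (2 - α) * ‖a l‖ := by
  filter_upwards [mem_nhdsWithin_of_mem_nhds (Ioi_mem_nhds (half_lt_self ht))] with r hr l
  refine (norm_solRateCoeff_le hα hα1 a ((half_pos ht).trans hr) l).trans ?_
  have h1 : r ^ (-α) ≤ (t / 2) ^ (-α) :=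
    Real.rpow_le_rpow_of_nonpos (half_pos ht) (le_of_lt hr) (by linarith)
  have h2 := Real.Gamma_pos_of_pos (show (0 : ℝ) < 2 - α by linarith)
  gcongr

/-- The coefficients of the solution are those of its rate, divided by the eigenvalues. -/
lemma norm_solCoeff_le_norm_solRateCoeff {α : ℝ} {a : ℕ → ℂ} (h0 : a 0 = 0) (t : ℝ) (l : ℕ) :
    ‖solCoeff α a t l‖ ≤ ‖solRateCoeff α a t l‖ / (l : ℝ) ^ 2 := by
  -- At l = 0 the right side is a division by zero, hence 0; the left side vanishes because a 0 = 0.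
  rcases Nat.eq_zero_or_pos l with rfl | hl
  · simp [solCoeff, h0]
  · have hl' : (0 : ℝ) < l := by exact_mod_cast hl
    rw [le_div_iff₀ (by positivity), solRateCoeff, norm_mul,
      norm_neg_natCast_mul_add_one, mul_comm]
    gcongr
    nlinarith

/-! ### Regularity of the zonal series and the equation in H^s -/

section Solution

variable {α s : ℝ} {a : ℕ → ℂ}

lemma isSobCoeff_solCoeff (hα : 0 < α) (hα1 : α < 1) (ha : IsSobCoeff s a) {t : ℝ} (ht : 0 ≤ t) :
    IsSobCoeff s (solCoeff α a t) :=
  ha.of_norm_le 1 (norm_solCoeff_le hα hα1 a ht)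

lemma isSobCoeff_solRateCoeff (hα : 0 < α) (hα1 : α < 1) (ha : IsSobCoeff s a) {t : ℝ}
    (ht : 0 < t) : IsSobCoeff s (solRateCoeff α a t) :=
  ha.of_norm_le _ (norm_solRateCoeff_le hα hα1 a ht)

lemma continuousOn_zonalSob_solCoeff (hα : 0 < α) (hα1 : α < 1) (hs : 0 ≤ s)
    (ha : IsSobCoeff s a) : ContinuousOn (fun t => zonalSob s (solCoeff α a t)) (Ici 0) :=
  fun t ht => continuousWithinAt_zonalSob hs ht ha
    (eventually_mem_nhdsWithin.mono fun _ hr => norm_solCoeff_le hα hα1 a hr)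
    fun l => continuousOn_solCoeff hα a l t ht

lemma continuousOn_zonalSob_solRateCoeff (hα : 0 < α) (hα1 : α < 1) (hs : 0 ≤ s)
    (ha : IsSobCoeff s a) : ContinuousOn (fun t => zonalSob s (solRateCoeff α a t)) (Ioi 0) :=
  fun t ht => continuousWithinAt_zonalSob hs ht ha (eventually_norm_solRateCoeff_le hα hα1 a ht)
    fun l => continuousWithinAt_const.mul
      ((continuousOn_solCoeff hα a l t (Ioi_subset_Ici_self ht)).mono Ioi_subset_Ici_self)

/-- Provides the majorant in H^{s+2}: l(l+1) times a solution coefficient is bounded by a multiple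
of a_l, locally uniformly in t > 0. -/
lemma IsSobCoeff.div_sq (ha : IsSobCoeff s a) : IsSobCoeff (s + 2) fun l => a l / (l : ℂ) ^ 2 where
  map_zero := by simp
  summable := by
    refine ha.summable.congr fun l => ?_
    rcases Nat.eq_zero_or_pos l with rfl | hl
    · simp [ha.map_zero]
    · have hl' : (0 : ℝ) < l := by exact_mod_cast hl
      have h1 : (l : ℝ) ^ (2 * (s + 2)) = (l : ℝ) ^ (2 * s) * (l : ℝ) ^ 4 := by
        rw [← Real.rpow_natCast, ← Real.rpow_add hl']
        norm_num
        ring_nf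
      rw [h1, norm_div, norm_pow, Complex.norm_natCast]
      field_simp

lemma norm_solCoeff_le_div_sq {K : ℝ} (h0 : a 0 = 0) {t : ℝ}
    (h : ∀ l, ‖solRateCoeff α a t l‖ ≤ K * ‖a l‖) (l : ℕ) :
    ‖solCoeff α a t l‖ ≤ K * ‖a l / (l : ℂ) ^ 2‖ := by
  refine (norm_solCoeff_le_norm_solRateCoeff h0 t l).trans ?_
  rw [norm_div, norm_pow, Complex.norm_natCast, ← mul_div_assoc]
  gcongr
  exact h l

lemma isSobCoeff_add_two_solCoeff (hα : 0 < α) (hα1 : α < 1) (ha : IsSobCoeff s a) {t : ℝ}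
    (ht : 0 < t) : IsSobCoeff (s + 2) (solCoeff α a t) :=
  ha.div_sq.of_norm_le _
    (norm_solCoeff_le_div_sq ha.map_zero (norm_solRateCoeff_le hα hα1 a ht))

lemma continuousOn_zonalSob_add_two_solCoeff (hα : 0 < α) (hα1 : α < 1) (hs : 0 ≤ s)
    (ha : IsSobCoeff s a) : ContinuousOn (fun t => zonalSob (s + 2) (solCoeff α a t)) (Ioi 0) :=
  fun t ht => continuousWithinAt_zonalSob (by linarith) ht ha.div_sq
    ((eventually_norm_solRateCoeff_le hα hα1 a ht).mono fun _ hr =>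
      norm_solCoeff_le_div_sq ha.map_zero hr)
    fun l => (continuousOn_solCoeff hα a l t (Ioi_subset_Ici_self ht)).mono Ioi_subset_Ici_self

lemma intervalIntegrable_zonalSob_solRateCoeff (hα : 0 < α) (hα1 : α < 1) (hs : 0 ≤ s)
    (ha : IsSobCoeff s a) {r : ℝ} (hr : 0 < r) :
    IntervalIntegrable (fun τ => zonalSob s (solRateCoeff α a τ)) volume 0 r := by
  -- The rate may blow up at 0, but not faster than τ^{-α}, which is integrable as α < 1.
  have h1 : IntervalIntegrable (fun τ : ℝ => 2 * √(∑' l : ℕ, ‖a l‖ ^ 2 * (l : ℝ) ^ (2 * s))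
      / Real.Gamma (2 - α) * τ ^ (-α)) volume 0 r :=
    (intervalIntegral.intervalIntegrable_rpow' (by linarith)).const_mul _
  refine h1.mono_fun' ?_ ?_
  · rw [uIoc_of_le hr.le]
    exact ((continuousOn_zonalSob_solRateCoeff hα hα1 hs ha).mono
      fun τ hτ => hτ.1).aestronglyMeasurable measurableSet_Ioc
  · rw [Filter.EventuallyLE, ae_restrict_iff' measurableSet_uIoc]
    refine Eventually.of_forall fun τ hτ => ?_
    rw [uIoc_of_le hr.le] at hτ
    have hτ0 : 0 < τ := hτ.1
    have hK : 0 ≤ τ ^ (-α) / Real.Gamma (2 - α) :=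
      div_nonneg (Real.rpow_nonneg hτ0.le _) (Real.Gamma_pos_of_pos (by linarith)).le
    have hd := isSobCoeff_solRateCoeff hα hα1 ha hτ0
    calc ‖zonalSob s (solRateCoeff α a τ)‖
        ≤ 2 * √(∑' l : ℕ, ‖solRateCoeff α a τ l‖ ^ 2 * (l : ℝ) ^ (2 * s)) :=
          norm_zonalSob_le hs hd
      _ ≤ 2 * √(∑' l : ℕ, (τ ^ (-α) / Real.Gamma (2 - α)) ^ 2
            * (‖a l‖ ^ 2 * (l : ℝ) ^ (2 * s))) := by
          gcongr 2 * √?_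
          refine hd.summable.tsum_le_tsum (fun l => ?_) (ha.summable.mul_left _)
          rw [← mul_assoc, ← mul_pow]
          gcongr
          exact norm_solRateCoeff_le hα hα1 a hτ0 l
      _ = _ := by
          rw [tsum_mul_left, Real.sqrt_mul (sq_nonneg _), Real.sqrt_sq hK]
          ring

/-- The integrated form of the equation. -/
lemma integral_tail_smul_zonalSob {ν : Measure ℝ} (hα : 0 < α) (hα1 : α < 1)
    (hν : IsLevyMeasure (fun z => z ^ α) ν) (hs : 0 ≤ s) (ha : IsSobCoeff s a) {r : ℝ}
    (hr : 0 < r) :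
    ∫ τ in (0 : ℝ)..r, tail ν (r - τ) • (zonalSob s (solCoeff α a τ) - zonalSob s a)
      = ∫ τ in (0 : ℝ)..r, zonalSob s (solRateCoeff α a τ) := by
  -- Coefficients determine an element of H^s and commute with Bochner integrals. What remains is
  -- the scalar relaxation equation for m = 0 and 0 = 0 otherwise.
  refine Sob.ext_coeff fun l m => ?_
  have hw : ContinuousOn (fun τ => zonalSob s (solCoeff α a τ) - zonalSob s a) (Ici 0) :=
    (continuousOn_zonalSob_solCoeff hα hα1 hs ha).sub continuousOn_const
  rw [← (sobCoeff s l m).intervalIntegral_comp_comm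
      (intervalIntegrable_tail_smul hα1 hν hw hr),
    ← (sobCoeff s l m).intervalIntegral_comp_comm
      (intervalIntegrable_zonalSob_solRateCoeff hα hα1 hs ha hr)]
  simp only [ContinuousLinearMap.map_smul_of_tower]
  rw [integral_tail_smul hα1 hν _ hr]
  have h1 : ∫ τ in (0 : ℝ)..r, rlKernel (1 - α) (r - τ) •
      sobCoeff s l m (zonalSob s (solCoeff α a τ) - zonalSob s a)
      = ∫ τ in (0 : ℝ)..r, (if m = 0 then -a l else 0) *
        ((rlKernel (1 - α) (r - τ) * (1 - relaxRate α (l * (l + 1)) τ) : ℝ) : ℂ) := by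
    refine intervalIntegral.integral_congr fun τ hτ => ?_
    rw [uIcc_of_le hr.le] at hτ
    simp only [map_sub]
    rw [sobCoeff_zonalSob hs (isSobCoeff_solCoeff hα hα1 ha hτ.1), sobCoeff_zonalSob hs ha,
      Complex.real_smul, solCoeff]
    split_ifs
    · push_cast; ring
    · simp
  have h2 : ∫ τ in (0 : ℝ)..r, sobCoeff s l m (zonalSob s (solRateCoeff α a τ))
      = ∫ τ in (0 : ℝ)..r, (if m = 0 then -a l * (l * (l + 1)) else 0) *
        ((relaxRate α (l * (l + 1)) τ : ℝ) : ℂ) := by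
    refine intervalIntegral.integral_congr_ae (Eventually.of_forall fun τ hτ => ?_)
    rw [uIoc_of_le hr.le] at hτ
    rw [sobCoeff_zonalSob hs (isSobCoeff_solRateCoeff hα hα1 ha hτ.1), solRateCoeff, solCoeff]
    split_ifs
    · ring
    · simp
  rw [h1, h2, intervalIntegral.integral_const_mul, intervalIntegral.integral_const_mul,
    intervalIntegral.integral_ofReal, intervalIntegral.integral_ofReal,
    integral_rlKernel_mul_one_sub_relaxRate hα hα1 (natCast_mul_add_one_nonneg l) hr]
  split_ifs
  · push_cast; ring
  · simp

/-- By the integrated equation the convolution is a primitive of the rate, which is continuous on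
(0, ∞) in H^s. -/
lemma hasNonlocalDerivAt_zonalSob {ν : Measure ℝ} (hα : 0 < α) (hα1 : α < 1)
    (hν : IsLevyMeasure (fun z => z ^ α) ν) (hs : 0 ≤ s) (ha : IsSobCoeff s a) {t : ℝ}
    (ht : 0 < t) :
    HasNonlocalDerivAt ν (fun t => zonalSob s (solCoeff α a t)) (zonalSob s (solRateCoeff α a t))
      t := by
  have hcont := continuousOn_zonalSob_solCoeff hα hα1 hs ha
  refine ⟨zonalSob s a, ?_, ?_, ?_⟩
  · have h1 := (hcont 0 self_mem_Ici).mono_left (nhdsWithin_mono 0 Ioi_subset_Ici_self)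
    simpa only [solCoeff_zero hα] using h1
  · filter_upwards [Ioi_mem_nhds ht] with r hr
    exact intervalIntegrable_tail_smul hα1 hν
      (w := fun τ => zonalSob s (solCoeff α a τ) - zonalSob s a)
      (hcont.sub continuousOn_const) hr
  · have hc := continuousOn_zonalSob_solRateCoeff hα hα1 hs ha
    have h1 := intervalIntegral.integral_hasDerivAt_right
      (intervalIntegrable_zonalSob_solRateCoeff hα hα1 hs ha ht)
      (hc.stronglyMeasurableAtFilter isOpen_Ioi t ht) (hc.continuousAt (Ioi_mem_nhds ht))
    refine h1.congr_of_eventuallyEq ?_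
    filter_upwards [Ioi_mem_nhds ht] with r hr
    exact integral_tail_smul_zonalSob hα hα1 hν hs ha hr

/-- The zonal series with relaxing coefficients is a strong solution. -/
theorem isStrongSolution_zonalSob (μ : ℝ) {ν : Measure ℝ} (hα : 0 < α) (hα1 : α < 1)
    (hν : IsLevyMeasure (fun z => z ^ α) ν) (hs : 0 ≤ s) (ha : IsSobCoeff s a) :
    IsStrongSolution μ ν (zonalSob s a) fun t => zonalSob s (solCoeff α a t) where
  continuousOn := continuousOn_zonalSob_solCoeff hα hα1 hs ha
  smoothing := by
    refine ⟨_, continuousOn_zonalSob_add_two_solCoeff hα hα1 hs ha, fun t ht => ?_⟩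
    rw [toL2_zonalSob (by linarith) (isSobCoeff_add_two_solCoeff hα hα1 ha ht),
      toL2_zonalSob hs (isSobCoeff_solCoeff hα hα1 ha ht.le)]
  equation := by
    refine ⟨_, continuousOn_zonalSob_solRateCoeff hα hα1 hs ha,
      fun t ht => ⟨hasNonlocalDerivAt_zonalSob hα hα1 hν hs ha ht, ?_⟩⟩
    have hc := isSobCoeff_solCoeff hα hα1 ha ht.le
    have hd := isSobCoeff_solRateCoeff hα hα1 ha ht
    rw [toL2_zonalSob hs hc, toL2_zonalSob hs hd]
    exact isGenerator_zonal μ (hc.summable_norm_sq hs) (hd.summable_norm_sq hs) fun _ => rfl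
  initial := by rw [solCoeff_zero hα]

end Solution

/-! ### Uniqueness -/

section Uniqueness

variable {α s μ : ℝ} {ν : Measure ℝ} {f : Sob s} {u v : ℝ → Sob s}

lemma IsStrongSolution.hasDerivAt_integral_coeff (hα1 : α < 1)
    (hν : IsLevyMeasure (fun z => z ^ α) ν) (hu : IsStrongSolution μ ν f u) (l : ℕ) (m : ℤ)
    {t : ℝ} (ht : 0 < t) :
    HasDerivAt (fun r => ∫ τ in (0 : ℝ)..r, rlKernel (1 - α) (r - τ) • sobCoeff s l m (u τ - f))
      ((-(l * (l + 1)) + Complex.I * μ * m) * sobCoeff s l m (u t)) t := by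
  obtain ⟨d, -, hd⟩ := hu.equation
  obtain ⟨⟨u₀, hu₀, hint, hder⟩, hgen⟩ := hd t ht
  have h0 := (hu.continuousOn 0 self_mem_Ici).mono_left
    (nhdsWithin_mono (0 : ℝ) Ioi_subset_Ici_self)
  rw [hu.initial] at h0
  -- Continuity at 0 identifies the limit u(0+) in the definition of the derivative with the initial
  -- value f.
  obtain rfl := tendsto_nhds_unique hu₀ h0
  have h1 := ((sobCoeff s l m).restrictScalars ℝ).hasFDerivAt.comp_hasDerivAt t hder
  simp only [ContinuousLinearMap.coe_restrictScalars', Function.comp_def] at h1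
  rw [sobCoeff_apply, hgen.coeff_eq, ← sobCoeff_apply] at h1
  refine h1.congr_of_eventuallyEq ?_
  filter_upwards [Ioi_mem_nhds ht, hint] with r hr hi
  rw [← integral_tail_smul hα1 hν _ hr, ← (sobCoeff s l m).intervalIntegral_comp_comm hi]
  simp only [ContinuousLinearMap.map_smul_of_tower]

/-- Both solutions subtract the same f inside the convolution, so the difference of their (l, m)
coefficients solves the homogeneous scalar equation. -/
theorem IsStrongSolution.eqOn (hα : 0 < α) (hα1 : α < 1) (hν : IsLevyMeasure (fun z => z ^ α) ν)
    (hu : IsStrongSolution μ ν f u) (hv : IsStrongSolution μ ν f v) : EqOn v u (Ici 0) := by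
  intro t ht
  rcases (mem_Ici.1 ht).eq_or_lt with rfl | ht0
  · rw [hu.initial, hv.initial]
  refine Sob.ext_coeff fun l m => ?_
  rw [← sub_eq_zero]
  have hcu : ContinuousOn (fun τ => sobCoeff s l m (u τ - f)) (Ici 0) :=
    (sobCoeff s l m).continuous.comp_continuousOn (hu.continuousOn.sub continuousOn_const)
  have hcv : ContinuousOn (fun τ => sobCoeff s l m (v τ - f)) (Ici 0) :=
    (sobCoeff s l m).continuous.comp_continuousOn (hv.continuousOn.sub continuousOn_const)
  have hc : ContinuousOn (fun τ => sobCoeff s l m (v τ) - sobCoeff s l m (u τ)) (Ici 0) :=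
    (hcv.sub hcu).congr fun τ _ => by simp
  refine eq_zero_of_hasDerivAt_integral_rlKernel hα hα1 (-(l * (l + 1)) + Complex.I * μ * m) hc
    (fun r hr => ?_) t ht0
  have h1 := (hv.hasDerivAt_integral_coeff hα1 hν l m hr).sub
    (hu.hasDerivAt_integral_coeff hα1 hν l m hr)
  rw [← mul_sub] at h1
  refine h1.congr_of_eventuallyEq ?_
  have hk {w : ℝ → ℂ} (hw : ContinuousOn w (Ici 0)) {q : ℝ} (hq : 0 < q) :
      IntervalIntegrable (fun τ => rlKernel (1 - α) (q - τ) • w τ) volume 0 q :=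
    (intervalIntegrable_rlKernel_comp_sub (by linarith) hq).smul_continuousOn
      (hw.mono fun τ hτ => by rw [uIcc_of_le hq.le] at hτ; exact hτ.1)
  filter_upwards [Ioi_mem_nhds hr] with q hq
  rw [Pi.sub_apply, ← intervalIntegral.integral_sub (hk hcv hq) (hk hcu hq)]
  refine intervalIntegral.integral_congr fun τ _ => ?_
  simp only [map_sub, smul_sub]
  ring

end Uniqueness

/-! ### The initial value -/

/-- Cauchy condensation turns the series into a multiple of ∑ 1/k². -/
lemma summable_one_div_mul_log_sq : Summable fun n : ℕ => 1 / ((n : ℝ) * Real.log n ^ 2) := by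
  rw [← summable_condensed_iff_of_eventually_nonneg (Eventually.of_forall fun n => by
    simp only [Pi.zero_apply]; positivity)]
  · refine ((Real.summable_one_div_nat_pow.2 one_lt_two).mul_left
      (1 / Real.log 2 ^ 2)).congr fun k => ?_
    rw [Nat.cast_pow, Nat.cast_ofNat, Real.log_pow]
    field_simp
  · filter_upwards [eventually_ge_atTop 2] with k hk
    have hk' : (2 : ℝ) ≤ k := by exact_mod_cast hk
    have hlog : 0 < Real.log k := Real.log_pos (by linarith)
    push_cast
    gcongr <;> linarith

/-- The coefficients `1 / (l ^ (s + 1 / 2) * log l)`; they vanish for `l = 0` and `l = 1`. -/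
def initCoeff (s : ℝ) (l : ℕ) : ℂ := ((1 / ((l : ℝ) ^ (s + 1 / 2) * Real.log l) : ℝ) : ℂ)

lemma norm_initCoeff_sq_mul_rpow (s : ℝ) (l : ℕ) :
    ‖initCoeff s l‖ ^ 2 * (l : ℝ) ^ (2 * s) = 1 / ((l : ℝ) * Real.log l ^ 2) := by
  rcases Nat.eq_zero_or_pos l with rfl | hl
  · simp [initCoeff]
  · have hl' : (0 : ℝ) < l := by exact_mod_cast hl
    have h1 : ((l : ℝ) ^ (s + 1 / 2)) ^ 2 = (l : ℝ) ^ (2 * s) * l := by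
      rw [← Real.rpow_natCast, ← Real.rpow_mul hl'.le, ← Real.rpow_add_one hl'.ne']
      norm_num
      ring_nf
    rw [initCoeff, Complex.norm_real, Real.norm_eq_abs, sq_abs, div_pow, mul_pow, h1]
    have := (Real.rpow_pos_of_pos hl' (2 * s)).ne'
    field_simp

lemma isSobCoeff_initCoeff (s : ℝ) : IsSobCoeff s (initCoeff s) where
  map_zero := by simp [initCoeff]
  summable := by
    simp only [norm_initCoeff_sq_mul_rpow]
    exact summable_one_div_mul_log_sq

/-- The terms l = 0, 1 vanish, since log 0 = log 1 = 0 and 1/0 = 0 by convention, so the full zonal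
series is the series from l = 2. -/
lemma hasSum_initCoeff {s : ℝ} (hs : 0 ≤ s) :
    HasSum (fun k : ℕ => (((1 / ((k + 2 : ℝ) ^ (s + 1 / 2) * Real.log (k + 2)) : ℝ)) : ℂ) •
      sphHarmL2 (k + 2) 0) (zonalSob s (initCoeff s)).toL2 := by
  have ha := isSobCoeff_initCoeff s
  have h1 := (hasSum_nat_add_iff' 2).2 (hasSum_zonal (ha.summable_norm_sq hs))
  rw [toL2_zonalSob hs ha]
  simpa [Finset.sum_range_succ, initCoeff] using h1

/-! ### Failure of further smoothing -/

/-- The relaxation rate at the eigenvalues decays no faster than their inverses. -/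
lemma exists_div_sq_le_relaxRate {α : ℝ} (hα : 0 < α) (hα1 : α < 1) {t : ℝ} (ht : 0 < t) :
    ∃ c > 0, ∀ l : ℕ, 0 < l → c / (l : ℝ) ^ 2 ≤ relaxRate α (l * (l + 1)) t := by
  obtain ⟨c, hc, h⟩ := exists_le_relaxRate hα hα1
  have htα : 0 < t ^ α := Real.rpow_pos_of_pos ht α
  refine ⟨c / (1 + 2 * t ^ α), by positivity, fun l hl => ?_⟩
  have hl' : (1 : ℝ) ≤ l := by exact_mod_cast hl
  refine le_trans ?_ (h _ t (by positivity) ht)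
  rw [div_div]
  gcongr
  nlinarith [mul_le_mul_of_nonneg_right (show (l : ℝ) * (l + 1) ≤ 2 * l ^ 2 by nlinarith) htα.le]

theorem zonal_solCoeff_initCoeff_notMem_sobolev {α s : ℝ} (hα : 0 < α) (hα1 : α < 1)
    (hs : 0 ≤ s) {t ε : ℝ} (ht : 0 < t) (hε : 0 < ε) :
    zonal (solCoeff α (initCoeff s) t) ∉ sobolev (s + 2 + ε) := by
  rw [zonal_mem_sobolev_iff
    ((isSobCoeff_solCoeff hα hα1 (isSobCoeff_initCoeff s) ht.le).summable_norm_sq hs)]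
  intro hsum
  obtain ⟨c, hc, h⟩ := exists_div_sq_le_relaxRate hα hα1 ht
  -- The extra weight l^{2ε} absorbs log² l, so the terms eventually dominate c²/l, a divergent
  -- series.
  have hlog : ∀ᶠ l : ℕ in atTop, Real.log l ≤ (l : ℝ) ^ ε := by
    have h1 := ((isLittleO_log_rpow_atTop hε).comp_tendsto tendsto_natCast_atTop_atTop).bound
      one_pos
    filter_upwards [h1] with l hl
    rw [one_mul, Function.comp_apply, Function.comp_apply, Real.norm_eq_abs, Real.norm_of_nonneg
      (Real.rpow_nonneg (Nat.cast_nonneg l) ε)] at hl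
    exact (le_abs_self _).trans hl
  refine Real.not_summable_natCast_inv ((summable_mul_left_iff (pow_ne_zero 2 hc.ne')).1
    (Summable.of_norm_bounded_eventually_nat hsum ?_))
  filter_upwards [hlog, eventually_ge_atTop 2] with l hl hl2
  have hl1 : (2 : ℝ) ≤ l := by exact_mod_cast hl2
  have hl0 : (0 : ℝ) < l := by linarith
  have hlogpos : 0 < Real.log l := Real.log_pos (by linarith)
  have h1 : (l : ℝ) ^ (2 * (s + 2 + ε)) = (l : ℝ) ^ (2 * s) * l ^ 4 * ((l : ℝ) ^ ε) ^ 2 := by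
    rw [← Real.rpow_natCast, ← Real.rpow_natCast, ← Real.rpow_mul hl0.le, ← Real.rpow_add hl0,
      ← Real.rpow_add hl0]
    norm_num
    ring_nf
  rw [Real.norm_of_nonneg (by positivity), solCoeff, norm_mul, Complex.norm_real, mul_pow, h1,
    show ∀ x y p q r : ℝ, x * y * (p * q * r) = x * p * (y * q * r) by intros; ring,
    norm_initCoeff_sq_mul_rpow]
  calc c ^ 2 * (l : ℝ)⁻¹
      ≤ (1 / ((l : ℝ) * Real.log l ^ 2)) * ((c / (l : ℝ) ^ 2) ^ 2 * l ^ 4 * Real.log l ^ 2) := by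
        apply le_of_eq
        field_simp
    _ ≤ _ := by
        rw [Real.norm_eq_abs, sq_abs]
        gcongr
        exact h l (by omega)

end

end SphereKolmogorov

/-! ### The proposition -/

theorem proposition3p2 (α : ℝ) (hα0 : 0 < α) (hα1 : α < 1)
    (ν : MeasureTheory.Measure ℝ)
    (hν : SphereKolmogorov.IsLevyMeasure (fun z : ℝ => z ^ α) ν)
    (μ : ℝ) (s : ℝ) (hs : 1 < s) :
    ∃ f : SphereKolmogorov.Sob s,
      HasSum (fun k : ℕ =>
          (((1 / ((k + 2 : ℝ) ^ (s + 1 / 2) * Real.log (k + 2)) : ℝ)) : ℂ) •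
            SphereKolmogorov.sphHarmL2 (k + 2) 0)
        f.toL2 ∧
      ∃ u : ℝ → SphereKolmogorov.Sob s,
        SphereKolmogorov.IsStrongSolution μ ν f u ∧
        (∀ v : ℝ → SphereKolmogorov.Sob s,
          SphereKolmogorov.IsStrongSolution μ ν f v → Set.EqOn v u (Set.Ici 0)) ∧
        ∀ t : ℝ, 0 < t → ∀ ε : ℝ, 0 < ε →
          (u t).toL2 ∉ SphereKolmogorov.sobolev (s + 2 + ε) := by
  have hs0 : 0 ≤ s := by linarith
  have ha := SphereKolmogorov.isSobCoeff_initCoeff s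
  have hu := SphereKolmogorov.isStrongSolution_zonalSob μ hα0 hα1 hν hs0 ha
  refine ⟨_, SphereKolmogorov.hasSum_initCoeff hs0, _, hu,
    fun v hv => hu.eqOn hα0 hα1 hν hv, fun t ht ε hε => ?_⟩
  rw [SphereKolmogorov.toL2_zonalSob hs0
    (SphereKolmogorov.isSobCoeff_solCoeff hα0 hα1 ha ht.le)]
  exact SphereKolmogorov.zonal_solCoeff_initCoeff_notMem_sobolev hα0 hα1 hs0 ht hε
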